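/- Let $\tilde A$ be an abelian group, $A\le\tilde A$ a subgroup, and $V$ a strongly $A$-graded Möbius (or conformal) vertex algebra: besides its $\mathbb Z$-grading by $L(0)$-eigenspaces $V_{(n)}$, $V$ has a compatible $A$-grading $V=\coprod_{\alpha\in A}V^{(\alpha)}$, preserved by $L(-1),L(0),L(1)$, with $\mathbf 1\in V^{(0)}$ (and $\omega\in V^{(0)}$ in the conformal case), $v_lV^{(\beta)}\subset V^{(\alpha+\beta)}$ for $v\in V^{(\alpha)}$, $l\in\mathbb Z$, $\dim (V_{(n)}\cap V^{(\alpha)})<\infty$, and $V_{(n)}\cap V^{(\alpha)}=0$ for $n\ll 0$. Let $W_1,W_2,W_3$ be strongly $\tilde A$-graded generalized $V$-modules: $W_i=\coprod_{n\in\mathbb C}(W_i)_{[n]}$ is the direct sum of its generalized $L(0)$-eigenspaces, with a compatible $\tilde A$-grading preserved by $L(-1),L(0),L(1)$, such that $v_lW_i^{(\beta)}\subset W_i^{(\alpha+\beta)}$ for $v\in V^{(\alpha)}$, each $(W_i)^{(\beta)}_{[n]}=(W_i)_{[n]}\cap W_i^{(\beta)}$ is finite-dimensional, and $(W_i)^{(\beta)}_{[n+k]}=0$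 for $k\in\mathbb Z$, $k\ll0$. For such a module $W$, let $W'=\coprod_{\beta,n}(W_{[n]}^{(\beta)})^*\subset W^*$ be its contragredient, with $(W')^{(\beta)}=\coprod_n(W_{[n]}^{(-\beta)})^*$, $\langle Y'(v,x)w',w\rangle=\langle w',Y(e^{xL(1)}(-x^{-2})^{L(0)}v,x^{-1})w\rangle$ and $\langle L'(j)w',w\rangle=\langle w',L(-j)w\rangle$ for $j=0,\pm1$; it is again a strongly $\tilde A$-graded generalized $V$-module, and $W$ is identified with $W''$ by evaluation, $w\mapsto(w'\mapsto\langle w',w\rangle)$. A logarithmic intertwining operator of type $\binom{W_3}{W_1\,W_2}$ is a linear map $\mathcal Y(\cdot,x)\cdot:W_1\otimes W_2\to W_3[\log x]\{x\}$, $\mathcal Y(w_1,x)w_2=\sum_{n\in\mathbb C}\sum_{k\in\mathbb N}(w_1)^{\mathcal Y}_{n;k}w_2\,x^{-n-1}(\log x)^k$ (for each $n$ only finitely many $k$ contribute), such that: for all $w_1,w_2,n$, $(w_1)^{\mathcal Y}_{n+m;k}w_2=0$ for all sufficiently large $m\in\mathbb N$, independently of $k$; the Jacobi identity $$x_0^{-1}\delta\!\left(\tfrac{x_1-x_2}{x_0}\right)Y_3(v,x_1)\mathcal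 Y(w_1,x_2)w_2-x_0^{-1}\delta\!\left(\tfrac{x_2-x_1}{-x_0}\right)\mathcal Y(w_1,x_2)Y_2(v,x_1)w_2=x_2^{-1}\delta\!\left(\tfrac{x_1-x_0}{x_2}\right)\mathcal Y(Y_1(v,x_0)w_1,x_2)w_2$$ holds for all $v\in V$; $\mathcal Y(L(-1)w_1,x)=\frac{d}{dx}\mathcal Y(w_1,x)$; and $[L(j),\mathcal Y(w_1,x)]=\sum_{i=0}^{j+1}\binom{j+1}{i}x^i\mathcal Y(L(j-i)w_1,x)$ for $j=-1,0,1$. It is grading-compatible if $(w_1)^{\mathcal Y}_{n;k}w_2\in W_3^{(\beta+\gamma)}$ for all $w_1\in W_1^{(\beta)}$, $w_2\in W_2^{(\gamma)}$, $n\in\mathbb C$, $k\in\mathbb N$. Let $\mathcal V_{W_1W_2}^{W_3}$ be the vector space of grading-compatible logarithmic intertwining operators of type $\binom{W_3}{W_1\,W_2}$, and let $N_{W_1W_2}^{W_3}$ be its dimension. For $r\in\mathbb Z$ and $\mathcal Y\in\mathcal V_{W_1W_2}^{W_3}$ define the $r$-contragredient operator $A_r(\mathcal Y)$ on $W_1\otimes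 W_3'$ by $$\langle A_r(\mathcal Y)(w_1,x)w_3',w_2\rangle=\langle w_3',\mathcal Y(e^{xL(1)}e^{(2r+1)\pi iL(0)}(x^{-L(0)})^2w_1,x^{-1})w_2\rangle .$$ Here, for $w$ of generalized weight $h$, $x^{-L(0)}w=x^{-h}e^{-(\log x)(L(0)-h)}w$ and $e^{aL(0)}w=e^{ah}e^{a(L(0)-h)}w$ (terminating exponential series), and $x\mapsto x^{-1}$ means $x^n(\log x)^k\mapsto x^{-n}(-\log x)^k$. Then for every $r\in\mathbb Z$ and every $\mathcal Y\in\mathcal V_{W_1W_2}^{W_3}$, $A_r(\mathcal Y)$ is a grading-compatible logarithmic intertwining operator of type $\binom{W_2'}{W_1\,W_3'}$. Moreover, under the identifications $W_2''=W_2$ and $W_3''=W_3$, $$A_{-r-1}(A_r(\mathcal Y))=A_r(A_{-r-1}(\mathcal Y))=\mathcal Y .$$ In particular, $\mathcal Y\mapsto A_r(\mathcal Y)$ is a linear isomorphism from $\mathcal V_{W_1W_2}^{W_3}$ onto $\mathcal V_{W_1W_3'}^{W_2'}$, and $N_{W_1W_2}^{W_3}=N_{W_1W_3'}^{W_2'}$.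 -/

import Mathlib

namespace LogVA

noncomputable section

/-! ### Direct sums and locally nilpotent exponentials -/

/-- `W = ∐ᵢ p i` (internal direct sum of subspaces). -/
def IsDirectSum {ι W : Type*} [AddCommGroup W] [Module ℂ W] (p : ι → Submodule ℂ W) : Prop :=
  iSupIndep p ∧ ⨆ i, p i = ⊤

open Classical in
theorem IsDirectSum.bijective {ι W : Type*} [AddCommGroup W] [Module ℂ W]
    {p : ι → Submodule ℂ W} (h : IsDirectSum p) : Function.Bijective (DirectSum.coeLinearMap p) :=
  (DirectSum.isInternal_submodule_iff_iSupIndep_and_iSup_eq_top p).2 h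

open Classical in
/-- Linear extension to `W = ∐ᵢ p i` of linear maps given on the homogeneous subspaces. -/
def IsDirectSum.lift {ι W U : Type*} [AddCommGroup W] [Module ℂ W] [AddCommGroup U] [Module ℂ U]
    {p : ι → Submodule ℂ W} (h : IsDirectSum p) (T : ∀ i, p i →ₗ[ℂ] U) : W →ₗ[ℂ] U :=
  DirectSum.toModule ℂ ι U T ∘ₗ
    (LinearEquiv.ofBijective (DirectSum.coeLinearMap p) h.bijective).symm.toLinearMap

theorem IsDirectSum.lift_apply {ι W U : Type*} [AddCommGroup W] [Module ℂ W]
    [AddCommGroup U] [Module ℂ U] {p : ι → Submodule ℂ W} (h : IsDirectSum p)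
    (T : ∀ i, p i →ₗ[ℂ] U) (i : ι) (w : p i) : h.lift T (w : W) = T i w := by
  classical
  have : (LinearEquiv.ofBijective (DirectSum.coeLinearMap p) h.bijective).symm (w : W)
      = DirectSum.lof ℂ ι (fun i => p i) i w := by
    rw [LinearEquiv.symm_apply_eq, LinearEquiv.ofBijective_apply, DirectSum.coeLinearMap_lof]
  unfold IsDirectSum.lift
  rw [LinearMap.comp_apply, LinearEquiv.coe_coe]
  have h2 := congrArg (DirectSum.toModule ℂ ι U T) this
  rw [DirectSum.toModule_lof] at h2
  convert h2

/-- The terminating exponential series `e^{tN} s = ∑ᵢ tⁱ (Nⁱ s)/i!`, as a polynomial in `t`, for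
vectors `s` (mapped into `W` by `j`) that are annihilated by a power of `N`. -/
def expSeries {S W : Type*} [AddCommGroup S] [Module ℂ S] [AddCommGroup W] [Module ℂ W]
    (N : Module.End ℂ W) (j : S →ₗ[ℂ] W) (h : ∀ s, ∃ m : ℕ, (N ^ m) (j s) = 0) :
    S →ₗ[ℂ] (ℕ →₀ W) where
  toFun s := Finsupp.ofSupportFinite (fun i => ((i.factorial : ℂ)⁻¹) • (N ^ i) (j s)) (by
    obtain ⟨m, hm⟩ := h s
    refine (Set.finite_lt_nat m).subset fun i hi => ?_
    by_contra hlt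
    apply hi
    have : i = (i - m) + m := by simp only [Set.mem_ofPred_eq] at hlt; omega
    change ((i.factorial : ℂ)⁻¹) • (N ^ i) (j s) = 0
    rw [this, pow_add, Module.End.mul_apply, hm, map_zero, smul_zero])
  map_add' s t := by
    ext i
    change (_ : ℂ) • (N ^ i) (j (s + t)) = (_ : ℂ) • (N ^ i) (j s) + (_ : ℂ) • (N ^ i) (j t)
    rw [map_add, map_add, smul_add]
  map_smul' c s := by
    ext i
    change (_ : ℂ) • (N ^ i) (j (c • s)) = c • ((_ : ℂ) • (N ^ i) (j s))
    rw [map_smul, map_smul, smul_comm]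

/-! ### Formal series in `x` and `log x` -/

/-- `𝒲{x}[[log x]]`: the value of `f` at `n`, `k` is the coefficient of `xⁿ (log x)ᵏ`. -/
abbrev LogSeries (W : Type*) := ℂ → ℕ → W

namespace LogSeries

variable {W : Type*} [AddCommGroup W] [Module ℂ W]

/-- Membership in `𝒲[log x]{x}`: each power of `x` comes with finitely many powers of `log x`. -/
def IsLogPolynomial (f : LogSeries W) : Prop := ∀ n, {k | f n k ≠ 0}.Finite

/-- The formal derivative `d/dx`, with `d/dx log x = x⁻¹`. -/
def deriv (f : LogSeries W) : LogSeries W :=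
  fun n k => (n + 1) • f (n + 1) k + ((k : ℂ) + 1) • f (n + 1) (k + 1)

/-- `f(x) ↦ f(x⁻¹)`, i.e. `xⁿ (log x)ᵏ ↦ x⁻ⁿ (-log x)ᵏ`. -/
def substInv : LogSeries W →ₗ[ℂ] LogSeries W where
  toFun f := fun n k => ((-1 : ℂ) ^ k) • f (-n) k
  map_add' f g := by ext n k; simp
  map_smul' c f := by ext n k; simp [smul_comm c]

/-- Multiplication by the monomial `x^{p.1} (log x)^{p.2}`. -/
def mulMonomial (p : ℂ × ℕ) : LogSeries W →ₗ[ℂ] LogSeries W where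
  toFun f := fun n k => if p.2 ≤ k then f (n - p.1) (k - p.2) else 0
  map_add' f g := by ext n k; by_cases h : p.2 ≤ k <;> simp [h]
  map_smul' c f := by ext n k; by_cases h : p.2 ≤ k <;> simp [h]

/-- The coefficient of `xⁿ (log x)ᵏ`. -/
def coeff (n : ℂ) (k : ℕ) : LogSeries W →ₗ[ℂ] W := LinearMap.proj k ∘ₗ LinearMap.proj n

end LogSeries

/-- Finite sums of terms `w xᵖ (log x)^q` with `p ∈ ℂ`, `q ∈ ℕ`, indexed by `(p, q)`. -/
abbrev LogPoly (W : Type*) [AddCommGroup W] := (ℂ × ℕ) →₀ W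

/-- Apply an operator `T : W → W'{x}[log x]` to an element of `W{x}[log x]` coefficientwise,
multiplying the monomials. -/
def LogPoly.apply {W W' : Type*} [AddCommGroup W] [Module ℂ W] [AddCommGroup W'] [Module ℂ W']
    (T : W →ₗ[ℂ] LogPoly W') : LogPoly W →ₗ[ℂ] LogPoly W' :=
  Finsupp.lsum ℂ fun p => Finsupp.lmapDomain W' ℂ (fun q => p + q) ∘ₗ T

/-! ### Relations between operators

Families of component operators `I u n w = u_n w`, corresponding to `I(u,x)w = ∑ₙ u_n w x^{-n-1}`,
are indexed by a ring `R`, which is `ℤ` for vertex operators and `ℂ` for the coefficients of the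
powers of `log x` in logarithmic intertwining operators. -/

/-- The Jacobi identity
`x₀⁻¹δ((x₁-x₂)/x₀) Y₃(v,x₁) I(w₁,x₂)w₂ - x₀⁻¹δ((x₂-x₁)/(-x₀)) I(w₁,x₂) Y₂(v,x₁)w₂
  = x₂⁻¹δ((x₁-x₀)/x₂) I(Y₁(v,x₀)w₁,x₂)w₂`
for a fixed `v`, acting with components `a₁ n`, `a₂ n`, `a₃ n` (`= v_n`) on the three spaces: this
is the equality of the coefficients of `x₀^{-l-1} x₁^{-m-1} x₂^{-n-1}` on both sides.  By the lower
truncation conditions, each of the three sums over `i ∈ ℕ` has only finitely many nonzero terms, so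
that it is the common value of all sufficiently long partial sums. -/
def JacobiIdentity {R W₁ W₂ W₃ : Type*} [Ring R] [AddCommGroup W₁] [Module ℂ W₁]
    [AddCommGroup W₂] [Module ℂ W₂] [AddCommGroup W₃] [Module ℂ W₃]
    (a₁ : ℤ → Module.End ℂ W₁) (a₂ : ℤ → Module.End ℂ W₂) (a₃ : ℤ → Module.End ℂ W₃)
    (I : W₁ → R → W₂ → W₃) : Prop :=
  ∀ (l m : ℤ) (n : R) (w₁ : W₁) (w₂ : W₂), ∀ᶠ N : ℕ in Filter.atTop,
    (∑ i ∈ Finset.range N, ((-1 : ℂ) ^ i * ((Ring.choose l i : ℤ) : ℂ)) •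
        a₃ (m + l - i) (I w₁ (n + i) w₂))
      - ((-1 : ℂ) ^ l) • (∑ i ∈ Finset.range N, ((-1 : ℂ) ^ i * ((Ring.choose l i : ℤ) : ℂ)) •
        I w₁ (n + l - i) (a₂ (m + i) w₂))
      = ∑ i ∈ Finset.range N, ((Ring.choose m i : ℤ) : ℂ) • I (a₁ (l + i) w₁) (m + n - i) w₂

/-- `[L(0), L(-1)] = L(-1)`, `[L(0), L(1)] = -L(1)`, `[L(-1), L(1)] = -2 L(0)`. -/
def Sl2Relations {W : Type*} [AddCommGroup W] [Module ℂ W] (L : SignType → Module.End ℂ W) :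
    Prop :=
  ⁅L 0, L (-1)⁆ = L (-1) ∧ ⁅L 0, L 1⁆ = -L 1 ∧ ⁅L (-1), L 1⁆ = (-2 : ℂ) • L 0

/-- `[L(j), I(w₁,x)] = ∑_{i=0}^{j+1} binom(j+1,i) xⁱ I(L(j-i)w₁, x)` for `j = -1, 0, 1`. -/
def Sl2BracketRelations {R W₁ W₂ W₃ : Type*} [Ring R] [AddCommGroup W₁] [Module ℂ W₁]
    [AddCommGroup W₂] [Module ℂ W₂] [AddCommGroup W₃] [Module ℂ W₃]
    (L₁ : SignType → Module.End ℂ W₁) (L₂ : SignType → Module.End ℂ W₂)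
    (L₃ : SignType → Module.End ℂ W₃) (I : W₁ → R → W₂ → W₃) : Prop :=
  ∀ (w₁ : W₁) (n : R) (w₂ : W₂),
    L₃ (-1) (I w₁ n w₂) - I w₁ n (L₂ (-1) w₂) = I (L₁ (-1) w₁) n w₂ ∧
    L₃ 0 (I w₁ n w₂) - I w₁ n (L₂ 0 w₂) = I (L₁ 0 w₁) n w₂ + I (L₁ (-1) w₁) (n + 1) w₂ ∧
    L₃ 1 (I w₁ n w₂) - I w₁ n (L₂ 1 w₂)
      = I (L₁ 1 w₁) n w₂ + (2 : ℂ) • I (L₁ 0 w₁) (n + 1) w₂ + I (L₁ (-1) w₁) (n + 2) w₂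

/-- The Virasoro relations `[L(m), L(n)] = (m-n) L(m+n) + (m³-m)/12 δ_{m+n,0} c`. -/
def VirasoroRelations {W : Type*} [AddCommGroup W] [Module ℂ W] (L : ℤ → Module.End ℂ W) (c : ℂ) :
    Prop :=
  ∀ m n : ℤ, ⁅L m, L n⁆ = ((m : ℂ) - n) • L (m + n)
    + (if n + m = 0 then ((m : ℂ) ^ 3 - m) / 12 * c else 0) • (1 : Module.End ℂ W)

/-! ### Vertex algebras and generalized modules -/

/-- The two cases of the theory: Möbius vertex algebras, and conformal vertex algebras with
conformal vector `ω` and central charge `c`. -/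
inductive Kind (V : Type*)
  | mobius : Kind V
  | conformal (ω : V) (c : ℂ) : Kind V

/-- The data underlying a `B`-graded space `W` with a vertex operator map
`v ↦ Y(v,x) = ∑ₙ v_n x^{-n-1}` from `V` and with operators `L(-1)`, `L(0)`, `L(1)`. -/
structure ModData (B V W : Type*) [AddCommGroup V] [Module ℂ V] [AddCommGroup W] [Module ℂ W] where
  /-- `Y v n = v_n` -/
  Y : V →ₗ[ℂ] (ℤ → Module.End ℂ W)
  /-- the operators `L(j)`, `j = 0, ±1` -/
  L : SignType → Module.End ℂ W
  /-- `gr β = W^{(β)}` -/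
  gr : B → Submodule ℂ W

/-- The data underlying a strongly graded vertex algebra: the action on itself and the vacuum. -/
structure VertexData (A V : Type*) [AddCommGroup V] [Module ℂ V] extends ModData A V V where
  one : V

/-- The weight space `V_{(n)}`, the eigenspace of `L(0)` for `n ∈ ℤ`. -/
def VertexData.wt {A V : Type*} [AddCommGroup V] [Module ℂ V] (D : VertexData A V) (n : ℤ) :
    Submodule ℂ V :=
  Module.End.eigenspace (D.L 0) (n : ℂ)

/-- The weight space `W_{[n]}`, the generalized eigenspace of `L(0)` for `n ∈ ℂ`. -/
def ModData.wt {B V W : Type*} [AddCommGroup V] [Module ℂ V] [AddCommGroup W] [Module ℂ W]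
    (M : ModData B V W) (n : ℂ) : Submodule ℂ W :=
  Module.End.maxGenEigenspace (M.L 0) n

/-- The conditions on `L(-1)`, `L(0)`, `L(1)` acting on `W`.  Möbius case: they represent `𝔰𝔩(2)`
and satisfy the bracket relations with vertex operators (`LV` is the action on `V`).  Conformal
case: they are components of `Y(ω,x) = ∑ L(n) x^{-n-2}`, and the `L(n)` satisfy the Virasoro
relations. -/
def ModData.LRelations {B V W : Type*} [AddCommGroup V] [Module ℂ V] [AddCommGroup W] [Module ℂ W]
    (M : ModData B V W) (LV : SignType → Module.End ℂ V) : Kind V → Prop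
  | .mobius => Sl2Relations M.L ∧ Sl2BracketRelations LV M.L M.L (fun v (n : ℤ) w => M.Y v n w)
  | .conformal ω c => M.L (-1) = M.Y ω 0 ∧ M.L 0 = M.Y ω 1 ∧ M.L 1 = M.Y ω 2 ∧
      VirasoroRelations (fun n => M.Y ω (n + 1)) c

/-- The axioms common to a vertex algebra acting on itself and to (generalized) modules: everything
except the vacuum and conformal vectors and the gradings. -/
structure IsVertexAction {A B V W : Type*} [AddCommGroup V] [Module ℂ V]
    [AddCommGroup W] [Module ℂ W] (κ : Kind V) (D : VertexData A V) (M : ModData B V W) :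
    Prop where
  truncation : ∀ (v : V) (w : W), ∃ N : ℤ, ∀ n ≥ N, M.Y v n w = 0
  vacuum : ∀ n, M.Y D.one n = if n = -1 then 1 else 0
  jacobi : ∀ u : V, JacobiIdentity (D.Y u) (M.Y u) (M.Y u) (fun v (n : ℤ) w => M.Y v n w)
  /-- `Y(L(-1)v, x) = d/dx Y(v,x)` -/
  derivative : ∀ (v : V) (n : ℤ), M.Y (D.L (-1) v) n = (-(n : ℂ)) • M.Y v (n - 1)
  L_relations : M.LRelations D.L κ

/-- `D` is a Möbius, respectively conformal, vertex algebra. -/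
structure IsVertexAlgebra {A V : Type*} [AddCommGroup V] [Module ℂ V]
    (κ : Kind V) (D : VertexData A V) : Prop extends IsVertexAction κ D D.toModData where
  wt_directSum : IsDirectSum D.wt
  one_mem : D.one ∈ D.wt 0
  creation : ∀ v : V, D.Y v (-1) D.one = v ∧ ∀ n : ℤ, 0 ≤ n → D.Y v n D.one = 0
  omega_mem : ∀ (ω : V) (c : ℂ), κ = .conformal ω c → ω ∈ D.wt 2

/-- `D` is a strongly `A`-graded Möbius, respectively conformal, vertex algebra. -/
structure IsStronglyGradedVertexAlgebra {A V : Type*} [AddCommGroup A] [AddCommGroup V]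
    [Module ℂ V] (κ : Kind V) (D : VertexData A V) : Prop extends IsVertexAlgebra κ D where
  gr_directSum : IsDirectSum D.gr
  gr_compatible : ∀ α, D.gr α = ⨆ n, D.wt n ⊓ D.gr α
  wt_bounded : ∀ α, ∃ N : ℤ, ∀ n < N, D.wt n ⊓ D.gr α = ⊥
  finiteDimensional : ∀ α n, FiniteDimensional ℂ (D.wt n ⊓ D.gr α : Submodule ℂ V)
  one_mem_gr : D.one ∈ D.gr 0
  Y_mem : ∀ (α β : A), ∀ v ∈ D.gr α, ∀ (l : ℤ), ∀ u ∈ D.gr β, D.Y v l u ∈ D.gr (α + β)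
  L_mem : ∀ (j : SignType) (α : A), ∀ v ∈ D.gr α, D.L j v ∈ D.gr α
  omega_mem_gr : ∀ (ω : V) (c : ℂ), κ = .conformal ω c → ω ∈ D.gr 0

/-- `M` is a generalized module. -/
structure IsGeneralizedModule {A B V W : Type*} [AddCommGroup V] [Module ℂ V]
    [AddCommGroup W] [Module ℂ W] (κ : Kind V) (D : VertexData A V) (M : ModData B V W) :
    Prop extends IsVertexAction κ D M where
  wt_directSum : IsDirectSum M.wt

/-- `M` is a strongly `B`-graded generalized module, for a vertex algebra strongly graded by a
subgroup `A` of `B`. -/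
structure IsStronglyGradedModule {B V W : Type*} [AddCommGroup B] {A : AddSubgroup B}
    [AddCommGroup V] [Module ℂ V] [AddCommGroup W] [Module ℂ W]
    (κ : Kind V) (D : VertexData A V) (M : ModData B V W) :
    Prop extends IsGeneralizedModule κ D M where
  gr_directSum : IsDirectSum M.gr
  gr_compatible : ∀ β, M.gr β = ⨆ n, M.wt n ⊓ M.gr β
  wt_bounded : ∀ (β : B) (n : ℂ), ∃ N : ℤ, ∀ k < N, M.wt (n + k) ⊓ M.gr β = ⊥
  finiteDimensional : ∀ β n, FiniteDimensional ℂ (M.wt n ⊓ M.gr β : Submodule ℂ W)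
  Y_mem : ∀ (α : A) (β : B), ∀ v ∈ D.gr α, ∀ (l : ℤ), ∀ w ∈ M.gr β,
    M.Y v l w ∈ M.gr ((α : B) + β)
  L_mem : ∀ (j : SignType) (β : B), ∀ w ∈ M.gr β, M.L j w ∈ M.gr β

/-! ### Weights and local nilpotence of `L(1)` -/

section Weights

variable {A B V W : Type*} [AddCommGroup V] [Module ℂ V] [AddCommGroup W] [Module ℂ W]

theorem sl2_of_virasoro {L : SignType → Module.End ℂ W} {T : ℤ → Module.End ℂ W} {c : ℂ}
    (hm : L (-1) = T (-1)) (h0 : L 0 = T 0) (h1 : L 1 = T 1) (h : VirasoroRelations T c) :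
    Sl2Relations L := by
  refine ⟨?_, ?_, ?_⟩
  · rw [hm, h0, h 0 (-1)]; simp
  · rw [h1, h0, h 0 1]; simp
  · rw [hm, h0, h1, h (-1) 1]; norm_num

theorem IsVertexAction.commutator {κ : Kind V} {D : VertexData A V} {M : ModData B V W}
    (h : IsVertexAction κ D M) (u v : V) (m n : ℤ) (w : W) :
    ∀ᶠ N : ℕ in Filter.atTop, M.Y u m (M.Y v n w) - M.Y v n (M.Y u m w)
      = ∑ i ∈ Finset.range N, ((Ring.choose m i : ℤ) : ℂ) • M.Y (D.Y u i v) (m + n - i) w := by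
  filter_upwards [h.jacobi u 0 m n v w, Filter.eventually_ge_atTop 1] with N hN h1
  have key : ∀ f : ℕ → W, (∑ i ∈ Finset.range N,
      ((-1 : ℂ) ^ i * ((Ring.choose (0 : ℤ) i : ℤ) : ℂ)) • f i) = f 0 := by
    intro f
    rw [Finset.sum_eq_single_of_mem 0 (Finset.mem_range.2 (by omega))]
    · simp
    · intro i _ hi
      obtain ⟨j, rfl⟩ := Nat.exists_eq_succ_of_ne_zero hi
      simp [Ring.choose_zero_succ]
  rw [key, key] at hN
  simpa using hN

theorem IsVertexAction.sl2 {κ : Kind V} {D : VertexData A V} {M : ModData B V W}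
    (h : IsVertexAction κ D M) : Sl2Relations M.L := by
  have := h.L_relations
  cases κ with
  | mobius => exact this.1
  | conformal ω c =>
    exact sl2_of_virasoro (T := fun n => M.Y ω (n + 1)) (by simpa using this.1)
      (by simpa using this.2.1) (by simpa using this.2.2.1) this.2.2.2

/-- `[L(0), v_n] = (L(0)v)_n + (L(-1)v)_{n+1}` -/
theorem IsVertexAction.bracket_zero {κ : Kind V} {D : VertexData A V} {M : ModData B V W}
    (hD : IsVertexAction κ D D.toModData) (h : IsVertexAction κ D M) (v : V) (n : ℤ) (w : W) :
    M.L 0 (M.Y v n w) - M.Y v n (M.L 0 w)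
      = M.Y (D.L 0 v) n w + M.Y (D.L (-1) v) (n + 1) w := by
  have hM := h.L_relations
  have hV := hD.L_relations
  cases κ with
  | mobius => exact (hM.2 v n w).2.1
  | conformal ω c =>
    obtain ⟨N, hN, h2⟩ := ((h.commutator ω v 1 n w).and (Filter.eventually_ge_atTop 2)).exists
    have hs : ∑ i ∈ Finset.range N, ((Ring.choose (1 : ℤ) i : ℤ) : ℂ) •
          M.Y (D.Y ω i v) (1 + n - i) w
        = ∑ i ∈ Finset.range 2, ((Ring.choose (1 : ℤ) i : ℤ) : ℂ) •
          M.Y (D.Y ω i v) (1 + n - i) w := by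
      symm
      apply Finset.sum_subset (Finset.range_subset_range.2 h2)
      intro i _ hi
      have : Ring.choose (1 : ℤ) i = 0 := by
        have := Ring.choose_natCast (R := ℤ) 1 i
        rw [Nat.choose_eq_zero_of_lt (by simpa using hi)] at this
        simpa using this
      simp [this]
    rw [hM.2.1, hV.1, hV.2.1, hN, hs]
    simp [Finset.sum_range_succ, add_comm]

theorem L_one_apply_zero {L : SignType → Module.End ℂ W} (h : Sl2Relations L) (w : W) :
    L 0 (L 1 w) = L 1 (L 0 w) - L 1 w := by
  have := congrArg (fun T : Module.End ℂ W => T w) h.2.1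
  simp only [Ring.lie_def, LinearMap.sub_apply, Module.End.mul_apply, LinearMap.neg_apply] at this
  rw [sub_eq_iff_eq_add] at this
  rw [this]; abel

theorem sl2_comm_zero {L : SignType → Module.End ℂ W} (h : Sl2Relations L) (j : SignType) (w : W) :
    L 0 (L j w) = L j (L 0 w) - ((j : ℤ) : ℂ) • L j w := by
  cases j with
  | zero => change L 0 (L 0 w) = L 0 (L 0 w) - _; simp
  | neg =>
    have := congrArg (fun T : Module.End ℂ W => T w) h.1
    simp only [Ring.lie_def, LinearMap.sub_apply, Module.End.mul_apply] at this
    rw [sub_eq_iff_eq_add] at this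
    change L 0 (L (-1) w) = L (-1) (L 0 w) - (((-1 : SignType) : ℤ) : ℂ) • L (-1) w
    rw [this]; simp [add_comm]
  | pos =>
    change L 0 (L 1 w) = L 1 (L 0 w) - (((1 : SignType) : ℤ) : ℂ) • L 1 w
    rw [L_one_apply_zero h]; simp

/-- An operator `T` with `(L₀ - b) T = T (L₀ - a)` maps generalized eigenspaces accordingly. -/
theorem mem_maxGenEigenspace_of_shift {L₀ T : Module.End ℂ W} {a b : ℂ}
    (h : ∀ w, L₀ (T w) - b • T w = T (L₀ w - a • w)) {w : W}
    (hw : w ∈ Module.End.maxGenEigenspace L₀ a) : T w ∈ Module.End.maxGenEigenspace L₀ b := by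
  rw [Module.End.mem_maxGenEigenspace] at hw ⊢
  obtain ⟨k, hk⟩ := hw
  refine ⟨k, ?_⟩
  have : ∀ (k : ℕ) (w : W), ((L₀ - b • 1) ^ k) (T w) = T (((L₀ - a • 1) ^ k) w) := by
    intro k
    induction k with
    | zero => simp
    | succ k ih =>
      intro w
      rw [pow_succ, Module.End.mul_apply, pow_succ, Module.End.mul_apply, ← ih]
      congr 1
      simpa using h w
  rw [this, hk, map_zero]

theorem ModData.L_mem_wt {M : ModData B V W} (h : Sl2Relations M.L) (j : SignType) {n : ℂ} {w : W}
    (hw : w ∈ M.wt n) : M.L j w ∈ M.wt (n - ((j : ℤ) : ℂ)) := by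
  refine mem_maxGenEigenspace_of_shift (fun u => ?_) hw
  rw [sl2_comm_zero h, map_sub, map_smul]
  module

theorem VertexData.L_one_mem_wt {D : VertexData A V} (h : Sl2Relations D.L) {n : ℤ} {v : V}
    (hv : v ∈ D.wt n) : D.L 1 v ∈ D.wt (n - 1) := by
  rw [VertexData.wt, Module.End.mem_eigenspace_iff] at hv ⊢
  rw [L_one_apply_zero h, hv, map_smul]
  push_cast
  module

/-- `v_l W_{[m]} ⊆ W_{[m + wt v - l - 1]}` -/
theorem IsVertexAction.Y_mem_wt {κ : Kind V} {D : VertexData A V} {M : ModData B V W}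
    (hD : IsVertexAction κ D D.toModData) (h : IsVertexAction κ D M) {k l : ℤ} {m : ℂ} {v : V}
    {w : W} (hv : v ∈ D.wt k) (hw : w ∈ M.wt m) : M.Y v l w ∈ M.wt (m + k - l - 1) := by
  refine mem_maxGenEigenspace_of_shift (T := M.Y v l) (fun u => ?_) hw
  have h1 := hD.bracket_zero h v l u
  rw [VertexData.wt, Module.End.mem_eigenspace_iff] at hv
  rw [h.derivative, hv, sub_eq_iff_eq_add] at h1
  rw [h1, map_sub, map_smul, map_smul]
  simp only [Pi.smul_apply, LinearMap.smul_apply, add_sub_cancel_right]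
  push_cast
  module

/-- Local nilpotence from a lower bound for the degrees. -/
theorem locally_nilpotent_of_lowering {N : Module.End ℂ W} {ι : Type*} {p : ι → ℤ → Submodule ℂ W}
    (hN : ∀ i k, ∀ w ∈ p i k, N w ∈ p i (k - 1)) (hb : ∀ i, ∃ K, ∀ k < K, p i k = ⊥) (i : ι) (k : ℤ)
    {w : W} (hw : w ∈ p i k) : ∃ m : ℕ, (N ^ m) w = 0 := by
  obtain ⟨K, hK⟩ := hb i
  have hm : ∀ m : ℕ, (N ^ m) w ∈ p i (k - m) := by
    intro m
    induction m with
    | zero => simpa using hw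
    | succ m ih =>
      rw [pow_succ', Module.End.mul_apply]
      have := hN i _ _ ih
      rw [show k - ((m + 1 : ℕ) : ℤ) = k - m - 1 by push_cast; ring]
      exact this
  refine ⟨(k - K + 1).toNat, ?_⟩
  have := hm (k - K + 1).toNat
  rw [hK _ (by have := Int.self_le_toNat (k - K + 1); omega)] at this
  simpa using this

theorem exists_pow_add {N : Module.End ℂ W} {x y : W} (hx : ∃ m : ℕ, (N ^ m) x = 0)
    (hy : ∃ m : ℕ, (N ^ m) y = 0) : ∃ m : ℕ, (N ^ m) (x + y) = 0 := by
  obtain ⟨a, ha⟩ := hx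
  obtain ⟨b, hb⟩ := hy
  refine ⟨a + b, ?_⟩
  rw [map_add, pow_add, Module.End.mul_apply, Module.End.mul_apply, hb, ← Module.End.mul_apply,
    ← pow_add, add_comm a b, pow_add, Module.End.mul_apply, ha]
  simp

theorem iSup_iSup_induction {ι ι' : Type*} {p : ι → Submodule ℂ W} {q : ι → ι' → Submodule ℂ W}
    (hp : ⨆ i, p i = ⊤) (hq : ∀ i, p i = ⨆ n, q i n) {P : W → Prop} (h0 : P 0)
    (hadd : ∀ x y, P x → P y → P (x + y)) (h : ∀ i n, ∀ w ∈ q i n, P w) (w : W) : P w := by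
  have hw : w ∈ ⨆ i, p i := by rw [hp]; trivial
  refine Submodule.iSup_induction p (motive := P) hw (fun i x hx => ?_) h0 hadd
  rw [hq i] at hx
  exact Submodule.iSup_induction (q i) (motive := P) hx (h i) h0 hadd

theorem IsStronglyGradedVertexAlgebra.L_one_nilpotent [AddCommGroup A] {κ : Kind V}
    {D : VertexData A V} (hD : IsStronglyGradedVertexAlgebra κ D) (v : V) :
    ∃ m : ℕ, ((D.L 1) ^ m) v = 0 := by
  refine iSup_iSup_induction (P := fun v => ∃ m : ℕ, ((D.L 1) ^ m) v = 0)
    hD.gr_directSum.2 hD.gr_compatible ⟨0, by simp⟩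
    (fun x y => exists_pow_add) (fun α n w hw => ?_) v
  refine locally_nilpotent_of_lowering (p := fun α n => D.wt n ⊓ D.gr α) (fun α k w hw => ?_)
    hD.wt_bounded α n hw
  exact ⟨VertexData.L_one_mem_wt hD.toIsVertexAction.sl2 hw.1, hD.L_mem 1 α w hw.2⟩

theorem IsStronglyGradedModule.L_one_nilpotent [AddCommGroup B] {A : AddSubgroup B} {κ : Kind V}
    {D : VertexData A V} {M : ModData B V W} (hM : IsStronglyGradedModule κ D M) (w : W) :
    ∃ m : ℕ, ((M.L 1) ^ m) w = 0 := by
  refine iSup_iSup_induction (P := fun w => ∃ m : ℕ, ((M.L 1) ^ m) w = 0)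
    hM.gr_directSum.2 hM.gr_compatible ⟨0, by simp⟩
    (fun x y => exists_pow_add) (fun β n w hw => ?_) w
  refine locally_nilpotent_of_lowering
    (p := fun (i : B × ℂ) (k : ℤ) => M.wt (i.2 + k) ⊓ M.gr i.1)
    (fun i k w hw => ⟨?_, hM.L_mem 1 _ w hw.2⟩) (fun i => hM.wt_bounded i.1 i.2) (β, n) 0
    (by simpa using hw)
  have := ModData.L_mem_wt hM.toIsVertexAction.sl2 1 hw.1
  have h2 : i.2 + (k : ℂ) - (((1 : SignType) : ℤ) : ℂ) = i.2 + ((k - 1 : ℤ) : ℂ) := by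
    push_cast [SignType.coe_one]
    ring
  rwa [h2] at this

theorem wt_nilpotent (M : ModData B V W) (n c : ℂ) (w : M.wt n) :
    ∃ m : ℕ, ((c • (M.L 0 - n • 1)) ^ m) ((M.wt n).subtype w) = 0 := by
  obtain ⟨m, hm⟩ := (Module.End.mem_maxGenEigenspace _ _ _).1 w.2
  refine ⟨m, ?_⟩
  rw [smul_pow, LinearMap.smul_apply, Submodule.subtype_apply, hm, smul_zero]

end Weights

/-! ### Contragredient modules -/

section Contragredient

variable {B V W : Type*} [AddCommGroup B] {A : AddSubgroup B} [AddCommGroup V] [Module ℂ V]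
  [AddCommGroup W] [Module ℂ W]

/-- The component `v_n^o = (-1)ᵏ ∑ₘ (1/m!) (L(1)ᵐ v)_{-n-m-2+2k}` of the opposite vertex operator
of a homogeneous element `v ∈ V_{(k)}`. -/
def oppositeYHomogeneous {κ : Kind V} {D : VertexData A V}
    (hD : IsStronglyGradedVertexAlgebra κ D) (M : ModData B V W) (k : ℤ) :
    D.wt k →ₗ[ℂ] (ℤ → Module.End ℂ W) :=
  LinearMap.pi fun n => ((-1 : ℂ) ^ k) •
    (Finsupp.lsum ℂ (fun m : ℕ => LinearMap.proj (-n - m - 2 + 2 * k) ∘ₗ M.Y) ∘ₗ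
      expSeries (D.L 1) (D.wt k).subtype (fun v => hD.L_one_nilpotent v))

/-- The components `v_n^o`, `v ∈ V`, of the opposite vertex operators on `W`. -/
def oppositeY {κ : Kind V} {D : VertexData A V} (hD : IsStronglyGradedVertexAlgebra κ D)
    (M : ModData B V W) : V →ₗ[ℂ] (ℤ → Module.End ℂ W) :=
  hD.wt_directSum.lift (oppositeYHomogeneous hD M)

/-- `(W_{[n]}^{(β)})^*`, the functionals vanishing on all `W_{[m]}^{(γ)}`, `(γ,m) ≠ (β,n)`. -/
def ModData.dualWt (M : ModData B V W) (β : B) (n : ℂ) : Submodule ℂ (Module.Dual ℂ W) where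
  carrier := {f | ∀ (γ : B) (m : ℂ), (γ, m) ≠ (β, n) → ∀ w ∈ M.wt m ⊓ M.gr γ, f w = 0}
  add_mem' hf hg γ m h w hw := by simp [hf γ m h w hw, hg γ m h w hw]
  zero_mem' := by simp
  smul_mem' c f hf γ m h w hw := by simp [hf γ m h w hw]

/-- The space `W' = ∐_{β,n} (W_{[n]}^{(β)})^* ⊆ W^*`. -/
def ModData.dualSpace (M : ModData B V W) : Submodule ℂ (Module.Dual ℂ W) :=
  ⨆ (β : B) (n : ℂ), M.dualWt β n

set_option linter.unusedSectionVars false in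
theorem ModData.mem_dualSpace {M : ModData B V W} {β : B} {n : ℂ} {f : Module.Dual ℂ W}
    (hf : f ∈ M.dualWt β n) : f ∈ M.dualSpace :=
  Submodule.mem_iSup_of_mem β (Submodule.mem_iSup_of_mem n hf)

set_option linter.unusedSectionVars false in
theorem ModData.dualSpace_induction {M : ModData B V W} {T : Submodule ℂ (Module.Dual ℂ W)}
    {f : Module.Dual ℂ W} (hf : f ∈ M.dualSpace) {P : Module.Dual ℂ W →ₗ[ℂ] Module.Dual ℂ W}
    (h : ∀ β n, ∀ f ∈ M.dualWt β n, P f ∈ T) : P f ∈ T := by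
  have : M.dualSpace ≤ T.comap P := iSup_le fun β => iSup_le fun n f hf => h β n f hf
  exact this hf

theorem dual_L_mem {κ : Kind V} {D : VertexData A V} {M : ModData B V W}
    (hM : IsStronglyGradedModule κ D M) (j : SignType) (f : Module.Dual ℂ W)
    (hf : f ∈ M.dualSpace) : (M.L j).dualMap f ∈ M.dualSpace := by
  refine ModData.dualSpace_induction hf fun β n f hf => ?_
  refine ModData.mem_dualSpace (β := β) (n := n + ((j : ℤ) : ℂ)) fun γ m h w hw => ?_
  refine hf γ (m - ((j : ℤ) : ℂ)) (fun h' => h ?_) _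
    ⟨ModData.L_mem_wt hM.toIsVertexAction.sl2 j hw.1, hM.L_mem j γ w hw.2⟩
  simp only [Prod.mk.injEq] at h' ⊢
  exact ⟨h'.1, by rw [← h'.2]; ring⟩

theorem oppositeY_mem {κ : Kind V} {D : VertexData A V} (hD : IsStronglyGradedVertexAlgebra κ D)
    {M : ModData B V W} (hM : IsStronglyGradedModule κ D M) {α : A} {k n : ℤ} {v : V}
    (hv : v ∈ D.wt k ⊓ D.gr α) {β : B} {m : ℂ} {w : W} (hw : w ∈ M.wt m ⊓ M.gr β) :
    oppositeY hD M v n w ∈ M.wt (m + n + 1 - k) ⊓ M.gr ((α : B) + β) := by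
  have hpow : ∀ i : ℕ, ((D.L 1) ^ i) v ∈ D.wt (k - i) ⊓ D.gr α := by
    intro i
    induction i with
    | zero => simpa using hv
    | succ i ih =>
      rw [pow_succ', Module.End.mul_apply]
      refine ⟨?_, hD.L_mem 1 _ _ ih.2⟩
      have := VertexData.L_one_mem_wt hD.toIsVertexAction.sl2 ih.1
      rw [show k - ((i + 1 : ℕ) : ℤ) = k - i - 1 by push_cast; ring]
      exact this
  have hlift : oppositeY hD M v = oppositeYHomogeneous hD M k ⟨v, hv.1⟩ :=
    hD.wt_directSum.lift_apply (oppositeYHomogeneous hD M) k ⟨v, hv.1⟩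
  rw [hlift]
  unfold oppositeYHomogeneous
  rw [LinearMap.pi_apply, LinearMap.smul_apply, LinearMap.smul_apply, LinearMap.comp_apply,
    Finsupp.lsum_apply, Finsupp.sum, LinearMap.sum_apply]
  refine Submodule.smul_mem _ _ (Submodule.sum_mem _ fun i _ => ?_)
  have hcoef : expSeries (D.L 1) (D.wt k).subtype (fun v => hD.L_one_nilpotent v) ⟨v, hv.1⟩ i
      = ((i.factorial : ℂ)⁻¹) • ((D.L 1) ^ i) v := rfl
  rw [hcoef, map_smul, LinearMap.smul_apply]
  refine Submodule.smul_mem _ _ ⟨?_, hM.Y_mem α β _ (hpow i).2 _ _ hw.2⟩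
  have := hD.toIsVertexAction.Y_mem_wt hM.toIsVertexAction (l := -n - i - 2 + 2 * k)
    (hpow i).1 hw.1
  have h2 : m + ((k - i : ℤ) : ℂ) - ((-n - i - 2 + 2 * k : ℤ) : ℂ) - 1 = m + n + 1 - k := by
    push_cast
    ring
  rw [h2] at this
  exact this

theorem dual_Y_mem {κ : Kind V} {D : VertexData A V} (hD : IsStronglyGradedVertexAlgebra κ D)
    {M : ModData B V W} (hM : IsStronglyGradedModule κ D M) (v : V) (n : ℤ) (f : Module.Dual ℂ W)
    (hf : f ∈ M.dualSpace) : (oppositeY hD M v n).dualMap f ∈ M.dualSpace := by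
  refine ModData.dualSpace_induction hf fun β m f hf => ?_
  refine iSup_iSup_induction (P := fun v => (oppositeY hD M v n).dualMap f ∈ M.dualSpace)
    hD.gr_directSum.2 hD.gr_compatible ?_ (fun x y hx hy => ?_) (fun α k v hv => ?_) v
  · have : (oppositeY hD M 0 n).dualMap f = 0 := by ext w; simp
    rw [this]; exact Submodule.zero_mem _
  · have : (oppositeY hD M (x + y) n).dualMap f
        = (oppositeY hD M x n).dualMap f + (oppositeY hD M y n).dualMap f := by ext w; simp
    rw [this]; exact Submodule.add_mem _ hx hy
  · refine ModData.mem_dualSpace (β := β - α) (n := m - n - 1 + k) fun γ m' h w hw => ?_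
    refine hf _ _ (fun h' => h ?_) _ (oppositeY_mem hD hM hv hw)
    simp only [Prod.mk.injEq] at h' ⊢
    exact ⟨by rw [← h'.1]; abel, by rw [← h'.2]; ring⟩

/-- The contragredient module `W'`: `⟨v_n w', w⟩ = ⟨w', v_n^o w⟩`, `⟨L'(j)w', w⟩ = ⟨w', L(-j)w⟩`,
and `(W')^{(β)} = ∐ₙ (W_{[n]}^{(-β)})^*`. (Its weight spaces are, as for any generalized module,
the generalized eigenspaces of `L'(0)`.) -/
def contragredient {κ : Kind V} {D : VertexData A V} (hD : IsStronglyGradedVertexAlgebra κ D)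
    {M : ModData B V W} (hM : IsStronglyGradedModule κ D M) : ModData B V M.dualSpace where
  Y :=
    { toFun := fun v n => (oppositeY hD M v n).dualMap.restrict (dual_Y_mem hD hM v n)
      map_add' := fun u v => by ext n f w; simp [LinearMap.restrict_apply]
      map_smul' := fun c v => by ext n f w; simp [LinearMap.restrict_apply] }
  L := fun j => (M.L (-j)).dualMap.restrict (dual_L_mem hM (-j))
  gr := fun β => (⨆ n, M.dualWt (-β) n).comap M.dualSpace.subtype

end Contragredient

/-! ### Logarithmic intertwining operators -/

section Intertwining

variable {B V W₁ W₂ W₃ : Type*} [AddCommGroup V] [Module ℂ V]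
  [AddCommGroup W₁] [Module ℂ W₁] [AddCommGroup W₂] [Module ℂ W₂] [AddCommGroup W₃] [Module ℂ W₃]

/-- The components of `𝒴(w₁,x)w₂ = ∑ₙ ∑ₖ (w₁)_{n;k} w₂ x^{-n-1} (log x)ᵏ`. -/
def component (𝒴 : W₁ →ₗ[ℂ] W₂ →ₗ[ℂ] LogSeries W₃) (k : ℕ) (w₁ : W₁) (n : ℂ) (w₂ : W₂) : W₃ :=
  𝒴 w₁ w₂ (-n - 1) k

/-- `𝒴` is a logarithmic intertwining operator of type `(W₃; W₁ W₂)`. -/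
structure IsLogIntertwining (M₁ : ModData B V W₁) (M₂ : ModData B V W₂) (M₃ : ModData B V W₃)
    (𝒴 : W₁ →ₗ[ℂ] W₂ →ₗ[ℂ] LogSeries W₃) : Prop where
  isLogPolynomial : ∀ w₁ w₂, (𝒴 w₁ w₂).IsLogPolynomial
  truncation : ∀ w₁ w₂ (n : ℂ), ∃ N : ℕ, ∀ m ≥ N, ∀ k, component 𝒴 k w₁ (n + m) w₂ = 0
  /-- the Jacobi identity, for the coefficient of each power of `log x₂` -/
  jacobi : ∀ (v : V) (k : ℕ), JacobiIdentity (M₁.Y v) (M₂.Y v) (M₃.Y v) (component 𝒴 k)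
  derivative : ∀ w₁ w₂, 𝒴 (M₁.L (-1) w₁) w₂ = (𝒴 w₁ w₂).deriv
  bracket : ∀ k, Sl2BracketRelations M₁.L M₂.L M₃.L (component 𝒴 k)

/-- `𝒴` maps `W₁^{(β)} ⊗ W₂^{(γ)}` to series with coefficients in `W₃^{(β+γ)}`. -/
def IsGradingCompatible [AddCommGroup B] (M₁ : ModData B V W₁) (M₂ : ModData B V W₂)
    (M₃ : ModData B V W₃) (𝒴 : W₁ →ₗ[ℂ] W₂ →ₗ[ℂ] LogSeries W₃) : Prop :=
  ∀ (β γ : B), ∀ w₁ ∈ M₁.gr β, ∀ w₂ ∈ M₂.gr γ, ∀ (n : ℂ) (k : ℕ),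
    component 𝒴 k w₁ n w₂ ∈ M₃.gr (β + γ)

/-- The space `𝒱_{W₁W₂}^{W₃}` of grading-compatible logarithmic intertwining operators of type
`(W₃; W₁ W₂)`. -/
def intertwiningSpace [AddCommGroup B] (M₁ : ModData B V W₁) (M₂ : ModData B V W₂)
    (M₃ : ModData B V W₃) : Submodule ℂ (W₁ →ₗ[ℂ] W₂ →ₗ[ℂ] LogSeries W₃) where
  carrier := {𝒴 | IsLogIntertwining M₁ M₂ M₃ 𝒴 ∧ IsGradingCompatible M₁ M₂ M₃ 𝒴}
  zero_mem' := by
    refine ⟨⟨?_, ?_, ?_, ?_, ?_⟩, ?_⟩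
    · intro w₁ w₂ n; simp
    · intro w₁ w₂ n; exact ⟨0, fun m _ k => rfl⟩
    · intro v k l m n w₁ w₂
      exact Filter.Eventually.of_forall fun N => by simp [component]
    · intro w₁ w₂; ext n k; simp [LogSeries.deriv]
    · intro k w₁ n w₂; simp [component]
    · intro β γ w₁ _ w₂ _ n k; exact Submodule.zero_mem _
  add_mem' := by
    rintro 𝒴 𝒵 ⟨hY, hY'⟩ ⟨hZ, hZ'⟩
    have hc : ∀ k w₁ n w₂, component (𝒴 + 𝒵) k w₁ n w₂
        = component 𝒴 k w₁ n w₂ + component 𝒵 k w₁ n w₂ := fun _ _ _ _ => rfl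
    refine ⟨⟨?_, ?_, ?_, ?_, ?_⟩, ?_⟩
    · intro w₁ w₂ n
      refine ((hY.isLogPolynomial w₁ w₂ n).union (hZ.isLogPolynomial w₁ w₂ n)).subset ?_
      intro k hk
      by_contra hcon
      simp only [Set.mem_union, Set.mem_ofPred_eq, not_or, not_not] at hcon
      exact hk (by simp [hcon.1, hcon.2])
    · intro w₁ w₂ n
      obtain ⟨N, hN⟩ := hY.truncation w₁ w₂ n
      obtain ⟨N', hN'⟩ := hZ.truncation w₁ w₂ n
      refine ⟨max N N', fun m hm k => ?_⟩
      rw [hc, hN m (le_of_max_le_left hm), hN' m (le_of_max_le_right hm), add_zero]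
    · intro v k l m n w₁ w₂
      filter_upwards [hY.jacobi v k l m n w₁ w₂, hZ.jacobi v k l m n w₁ w₂] with N h1 h2
      simp only [hc, map_add, smul_add, Finset.sum_add_distrib]
      rw [← h1, ← h2]; abel
    · intro w₁ w₂
      have h1 := hY.derivative w₁ w₂
      have h2 := hZ.derivative w₁ w₂
      ext n k
      simp only [LinearMap.add_apply, h1, h2, Pi.add_apply, LogSeries.deriv, smul_add]
      abel
    · intro k w₁ n w₂
      obtain ⟨a1, a2, a3⟩ := hY.bracket k w₁ n w₂
      obtain ⟨b1, b2, b3⟩ := hZ.bracket k w₁ n w₂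
      simp only [hc, map_add, smul_add]
      refine ⟨?_, ?_, ?_⟩
      · rw [← a1, ← b1]; abel
      · rw [add_sub_add_comm, a2, b2]; abel
      · rw [add_sub_add_comm, a3, b3]; abel
    · intro β γ w₁ h₁ w₂ h₂ n k
      rw [hc]
      exact Submodule.add_mem _ (hY' β γ w₁ h₁ w₂ h₂ n k) (hZ' β γ w₁ h₁ w₂ h₂ n k)
  smul_mem' := by
    rintro c 𝒴 ⟨hY, hY'⟩
    have hc : ∀ k w₁ n w₂, component (c • 𝒴) k w₁ n w₂ = c • component 𝒴 k w₁ n w₂ :=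
      fun _ _ _ _ => rfl
    refine ⟨⟨?_, ?_, ?_, ?_, ?_⟩, ?_⟩
    · intro w₁ w₂ n
      refine (hY.isLogPolynomial w₁ w₂ n).subset fun k hk h0 => hk ?_
      simp [h0]
    · intro w₁ w₂ n
      obtain ⟨N, hN⟩ := hY.truncation w₁ w₂ n
      exact ⟨N, fun m hm k => by rw [hc, hN m hm, smul_zero]⟩
    · intro v k l m n w₁ w₂
      filter_upwards [hY.jacobi v k l m n w₁ w₂] with N h1
      simp only [hc, map_smul]
      simp only [smul_comm _ c, ← Finset.smul_sum]
      rw [← smul_sub, h1]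
    · intro w₁ w₂
      have h1 := hY.derivative w₁ w₂
      ext n k
      simp only [LinearMap.smul_apply, h1, Pi.smul_apply, LogSeries.deriv, smul_add, smul_comm _ c]
    · intro k w₁ n w₂
      obtain ⟨a1, a2, a3⟩ := hY.bracket k w₁ n w₂
      simp only [hc, map_smul]
      refine ⟨?_, ?_, ?_⟩
      · rw [← a1, smul_sub]
      · rw [← smul_sub, a2, smul_add]
      · rw [← smul_sub, a3, smul_add, smul_add, smul_comm]
    · intro β γ w₁ h₁ w₂ h₂ n k
      rw [hc]
      exact Submodule.smul_mem _ _ (hY' β γ w₁ h₁ w₂ h₂ n k)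

/-- The fusion rule `N_{W₁W₂}^{W₃} = dim 𝒱_{W₁W₂}^{W₃}`. -/
def fusionRule [AddCommGroup B] (M₁ : ModData B V W₁) (M₂ : ModData B V W₂)
    (M₃ : ModData B V W₃) : Cardinal :=
  Module.rank ℂ (intertwiningSpace M₁ M₂ M₃)

end Intertwining

/-! ### The `r`-contragredient operator -/

section ContragredientOperator

variable {B V W W₁ W₂ W₃ : Type*} [AddCommGroup B] {A : AddSubgroup B} [AddCommGroup V] [Module ℂ V]
  [AddCommGroup W] [Module ℂ W] [AddCommGroup W₁] [Module ℂ W₁] [AddCommGroup W₂] [Module ℂ W₂]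
  [AddCommGroup W₃] [Module ℂ W₃] {κ : Kind V} {D : VertexData A V}

/-- `x^{-L(0)} w = x^{-n} e^{-log x (L(0)-n)} w` for `w ∈ W_{[n]}`. -/
def xPowNegL0 {M : ModData B V W} (hM : IsStronglyGradedModule κ D M) : W →ₗ[ℂ] LogPoly W :=
  hM.wt_directSum.lift fun n => Finsupp.lmapDomain W ℂ (fun i : ℕ => (-n, i)) ∘ₗ
    expSeries ((-1 : ℂ) • (M.L 0 - n • 1)) (M.wt n).subtype (wt_nilpotent M n (-1))

/-- `e^{aL(0)} w = e^{an} e^{a(L(0)-n)} w` for `w ∈ W_{[n]}`. -/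
def expL0 {M : ModData B V W} (hM : IsStronglyGradedModule κ D M) (a : ℂ) : W →ₗ[ℂ] W :=
  hM.wt_directSum.lift fun n => Complex.exp (a * n) •
    (Finsupp.lsum ℂ (fun _ : ℕ => LinearMap.id) ∘ₗ
      expSeries (a • (M.L 0 - n • 1)) (M.wt n).subtype (wt_nilpotent M n a))

/-- `e^{xL(1)} w = ∑ᵢ xⁱ L(1)ⁱ w / i!`. -/
def expXL1 {M : ModData B V W} (hM : IsStronglyGradedModule κ D M) : W →ₗ[ℂ] LogPoly W :=
  Finsupp.lmapDomain W ℂ (fun i : ℕ => ((i : ℂ), 0)) ∘ₗ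
    expSeries (M.L 1) LinearMap.id hM.L_one_nilpotent

/-- `e^{xL(1)} e^{(2r+1)πi L(0)} (x^{-L(0)})² w`. -/
def contragredientArg {M : ModData B V W} (hM : IsStronglyGradedModule κ D M) (r : ℤ) :
    W →ₗ[ℂ] LogPoly W :=
  LogPoly.apply (expXL1 hM) ∘ₗ
    Finsupp.mapRange.linearMap (expL0 hM ((2 * r + 1) * Real.pi * Complex.I)) ∘ₗ
    LogPoly.apply (xPowNegL0 hM) ∘ₗ xPowNegL0 hM

/-- `g ↦ 𝒴(g(x), x⁻¹) w₂` for `g ∈ W₁{x}[log x]` a finite sum of terms `w xᵖ (log x)^q`, each of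
which contributes `xᵖ (log x)^q 𝒴(w, x⁻¹) w₂`. -/
def evalAtInv (𝒴 : W₁ →ₗ[ℂ] W₂ →ₗ[ℂ] LogSeries W₃) :
    LogPoly W₁ →ₗ[ℂ] W₂ →ₗ[ℂ] LogSeries W₃ :=
  Finsupp.lsum ℂ fun p => 𝒴.compr₂ (LogSeries.mulMonomial p ∘ₗ LogSeries.substInv)

/-- The `r`-contragredient operator `A_r(𝒴)`, with coefficients a priori in `W₂^*`:
`⟨A_r(𝒴)(w₁,x)w₃', w₂⟩ = ⟨w₃', 𝒴(e^{xL(1)} e^{(2r+1)πi L(0)} (x^{-L(0)})² w₁, x⁻¹)w₂⟩`. -/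
def contragredientOperator {M₁ : ModData B V W₁} (h₁ : IsStronglyGradedModule κ D M₁)
    (M₃ : ModData B V W₃) (r : ℤ) (𝒴 : W₁ →ₗ[ℂ] W₂ →ₗ[ℂ] LogSeries W₃) :
    W₁ →ₗ[ℂ] M₃.dualSpace →ₗ[ℂ] LogSeries (Module.Dual ℂ W₂) :=
  LinearMap.mk₂ ℂ
    (fun w₁ w₃' n k =>
      (w₃' : Module.Dual ℂ W₃) ∘ₗ LogSeries.coeff n k ∘ₗ evalAtInv 𝒴 (contragredientArg h₁ r w₁))
    (fun w w' f => by ext n k w₂; simp)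
    (fun c w f => by ext n k w₂; simp)
    (fun w f g => by ext n k w₂; simp)
    (fun c w f => by ext n k w₂; simp)

end ContragredientOperator

end

end LogVA

open LogVA

/-! The operator `A_r(𝒴)` is a transpose of `𝒴` after three changes: the scaling
e^{(2r+1)πiL(0)}(x^{-L(0)})² of the argument, then e^{xL(1)}, then x ↦ x⁻¹. The opposite vertex
operator defining W' is the same construction with scaling (-x⁻²)^{L(0)}. The proof therefore treats
e^{xL(1)} and x ↦ x⁻¹ once, in `oppComponent`, for components indexed by any commutative ring (ℤ for
vertex operators, ℂ for the coefficient of each power of log x), and puts the scaling on afterwards.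

The core is `oppComponent_jacobi`. The given Jacobi identity is applied to L(1)^j u/j! and L(1)^s
w/s! and summed over j and s. The two product terms match at once, trading places because
transposition reverses composition. The iterate term carries the content: it rests on e^{xL(1)}
Y(u,x₀) e^{-xL(1)} = Y(e^{x(1-xx₀)L(1)} (1-xx₀)^{-2L(0)} u, x₀/(1-xx₀)), which appears
coefficientwise as `divPow_L_one_Y` and is extended in `sum_divPow_L_one_Y`. The 𝔰𝔩(2) brackets and
the L(-1)-derivative property come from e^{-tL(1)}L(-1)e^{tL(1)} = L(-1) - 2tL(0) + t²L(1).

The scaling enters through two facts. Passing an operator of integral degree d through it costs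
(-1)^d x^{-2d}, whatever r is (`scalingArg_shift`); this is the sign and shift in the iterate term
of `oppComponent_jacobi`. Its derivative is -2x⁻¹L(0) times itself (`logDeriv_scalingArg`), which
cancels the 2x⁻¹L(0) left over from e^{xL(1)}.

Finiteness comes from the double grading by weight and degree. Components of bihomogeneous vectors
are bihomogeneous (`component_mem_wt`), so transposed coefficients lie in W₂', are lower truncated,
and involve finitely many powers of log x because the spaces W_{[n]}^{(β)} are finite-dimensional.
The same finiteness gives W = W''.

For r + s = -1 the argument map for r, taken at x⁻¹, undoes the one for s at x
(`apply_invVar_contragredientArg`). Together with W = W'' this makes A_{-r-1} inverse to A_r. -/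

namespace LogVA

/-! ### Binomial coefficients and triple sums -/

/-- The binomial coefficient `binom(z, i)` for an integer `z`, as a complex number. -/
noncomputable abbrev binom (z : ℤ) (i : ℕ) : ℂ := ((Ring.choose z i : ℤ) : ℂ)

theorem binom_zero (z : ℤ) : binom z 0 = 1 := by simp [binom]

theorem binom_zero_succ (i : ℕ) : binom 0 (i + 1) = 0 := by simp [binom, Ring.choose_zero_succ]

theorem binom_succ_succ (z : ℤ) (i : ℕ) :
    binom (z + 1) (i + 1) = binom z i + binom z (i + 1) := by
  unfold binom
  rw [Ring.choose_succ_succ, Int.cast_add]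

theorem succ_mul_binom_succ (z : ℤ) (i : ℕ) :
    ((i : ℂ) + 1) * binom z (i + 1) = ((z : ℂ) - i) * binom z i := by
  have h := Ring.choose_smul_choose z (Nat.le_succ i)
  simp only [Nat.succ_eq_add_one, Nat.choose_succ_self_right, add_tsub_cancel_left,
    Ring.choose_one_right, nsmul_eq_mul] at h
  unfold binom
  have h' := congrArg (fun x : ℤ => (x : ℂ)) h
  push_cast at h'
  rw [h']; ring

theorem binom_natCast (n i : ℕ) : binom (n : ℤ) i = (n.choose i : ℂ) := by
  unfold binom
  rw [Ring.choose_natCast]; simp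

open Finset HasAntidiagonal in
/-- The sum of `f i j r` over all `i + j + r = s`. -/
def tripleSum {W : Type*} [AddCommMonoid W] (s : ℕ) (f : ℕ → ℕ → ℕ → W) : W :=
  ∑ x ∈ antidiagonal s, ∑ y ∈ antidiagonal x.1, f y.1 y.2 x.2

section TripleSum

variable {W : Type*} [AddCommGroup W]

theorem tripleSum_add (s : ℕ) (f g : ℕ → ℕ → ℕ → W) :
    tripleSum s (fun i j r => f i j r + g i j r) = tripleSum s f + tripleSum s g := by
  simp only [tripleSum, Finset.sum_add_distrib]

theorem tripleSum_congr {s : ℕ} {f g : ℕ → ℕ → ℕ → W}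
    (h : ∀ i j r, i + j + r = s → f i j r = g i j r) : tripleSum s f = tripleSum s g := by
  refine Finset.sum_congr rfl fun x hx => Finset.sum_congr rfl fun y hy => h _ _ _ ?_
  rw [Finset.HasAntidiagonal.mem_antidiagonal] at hx hy
  omega

/-- A summand divisible by one of the three variables loses one total degree when that variable is
stripped off. This and its two companions do the reindexing in the recursions for e^{xL(1)}. -/
theorem tripleSum_succ_third {s : ℕ} {f : ℕ → ℕ → ℕ → W} (h : ∀ i j, f i j 0 = 0) :
    tripleSum (s + 1) f = tripleSum s fun i j r => f i j (r + 1) := by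
  unfold tripleSum
  rw [Finset.Nat.sum_antidiagonal_succ']
  simp [h]

theorem tripleSum_succ_first {s : ℕ} {f : ℕ → ℕ → ℕ → W} (h : ∀ j r, f 0 j r = 0) :
    tripleSum (s + 1) f = tripleSum s fun i j r => f (i + 1) j r := by
  unfold tripleSum
  rw [Finset.Nat.sum_antidiagonal_succ]
  simp [Finset.Nat.sum_antidiagonal_succ, h]

theorem tripleSum_succ_second {s : ℕ} {f : ℕ → ℕ → ℕ → W} (h : ∀ i r, f i 0 r = 0) :
    tripleSum (s + 1) f = tripleSum s fun i j r => f i (j + 1) r := by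
  unfold tripleSum
  rw [Finset.Nat.sum_antidiagonal_succ]
  simp [Finset.Nat.sum_antidiagonal_succ', h]

theorem map_tripleSum {W' : Type*} [AddCommGroup W'] (T : W →+ W') (s : ℕ)
    (f : ℕ → ℕ → ℕ → W) : T (tripleSum s f) = tripleSum s fun i j r => T (f i j r) := by
  simp only [tripleSum, map_sum]

theorem smul_tripleSum [Module ℂ W] (c : ℂ) (s : ℕ) (f : ℕ → ℕ → ℕ → W) :
    c • tripleSum s f = tripleSum s fun i j r => c • f i j r := by
  simp only [tripleSum, Finset.smul_sum]

end TripleSum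

/-! ### Divided powers -/

section DivPow

variable {W : Type*} [AddCommGroup W] [Module ℂ W]

/-- The divided power `Nˢ / s!`. -/
noncomputable def divPow (N : Module.End ℂ W) (s : ℕ) : Module.End ℂ W :=
  ((s.factorial : ℂ)⁻¹) • N ^ s

theorem divPow_zero (N : Module.End ℂ W) : divPow N 0 = 1 := by simp [divPow]

theorem divPow_zero_apply (N : Module.End ℂ W) (w : W) : divPow N 0 w = w := by simp [divPow]

theorem apply_divPow (N : Module.End ℂ W) (s : ℕ) (w : W) :
    N (divPow N s w) = ((s : ℂ) + 1) • divPow N (s + 1) w := by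
  unfold divPow
  rw [LinearMap.smul_apply, LinearMap.smul_apply, map_smul, smul_smul, pow_succ',
    Module.End.mul_apply, Nat.factorial_succ]
  congr 1
  have h1 : ((s : ℂ) + 1) ≠ 0 := Nat.cast_add_one_ne_zero s
  push_cast
  rw [mul_inv, mul_inv_cancel_left₀ h1]

theorem divPow_apply (N : Module.End ℂ W) (s : ℕ) (w : W) :
    divPow N s (N w) = ((s : ℂ) + 1) • divPow N (s + 1) w := by
  rw [← apply_divPow]
  unfold divPow
  rw [LinearMap.smul_apply, LinearMap.smul_apply, map_smul, ← Module.End.mul_apply,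
    ← Module.End.mul_apply, ← pow_succ', ← pow_succ]

theorem divPow_eq_zero {N : Module.End ℂ W} {S s : ℕ} {w : W} (h : (N ^ S) w = 0) (hs : S ≤ s) :
    divPow N s w = 0 := by
  unfold divPow
  rw [LinearMap.smul_apply, ← Nat.sub_add_cancel hs, pow_add, Module.End.mul_apply, h, map_zero,
    smul_zero]

theorem divPow_divPow (N : Module.End ℂ W) (s t : ℕ) (w : W) :
    divPow N s (divPow N t w) = ((s + t).choose s : ℂ) • divPow N (s + t) w := by
  unfold divPow
  simp only [LinearMap.smul_apply, map_smul, smul_smul, ← Module.End.mul_apply, ← pow_add]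
  congr 1
  rw [Nat.cast_add_choose]
  have h1 : ((s + t).factorial : ℂ) ≠ 0 := Nat.cast_ne_zero.2 (Nat.factorial_ne_zero _)
  have h2 : (s.factorial : ℂ) ≠ 0 := Nat.cast_ne_zero.2 (Nat.factorial_ne_zero _)
  have h3 : (t.factorial : ℂ) ≠ 0 := Nat.cast_ne_zero.2 (Nat.factorial_ne_zero _)
  field_simp

theorem divPow_smul (N : Module.End ℂ W) (c : ℂ) (s : ℕ) :
    divPow (c • N) s = c ^ s • divPow N s := by
  unfold divPow
  rw [smul_pow, smul_comm]

/-- The degree t part of e^{xN}e^{-xN} = 1: an alternating sum of binomial coefficients vanishes. -/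
theorem sum_divPow_neg (N : Module.End ℂ W) {t : ℕ} (ht : t ≠ 0) (w : W) :
    ∑ x ∈ Finset.HasAntidiagonal.antidiagonal t, divPow N x.1 (divPow ((-1 : ℂ) • N) x.2 w) = 0 := by
  have h : ∀ x ∈ Finset.HasAntidiagonal.antidiagonal t, divPow N x.1 (divPow ((-1 : ℂ) • N) x.2 w)
      = ((-1 : ℂ) ^ x.2 * (t.choose x.2 : ℂ)) • divPow N t w := by
    intro x hx
    rw [Finset.HasAntidiagonal.mem_antidiagonal] at hx
    rw [divPow_smul, LinearMap.smul_apply, map_smul, divPow_divPow, hx, smul_smul,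
      Nat.choose_symm_of_eq_add (by omega : t = x.1 + x.2)]
  rw [Finset.sum_congr rfl h, ← Finset.sum_smul]
  -- The range sum runs over the first index while the sign sits on the second, hence the
  -- reflection.
  rw [Finset.Nat.sum_antidiagonal_eq_sum_range_succ_mk, ← Finset.sum_range_reflect]
  have h2 : ∑ j ∈ Finset.range (t + 1), ((-1 : ℂ) ^ j * (t.choose j : ℂ)) = 0 := by
    have := Int.alternating_sum_range_choose_of_ne ht
    exact_mod_cast congrArg (fun z : ℤ => (z : ℂ)) this
  have h3 : ∑ j ∈ Finset.range t.succ, ((-1 : ℂ) ^ (t - (t.succ - 1 - j))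
      * (t.choose (t - (t.succ - 1 - j)) : ℂ)) = 0 := by
    rw [← h2]
    refine Finset.sum_congr rfl fun j hj => ?_
    rw [Finset.mem_range] at hj
    rw [show t - (t.succ - 1 - j) = j by omega]
  rw [h3, zero_smul]

end DivPow

/-! ### Brackets of `L(±1)` with vertex operators -/

section Brackets

variable {A B V W : Type*} [AddCommGroup V] [Module ℂ V] [AddCommGroup W] [Module ℂ W]
  {κ : Kind V} {D : VertexData A V} {M : ModData B V W}

/-- `[L(1), v_n] = (L(1)v)_n + 2 (L(0)v)_{n+1} + (L(-1)v)_{n+2}` -/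
theorem IsVertexAction.bracket_one
    (hD : IsVertexAction κ D D.toModData) (h : IsVertexAction κ D M) (v : V) (n : ℤ) (w : W) :
    M.L 1 (M.Y v n w) - M.Y v n (M.L 1 w)
      = M.Y (D.L 1 v) n w + (2 : ℂ) • M.Y (D.L 0 v) (n + 1) w + M.Y (D.L (-1) v) (n + 2) w := by
  have hM := h.L_relations
  have hV := hD.L_relations
  cases κ with
  | mobius => exact (hM.2 v n w).2.2
  | conformal ω c =>
    -- L(1) = ω₂, so the commutator formula has coefficients binom(2,i), and only i = 0, 1, 2
    -- survive, giving L(-1)v, L(0)v, L(1)v.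
    obtain ⟨N, hN, h3⟩ := ((h.commutator ω v 2 n w).and (Filter.eventually_ge_atTop 3)).exists
    have hs : ∑ i ∈ Finset.range N, ((Ring.choose (2 : ℤ) i : ℤ) : ℂ) •
          M.Y (D.Y ω i v) (2 + n - i) w
        = ∑ i ∈ Finset.range 3, ((Ring.choose (2 : ℤ) i : ℤ) : ℂ) •
          M.Y (D.Y ω i v) (2 + n - i) w := by
      symm
      apply Finset.sum_subset (Finset.range_subset_range.2 h3)
      intro i _ hi
      have : binom (2 : ℤ) i = 0 := by
        rw [show (2 : ℤ) = ((2 : ℕ) : ℤ) by rfl, binom_natCast,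
          Nat.choose_eq_zero_of_lt (by simp only [Finset.mem_range] at hi; omega), Nat.cast_zero]
      unfold binom at this
      rw [this, zero_smul]
    have c2 : Ring.choose (2 : ℤ) 2 = 1 := by
      have := Ring.choose_natCast (R := ℤ) 2 2
      simpa using this
    rw [hM.2.2.1, hV.1, hV.2.1, hV.2.2.1, hN, hs]
    simp only [Finset.sum_range_succ, Finset.sum_range_zero, Ring.choose_zero_right,
      Ring.choose_one_right, c2]
    simp only [Nat.cast_zero, Nat.cast_one, Nat.cast_ofNat, Int.cast_one, one_smul, zero_add,
      Int.cast_ofNat]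
    rw [show (2 : ℤ) + n - 0 = n + 2 by ring, show (2 : ℤ) + n - 1 = n + 1 by ring,
      show (2 : ℤ) + n - 2 = n by ring]
    abel

theorem VertexData.L_zero_of_mem_wt {k : ℤ} {u : V} (hu : u ∈ D.wt k) :
    D.L 0 u = (k : ℂ) • u := by
  rwa [VertexData.wt, Module.End.mem_eigenspace_iff] at hu

/-- On a homogeneous vector both L(0)u and L(-1)u produce multiples of u_{n+1}, so they merge into
one term: 2k from L(0), -(n+2) from the derivative property. -/
theorem IsVertexAction.bracket_one_of_mem_wt
    (hD : IsVertexAction κ D D.toModData) (h : IsVertexAction κ D M) {k : ℤ} {u : V}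
    (hu : u ∈ D.wt k) (n : ℤ) (w : W) :
    M.L 1 (M.Y u n w) = M.Y u n (M.L 1 w) + M.Y (D.L 1 u) n w
      + (2 * (k : ℂ) - n - 2) • M.Y u (n + 1) w := by
  have h1 := hD.bracket_one h u n w
  rw [sub_eq_iff_eq_add] at h1
  rw [h1, VertexData.L_zero_of_mem_wt hu, h.derivative, map_smul]
  simp only [Pi.smul_apply, LinearMap.smul_apply]
  rw [show n + 2 - 1 = n + 1 by ring]
  push_cast
  module

/-- `[L(0), u_n] = (wt u - n - 1) u_n` -/
theorem IsVertexAction.bracket_zero_of_mem_wt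
    (hD : IsVertexAction κ D D.toModData) (h : IsVertexAction κ D M) {k : ℤ} {u : V}
    (hu : u ∈ D.wt k) (n : ℤ) (w : W) :
    M.L 0 (M.Y u n w) = M.Y u n (M.L 0 w) + ((k - n - 1 : ℤ) : ℂ) • M.Y u n w := by
  have h1 := hD.bracket_zero h u n w
  rw [sub_eq_iff_eq_add] at h1
  rw [h1, VertexData.L_zero_of_mem_wt hu, h.derivative, map_smul]
  simp only [Pi.smul_apply, LinearMap.smul_apply]
  rw [show n + 1 - 1 = n by ring]
  push_cast
  module

theorem divPow_L_one_mem_wt (h : Sl2Relations D.L) {k : ℤ} {u : V} (hu : u ∈ D.wt k) (j : ℕ) :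
    divPow (D.L 1) j u ∈ D.wt (k - j) := by
  refine Submodule.smul_mem _ _ ?_
  induction j with
  | zero => simpa using hu
  | succ j ih =>
    rw [pow_succ', Module.End.mul_apply, show k - ((j + 1 : ℕ) : ℤ) = k - j - 1 by push_cast; ring]
    exact VertexData.L_one_mem_wt h ih

/-- Commutation of divided powers of `L(1)` with `u_q`. -/
theorem divPow_L_one_Y
    (hD : IsVertexAction κ D D.toModData) (h : IsVertexAction κ D M) {k : ℤ} {u : V}
    (hu : u ∈ D.wt k) (q : ℤ) (w : W) (s : ℕ) :
    divPow (M.L 1) s (M.Y u q w) = tripleSum s fun i j r =>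
      binom (2 * k - j - q - 2) i • M.Y (divPow (D.L 1) j u) (q + i) (divPow (M.L 1) r w) := by
  induction s with
  | zero => simp [tripleSum, divPow_zero, binom_zero]
  | succ s ih =>
    set X : ℕ → ℕ → ℕ → W := fun i j r =>
      M.Y (divPow (D.L 1) j u) (q + i) (divPow (M.L 1) r w) with hX
    have hs : ((s : ℂ) + 1) ≠ 0 := Nat.cast_add_one_ne_zero s
    -- Multiplying by s + 1 turns the divided power of order s + 1 into L(1) applied to that of
    -- order s.
    refine smul_right_injective W hs ?_
    change ((s : ℂ) + 1) • _ = ((s : ℂ) + 1) • _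
    rw [← apply_divPow, ih, smul_tripleSum]
    have e1 : (M.L 1) (tripleSum s fun i j r => binom (2 * k - j - q - 2) i • X i j r)
        = tripleSum s fun i j r => binom (2 * k - j - q - 2) i • (M.L 1) (X i j r) := by
      have := map_tripleSum (M.L 1).toAddMonoidHom s
        (fun i j r => binom (2 * k - j - q - 2) i • X i j r)
      simpa using this
    -- L(1) raises exactly one of the three indices: r when it reaches w, j when it hits u, i
    -- through the u_{n+1} term.
    have e2 : ∀ i j r, (M.L 1) (X i j r) = ((r : ℂ) + 1) • X i j (r + 1)
        + ((j : ℂ) + 1) • X i (j + 1) r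
        + (2 * (k : ℂ) - 2 * j - q - i - 2) • X (i + 1) j r := by
      intro i j r
      rw [hX]
      simp only
      rw [hD.bracket_one_of_mem_wt h (divPow_L_one_mem_wt hD.sl2 hu j), apply_divPow, apply_divPow,
        map_smul, map_smul]
      simp only [Pi.smul_apply, LinearMap.smul_apply]
      congr 2
      · push_cast; ring
      · rw [show q + ((i + 1 : ℕ) : ℤ) = q + i + 1 by push_cast; ring]
    -- The factor s + 1 = i + j + r is split among the three indices. The j part uses upper index
    -- raised by one, so that it is restored after j ↦ j + 1; Pascal's rule moves the difference
    -- into the i part. The value 0 at i = 0 makes the shift in i legitimate.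
    have e3 : (tripleSum (s + 1) fun i j r => ((s : ℂ) + 1) • binom (2 * k - j - q - 2) i • X i j r)
        = (tripleSum (s + 1) fun i j r => ((r : ℂ) * binom (2 * k - j - q - 2) i) • X i j r)
        + (tripleSum (s + 1) fun i j r => ((j : ℂ) * binom (2 * k - j - q - 2 + 1) i) • X i j r)
        + (tripleSum (s + 1) fun i j r => (i.casesOn 0 (fun i' =>
            (2 * (k : ℂ) - 2 * j - q - i' - 2) * binom (2 * k - j - q - 2) i') : ℂ) • X i j r) := by
      rw [← tripleSum_add, ← tripleSum_add]
      refine tripleSum_congr fun i j r hijr => ?_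
      rw [smul_smul, ← add_smul, ← add_smul]
      congr 1
      have : ((s : ℂ) + 1) = i + j + r := by exact_mod_cast hijr.symm
      rw [this]
      cases i with
      | zero =>
        change _ = _ + _ * _ + (0 : ℂ)
        rw [binom_zero, binom_zero]; push_cast; ring
      | succ i =>
        simp only
        rw [binom_succ_succ]
        have h2 := succ_mul_binom_succ (2 * k - j - q - 2) i
        push_cast at h2 ⊢
        linear_combination h2
    rw [e1, e3, tripleSum_succ_third (by simp), tripleSum_succ_second (by simp),
      tripleSum_succ_first (by simp), ← tripleSum_add, ← tripleSum_add]
    refine tripleSum_congr fun i j r _ => ?_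
    rw [e2]
    simp only [smul_add, smul_smul]
    congr 2
    · congr 1; push_cast; ring
    · rw [show 2 * k - ((j + 1 : ℕ) : ℤ) - q - 2 + 1 = 2 * k - j - q - 2 by push_cast; ring]
      congr 1; push_cast; ring
    · rw [mul_comm]

/-- The identity behind the compatibility of `e^{xL(1)}` with the iterate side of the Jacobi
identity. -/
theorem sum_divPow_L_one_Y
    (hD : IsVertexAction κ D D.toModData) (h : IsVertexAction κ D M) {k : ℤ} {u : V}
    (hu : u ∈ D.wt k) (w : W) (t : ℕ) : ∀ (m l : ℤ),
    ∑ x ∈ Finset.HasAntidiagonal.antidiagonal t, ((-1 : ℂ) ^ x.1 * binom m x.1) •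
        divPow (M.L 1) x.2 (M.Y u (l + x.1) w)
      = tripleSum t fun i j r => binom (2 * k - j - 2 - m - l) i •
        M.Y (divPow (D.L 1) j u) (l + i) (divPow (M.L 1) r w) := by
  induction t with
  | zero => simp [tripleSum, divPow_zero, binom_zero]
  | succ t ih =>
    -- Pascal's rule in m: each side F satisfies F(t+1, m+1, l) = F(t+1, m, l) - F(t, m, l+1). The
    -- correction has smaller t but shifted l, which is why m and l are quantified inside the
    -- induction on t.
    have stepL : ∀ m l : ℤ, ∑ x ∈ Finset.HasAntidiagonal.antidiagonal (t + 1),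
        ((-1 : ℂ) ^ x.1 * binom (m + 1) x.1) •
        divPow (M.L 1) x.2 (M.Y u (l + x.1) w)
      = ∑ x ∈ Finset.HasAntidiagonal.antidiagonal (t + 1), ((-1 : ℂ) ^ x.1 * binom m x.1) •
        divPow (M.L 1) x.2 (M.Y u (l + x.1) w)
      - ∑ x ∈ Finset.HasAntidiagonal.antidiagonal t, ((-1 : ℂ) ^ x.1 * binom m x.1) •
        divPow (M.L 1) x.2 (M.Y u (l + 1 + x.1) w) := by
      intro m l
      rw [Finset.Nat.sum_antidiagonal_succ, Finset.Nat.sum_antidiagonal_succ, add_sub_assoc,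
        ← Finset.sum_sub_distrib]
      congr 1
      · simp only [binom_zero]
      · refine Finset.sum_congr rfl fun x _ => ?_
        rw [binom_succ_succ,
          show l + ((x.1 + 1 : ℕ) : ℤ) = l + 1 + x.1 by push_cast; ring, ← sub_smul]
        congr 1
        ring
    have stepR : ∀ m l : ℤ, (tripleSum (t + 1) fun i j r => binom (2 * k - j - 2 - (m + 1) - l) i •
          M.Y (divPow (D.L 1) j u) (l + i) (divPow (M.L 1) r w))
      = (tripleSum (t + 1) fun i j r => binom (2 * k - j - 2 - m - l) i •
          M.Y (divPow (D.L 1) j u) (l + i) (divPow (M.L 1) r w))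
      - tripleSum t fun i j r => binom (2 * k - j - 2 - m - (l + 1)) i •
          M.Y (divPow (D.L 1) j u) (l + 1 + i) (divPow (M.L 1) r w) := by
      intro m l
      rw [eq_sub_iff_add_eq]
      have : (tripleSum t fun i j r => binom (2 * k - j - 2 - m - (l + 1)) i •
          M.Y (divPow (D.L 1) j u) (l + 1 + i) (divPow (M.L 1) r w))
        = tripleSum (t + 1) fun i j r => (i.casesOn 0 fun i' =>
            binom (2 * k - j - 2 - (m + 1) - l) i' : ℂ) •
          M.Y (divPow (D.L 1) j u) (l + i) (divPow (M.L 1) r w) := by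
        rw [tripleSum_succ_first (by simp)]
        refine tripleSum_congr fun i j r _ => ?_
        rw [show l + ((i + 1 : ℕ) : ℤ) = l + 1 + i by push_cast; ring,
          show 2 * k - (j : ℤ) - 2 - m - (l + 1) = 2 * k - j - 2 - (m + 1) - l by ring]
      rw [this, ← tripleSum_add]
      refine tripleSum_congr fun i j r _ => ?_
      rw [← add_smul]
      congr 1
      cases i with
      | zero => simp
      | succ i =>
        simp only
        rw [show 2 * k - (j : ℤ) - 2 - m - l = 2 * k - j - 2 - (m + 1) - l + 1 by ring,
          binom_succ_succ, add_comm]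
    intro m l
    -- The recursion runs both up and down in m, so all of ℤ is reached from m = 0, where the left
    -- side is a single term and `divPow_L_one_Y` applies.
    induction m with
    | zero =>
      rw [Finset.Nat.sum_antidiagonal_succ]
      simp only [binom_zero_succ, binom_zero]
      simp only [pow_zero, mul_one, one_smul, mul_zero, zero_smul, Finset.sum_const_zero, add_zero,
        Nat.cast_zero]
      rw [divPow_L_one_Y hD h hu]
      refine tripleSum_congr fun i j r _ => ?_
      rw [show 2 * k - (j : ℤ) - 2 - 0 - l = 2 * k - j - l - 2 by ring]
    | succ m hm => rw [stepL, stepR, hm, ih]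
    | pred m hm =>
      have h1 := stepL (-(m : ℤ) - 1) l
      have h2 := stepR (-(m : ℤ) - 1) l
      rw [sub_add_cancel] at h1 h2
      rw [hm, h2, ih] at h1
      exact (sub_left_injective h1).symm

end Brackets

/-! ### Rearrangement of finite sums -/

section Box

open Finset HasAntidiagonal

variable {W : Type*} [AddCommGroup W]

/-- All series are finite truncations over boxes, whereas the identities for e^{xL(1)} are
homogeneous in total degree. Vanishing outside the box reconciles the two, with any cutoff at least
N + S. -/
theorem sum_range_range_eq_sum_antidiagonal {f : ℕ → ℕ → W} {N S T : ℕ}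
    (hN : ∀ i s, N ≤ i → f i s = 0) (hS : ∀ i s, S ≤ s → f i s = 0) (hT : N + S ≤ T) :
    ∑ i ∈ range N, ∑ s ∈ range S, f i s = ∑ t ∈ range T, ∑ x ∈ antidiagonal t, f x.1 x.2 := by
  rw [← sum_product' (range N) (range S) f]
  rw [← sum_fiberwise_of_maps_to (s := range N ×ˢ range S) (t := range T) (g := fun x => x.1 + x.2)
    (fun x hx => by simp only [mem_product, mem_range] at hx ⊢; omega)]
  refine sum_congr rfl fun t _ => sum_subset (fun x hx => ?_) fun x hx hx' => ?_
  · rw [HasAntidiagonal.mem_antidiagonal]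
    exact (mem_filter.1 hx).2
  · rw [HasAntidiagonal.mem_antidiagonal] at hx
    simp only [mem_filter, mem_product, mem_range, not_and_or, hx] at hx'
    rcases hx' with (h | h) | h
    · exact hN _ _ (by omega)
    · exact hS _ _ (by omega)
    · exact absurd trivial h

theorem sum_range_range_range_eq_sum_tripleSum {f : ℕ → ℕ → ℕ → W} {N J S T : ℕ}
    (hN : ∀ i j s, N ≤ i → f i j s = 0) (hJ : ∀ i j s, J ≤ j → f i j s = 0)
    (hS : ∀ i j s, S ≤ s → f i j s = 0) (hT : N + J + S ≤ T) :
    ∑ j ∈ range J, ∑ s ∈ range S, ∑ i ∈ range N, f i j s = ∑ t ∈ range T, tripleSum t f := by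
  have h1 : ∑ j ∈ range J, ∑ s ∈ range S, ∑ i ∈ range N, f i j s
      = ∑ s ∈ range S, ∑ i ∈ range N, ∑ j ∈ range J, f i j s := by
    rw [sum_comm]
    exact sum_congr rfl fun s _ => sum_comm
  have h2 : ∀ s, ∑ i ∈ range N, ∑ j ∈ range J, f i j s
      = ∑ a ∈ range (N + J), ∑ y ∈ antidiagonal a, f y.1 y.2 s := fun s =>
    sum_range_range_eq_sum_antidiagonal (f := fun i j => f i j s) (fun i j => hN i j s)
      (fun i j => hJ i j s) le_rfl
  rw [h1, sum_congr rfl fun s _ => h2 s, sum_comm]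
  refine sum_range_range_eq_sum_antidiagonal (f := fun a s => ∑ y ∈ antidiagonal a, f y.1 y.2 s)
    (fun a s ha => sum_eq_zero fun y hy => ?_) (fun a s hs => sum_eq_zero fun y _ => hS _ _ _ hs) hT
  rw [HasAntidiagonal.mem_antidiagonal] at hy
  by_cases h : N ≤ y.1
  · exact hN _ _ _ h
  · exact hJ _ _ _ (by omega)

end Box

/-! ### The series `e^{tL(1)} w` and the action of `𝔰𝔩(2)` on it -/

section Series

variable {W W' : Type*} [AddCommGroup W] [Module ℂ W] [AddCommGroup W'] [Module ℂ W']

/-- Multiplication by `t` on `W[t]`. -/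
noncomputable def mulVar : (ℕ →₀ W) →ₗ[ℂ] (ℕ →₀ W) := Finsupp.lmapDomain W ℂ Nat.succ

theorem mulVar_zero (g : ℕ →₀ W) : mulVar g 0 = 0 :=
  Finsupp.mapDomain_of_notMem_range _ _ (by simp)

theorem mulVar_succ (g : ℕ →₀ W) (s : ℕ) : mulVar g (s + 1) = g s :=
  Finsupp.mapDomain_apply Nat.succ_injective g s

/-- The coefficientwise action of an operator. -/
noncomputable abbrev coeffwise {α : Type*} (T : W →ₗ[ℂ] W') : (α →₀ W) →ₗ[ℂ] (α →₀ W') :=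
  Finsupp.mapRange.linearMap T

/-- `e^{tN} w` for a locally nilpotent `N`. -/
noncomputable abbrev expPoly (N : Module.End ℂ W) (hN : ∀ w, ∃ m : ℕ, (N ^ m) w = 0) :
    W →ₗ[ℂ] (ℕ →₀ W) :=
  expSeries N LinearMap.id hN

theorem expSeries_apply {S : Type*} [AddCommGroup S] [Module ℂ S] (N : Module.End ℂ W)
    (j : S →ₗ[ℂ] W) (h : ∀ s, ∃ m : ℕ, (N ^ m) (j s) = 0) (s : S) (i : ℕ) :
    expSeries N j h s i = divPow N i (j s) := rfl

/-- Any exponent killing the vector may serve as cutoff, not just the exact support. Several series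
can thus share one bound. -/
theorem expSeries_sum {S U : Type*} [AddCommGroup S] [Module ℂ S] [AddCommGroup U] [Module ℂ U]
    {N : Module.End ℂ W} {j : S →ₗ[ℂ] W} {h : ∀ s, ∃ m : ℕ, (N ^ m) (j s) = 0} {s : S} {m : ℕ}
    (hm : (N ^ m) (j s) = 0) (F : ℕ → W →ₗ[ℂ] U) :
    Finsupp.lsum ℂ F (expSeries N j h s) = ∑ i ∈ Finset.range m, F i (divPow N i (j s)) := by
  rw [Finsupp.lsum_apply]
  refine Finsupp.sum_of_support_subset _ (fun i hi => ?_) _ (by simp)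
  rw [Finset.mem_range]
  by_contra hlt
  rw [Finsupp.mem_support_iff, expSeries_apply, divPow_eq_zero hm (by omega)] at hi
  exact hi rfl

variable {L : SignType → Module.End ℂ W}

theorem L_zero_divPow (h : Sl2Relations L) (s : ℕ) (w : W) :
    L 0 (divPow (L 1) s w) = divPow (L 1) s (L 0 w) - (s : ℂ) • divPow (L 1) s w := by
  induction s with
  | zero => simp [divPow_zero]
  | succ s ih =>
    have hs : ((s : ℂ) + 1) ≠ 0 := Nat.cast_add_one_ne_zero s
    refine smul_right_injective W hs ?_
    change ((s : ℂ) + 1) • _ = ((s : ℂ) + 1) • _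
    rw [← map_smul, ← apply_divPow, L_one_apply_zero h, ih, smul_sub, ← apply_divPow, map_sub,
      map_smul, apply_divPow _ s w]
    push_cast
    module

theorem L_neg_one_apply_one (h : Sl2Relations L) (w : W) :
    L (-1) (L 1 w) = L 1 (L (-1) w) - (2 : ℂ) • L 0 w := by
  have := congrArg (fun T : Module.End ℂ W => T w) h.2.2
  simp only [Ring.lie_def, LinearMap.sub_apply, Module.End.mul_apply, LinearMap.smul_apply] at this
  rw [sub_eq_iff_eq_add] at this
  rw [this]
  module

/-- The part of degree s + 1 of e^{-tL(1)}L(-1)e^{tL(1)} = L(-1) - 2tL(0) + t²L(1): the adjoint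
action of L(1) on L(-1) stops after two steps. -/
theorem L_neg_one_divPow (h : Sl2Relations L) (s : ℕ) (w : W) :
    L (-1) (divPow (L 1) (s + 1) w) = divPow (L 1) (s + 1) (L (-1) w)
      - (2 : ℂ) • divPow (L 1) s (L 0 w) + (s : ℂ) • divPow (L 1) s w := by
  induction s with
  | zero =>
    have h1 : ∀ w, divPow (L 1) 1 w = L 1 w := by simp [divPow]
    simp [divPow_zero, h1, L_neg_one_apply_one h]
  | succ s ih =>
    have hs : (((s + 1 : ℕ) : ℂ) + 1) ≠ 0 := Nat.cast_add_one_ne_zero _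
    refine smul_right_injective W hs ?_
    change (((s + 1 : ℕ) : ℂ) + 1) • _ = (((s + 1 : ℕ) : ℂ) + 1) • _
    rw [← map_smul, ← apply_divPow, L_neg_one_apply_one h, ih, smul_add, smul_sub, ← apply_divPow,
      map_add, map_sub, map_smul, map_smul, apply_divPow _ s w, apply_divPow _ s (L 0 w),
      L_zero_divPow h]
    push_cast
    module

variable {hN : ∀ w, ∃ m : ℕ, ((L 1) ^ m) w = 0}

theorem coeffwise_L_one_expPoly (w : W) :
    coeffwise (L 1) (expPoly (L 1) hN w) = expPoly (L 1) hN (L 1 w) := by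
  ext s
  simp [expSeries_apply, apply_divPow, divPow_apply]

theorem coeffwise_L_zero_expPoly (h : Sl2Relations L) (w : W) :
    coeffwise (L 0) (expPoly (L 1) hN w) = expPoly (L 1) hN (L 0 w)
      - mulVar (coeffwise (L 1) (expPoly (L 1) hN w)) := by
  ext s
  rw [Finsupp.sub_apply]
  simp only [Finsupp.mapRange.linearMap_apply, Finsupp.mapRange_apply]
  cases s with
  | zero => rw [mulVar_zero]; simp [expSeries_apply, divPow_zero]
  | succ s =>
    rw [mulVar_succ, Finsupp.mapRange_apply]
    simp only [expSeries_apply, LinearMap.id_apply]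
    rw [L_zero_divPow h, apply_divPow]
    push_cast
    rfl

theorem coeffwise_L_neg_one_expPoly (h : Sl2Relations L) (w : W) :
    coeffwise (L (-1)) (expPoly (L 1) hN w) = expPoly (L 1) hN (L (-1) w)
      - (2 : ℂ) • mulVar (expPoly (L 1) hN (L 0 w))
      + mulVar (mulVar (coeffwise (L 1) (expPoly (L 1) hN w))) := by
  ext s
  rw [Finsupp.add_apply, Finsupp.sub_apply, Finsupp.smul_apply]
  simp only [Finsupp.mapRange.linearMap_apply, Finsupp.mapRange_apply]
  cases s with
  | zero => rw [mulVar_zero, mulVar_zero]; simp [expSeries_apply, divPow_zero]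
  | succ s =>
    rw [mulVar_succ, mulVar_succ]
    simp only [expSeries_apply, LinearMap.id_apply]
    rw [L_neg_one_divPow h]
    congr 1
    cases s with
    | zero => rw [mulVar_zero]; simp
    | succ s =>
      rw [mulVar_succ, Finsupp.mapRange_apply, expSeries_apply, apply_divPow]
      push_cast
      rfl

end Series

/-! ### The operators `I(e^{xL(1)} w, x⁻¹)` -/

section OppComponent

variable {R W₁ W₂ W₃ : Type*} [CommRing R] [AddCommGroup W₁] [Module ℂ W₁]
  [AddCommGroup W₂] [Module ℂ W₂] [AddCommGroup W₃] [Module ℂ W₃]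

/-- The coefficient of `x^{-n-1}` in `I(g(x), x⁻¹)`, where
`I(w,x) = ∑ₙ w_n x^{-n-1}` and `g(t)` is a polynomial in `t`. -/
noncomputable def seriesComponent (I : W₁ →ₗ[ℂ] R → W₂ →ₗ[ℂ] W₃) (n : R) :
    (ℕ →₀ W₁) →ₗ[ℂ] W₂ →ₗ[ℂ] W₃ :=
  Finsupp.lsum ℂ fun s : ℕ => LinearMap.proj (-n - 2 - s) ∘ₗ I

theorem seriesComponent_single (I : W₁ →ₗ[ℂ] R → W₂ →ₗ[ℂ] W₃) (n : R) (s : ℕ) (w : W₁) :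
    seriesComponent I n (Finsupp.single s w) = I w (-n - 2 - s) := by
  simp [seriesComponent]

theorem seriesComponent_mulVar (I : W₁ →ₗ[ℂ] R → W₂ →ₗ[ℂ] W₃) (n : R) (g : ℕ →₀ W₁) :
    seriesComponent I n (mulVar g) = seriesComponent I (n + 1) g := by
  induction g using Finsupp.induction_linear with
  | zero => simp
  | add f g hf hg => rw [map_add, map_add, map_add, hf, hg]
  | single s w =>
    rw [mulVar, Finsupp.lmapDomain_apply, Finsupp.mapDomain_single, seriesComponent_single,
      seriesComponent_single, show -n - 2 - ((s.succ : ℕ) : R) = -(n + 1) - 2 - s by push_cast; ring]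

/-- The coefficient of `x^{-n-1}` in `I(e^{xN} w, x⁻¹)`. -/
noncomputable def oppComponent (N : Module.End ℂ W₁) (hN : ∀ w, ∃ m : ℕ, (N ^ m) w = 0)
    (I : W₁ →ₗ[ℂ] R → W₂ →ₗ[ℂ] W₃) : W₁ →ₗ[ℂ] R → W₂ →ₗ[ℂ] W₃ :=
  LinearMap.pi fun n => seriesComponent I n ∘ₗ expPoly N hN

theorem oppComponent_apply (N : Module.End ℂ W₁) (hN : ∀ w, ∃ m : ℕ, (N ^ m) w = 0)
    (I : W₁ →ₗ[ℂ] R → W₂ →ₗ[ℂ] W₃) (w : W₁) (n : R) :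
    oppComponent N hN I w n = seriesComponent I n (expPoly N hN w) := rfl

theorem oppComponent_eq_sum {N : Module.End ℂ W₁} {hN : ∀ w, ∃ m : ℕ, (N ^ m) w = 0}
    (I : W₁ →ₗ[ℂ] R → W₂ →ₗ[ℂ] W₃) {w : W₁} {m : ℕ} (hm : (N ^ m) w = 0) (n : R) :
    oppComponent N hN I w n = ∑ s ∈ Finset.range m, I (divPow N s w) (-n - 2 - s) :=
  expSeries_sum (j := LinearMap.id) hm _

variable {L₁ : SignType → Module.End ℂ W₁} {L₂ : SignType → Module.End ℂ W₂}
  {L₃ : SignType → Module.End ℂ W₃} {I : W₁ →ₗ[ℂ] R → W₂ →ₗ[ℂ] W₃}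
  {hN : ∀ w, ∃ m : ℕ, ((L₁ 1) ^ m) w = 0}

/-- The powers xⁱ in the bracket relation become x⁻ⁱ because the operator is taken at x⁻¹; hence the
indices n - i here and in the next lemma. -/
theorem seriesComponent_bracket_one (h : Sl2BracketRelations L₁ L₂ L₃ fun w (n : R) w₂ => I w n w₂)
    (g : ℕ →₀ W₁) (n : R) (w₂ : W₂) :
    L₃ 1 (seriesComponent I n g w₂) - seriesComponent I n g (L₂ 1 w₂)
      = seriesComponent I n (coeffwise (L₁ 1) g) w₂
        + (2 : ℂ) • seriesComponent I (n - 1) (coeffwise (L₁ 0) g) w₂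
        + seriesComponent I (n - 2) (coeffwise (L₁ (-1)) g) w₂ := by
  induction g using Finsupp.induction_linear with
  | zero => simp
  | add f g hf hg =>
    simp only [map_add, LinearMap.add_apply, smul_add]
    rw [add_sub_add_comm, hf, hg]
    abel
  | single s w =>
    simp only [Finsupp.mapRange.linearMap_apply, Finsupp.mapRange_single, seriesComponent_single]
    rw [(h w _ w₂).2.2, show -n - 2 - (s : R) + 1 = -(n - 1) - 2 - s by ring,
      show -n - 2 - (s : R) + 2 = -(n - 2) - 2 - s by ring]

theorem seriesComponent_bracket_zero (h : Sl2BracketRelations L₁ L₂ L₃ fun w (n : R) w₂ => I w n w₂)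
    (g : ℕ →₀ W₁) (n : R) (w₂ : W₂) :
    L₃ 0 (seriesComponent I n g w₂) - seriesComponent I n g (L₂ 0 w₂)
      = seriesComponent I n (coeffwise (L₁ 0) g) w₂
        + seriesComponent I (n - 1) (coeffwise (L₁ (-1)) g) w₂ := by
  induction g using Finsupp.induction_linear with
  | zero => simp
  | add f g hf hg =>
    simp only [map_add, LinearMap.add_apply]
    rw [add_sub_add_comm, hf, hg]
    abel
  | single s w =>
    simp only [Finsupp.mapRange.linearMap_apply, Finsupp.mapRange_single, seriesComponent_single]
    rw [(h w _ w₂).2.1, show -n - 2 - (s : R) + 1 = -(n - 1) - 2 - s by ring]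

theorem seriesComponent_bracket_neg_one
    (h : Sl2BracketRelations L₁ L₂ L₃ fun w (n : R) w₂ => I w n w₂)
    (g : ℕ →₀ W₁) (n : R) (w₂ : W₂) :
    L₃ (-1) (seriesComponent I n g w₂) - seriesComponent I n g (L₂ (-1) w₂)
      = seriesComponent I n (coeffwise (L₁ (-1)) g) w₂ := by
  induction g using Finsupp.induction_linear with
  | zero => simp
  | add f g hf hg =>
    simp only [map_add, LinearMap.add_apply]
    rw [add_sub_add_comm, hf, hg]
  | single s w =>
    simp only [Finsupp.mapRange.linearMap_apply, Finsupp.mapRange_single, seriesComponent_single]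
    rw [(h w _ w₂).1]

/-- Moving L(0) and L(-1) past e^{xL(1)} produces corrections that cancel the L(1) and L(0) terms,
leaving L(-1) alone. After transposition and scaling this is the bracket with L'(-1); the two lemmas
below play the same part for L'(0) and L'(1). -/
theorem oppComponent_bracket_one (hL : Sl2Relations L₁)
    (h : Sl2BracketRelations L₁ L₂ L₃ fun w (n : R) w₂ => I w n w₂) (w : W₁) (n : R) (w₂ : W₂) :
    L₃ 1 (oppComponent (L₁ 1) hN I w n w₂) - oppComponent (L₁ 1) hN I w n (L₂ 1 w₂)
      = oppComponent (L₁ 1) hN I (L₁ (-1) w) (n - 2) w₂ := by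
  simp only [oppComponent_apply]
  rw [seriesComponent_bracket_one h, coeffwise_L_zero_expPoly hL, coeffwise_L_neg_one_expPoly hL]
  simp only [map_add, map_sub, map_smul, seriesComponent_mulVar, LinearMap.add_apply,
    LinearMap.sub_apply, LinearMap.smul_apply]
  rw [show n - 1 + 1 = n by ring, show n - 2 + 1 = n - 1 by ring, show n - 1 + 1 = n by ring]
  module

theorem oppComponent_bracket_zero (hL : Sl2Relations L₁)
    (h : Sl2BracketRelations L₁ L₂ L₃ fun w (n : R) w₂ => I w n w₂) (w : W₁) (n : R) (w₂ : W₂) :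
    L₃ 0 (oppComponent (L₁ 1) hN I w n w₂) - oppComponent (L₁ 1) hN I w n (L₂ 0 w₂)
      = oppComponent (L₁ 1) hN I (L₁ (-1) w) (n - 1) w₂
        - oppComponent (L₁ 1) hN I (L₁ 0 w) n w₂ := by
  simp only [oppComponent_apply]
  rw [seriesComponent_bracket_zero h, coeffwise_L_zero_expPoly hL, coeffwise_L_neg_one_expPoly hL]
  simp only [map_add, map_sub, map_smul, seriesComponent_mulVar, LinearMap.add_apply,
    LinearMap.sub_apply, LinearMap.smul_apply]
  rw [show n - 1 + 1 = n by ring]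
  module

theorem oppComponent_bracket_neg_one (hL : Sl2Relations L₁)
    (h : Sl2BracketRelations L₁ L₂ L₃ fun w (n : R) w₂ => I w n w₂) (w : W₁) (n : R) (w₂ : W₂) :
    L₃ (-1) (oppComponent (L₁ 1) hN I w n w₂) - oppComponent (L₁ 1) hN I w n (L₂ (-1) w₂)
      = oppComponent (L₁ 1) hN I (L₁ (-1) w) n w₂
        - (2 : ℂ) • oppComponent (L₁ 1) hN I (L₁ 0 w) (n + 1) w₂
        + oppComponent (L₁ 1) hN I (L₁ 1 w) (n + 2) w₂ := by
  simp only [oppComponent_apply]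
  rw [seriesComponent_bracket_neg_one h, coeffwise_L_neg_one_expPoly hL, coeffwise_L_one_expPoly]
  simp only [map_add, map_sub, map_smul, seriesComponent_mulVar, LinearMap.add_apply,
    LinearMap.sub_apply, LinearMap.smul_apply]
  rw [show n + 1 + 1 = n + 2 by ring]

end OppComponent

/-! ### The Jacobi identity for opposite operators -/

section OppJacobi

variable {R B B' V W₁ W₂ W₃ : Type*} [CommRing R] [AddCommGroup B] {A : AddSubgroup B}
  [AddCommGroup V] [Module ℂ V] [AddCommGroup W₁] [Module ℂ W₁]
  [AddCommGroup W₂] [Module ℂ W₂] [AddCommGroup W₃] [Module ℂ W₃] {κ : Kind V}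
  {D : VertexData A V} {M₁ : ModData B' V W₁} {M₂ : ModData B V W₂} {M₃ : ModData B V W₃}

/-- On weight k the scaling (-x⁻²)^{L(0)} is the scalar (-1)^k x^{-2k}, that is, a sign and an index
shift by 2k. Results on `oppComponent` thereby become results on W'. -/
theorem oppositeY_of_mem_wt (hD : IsStronglyGradedVertexAlgebra κ D) (M : ModData B V W₂) {k : ℤ}
    {u : V} (hu : u ∈ D.wt k) (n : ℤ) :
    oppositeY hD M u n
      = ((-1 : ℂ) ^ k) • oppComponent (D.L 1) hD.L_one_nilpotent M.Y u (n - 2 * k) := by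
  have hlift : oppositeY hD M u = oppositeYHomogeneous hD M k ⟨u, hu⟩ :=
    hD.wt_directSum.lift_apply (oppositeYHomogeneous hD M) k ⟨u, hu⟩
  obtain ⟨m, hm⟩ := hD.L_one_nilpotent u
  rw [hlift, oppComponent_eq_sum _ hm]
  unfold oppositeYHomogeneous
  rw [LinearMap.pi_apply, LinearMap.smul_apply, LinearMap.comp_apply]
  congr 1
  refine (expSeries_sum (j := (D.wt k).subtype) hm _).trans (Finset.sum_congr rfl fun i _ => ?_)
  rw [LinearMap.comp_apply, LinearMap.proj_apply,
    show -(n - 2 * k) - 2 - (i : ℤ) = -n - i - 2 + 2 * k by ring]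
  rfl

theorem oppositeY_eq_sum (hD : IsStronglyGradedVertexAlgebra κ D) (M : ModData B V W₂) {k : ℤ}
    {u : V} (hu : u ∈ D.wt k) {J : ℕ} (hJ : ((D.L 1) ^ J) u = 0) (n : ℤ) (w : W₂) :
    oppositeY hD M u n w = ((-1 : ℂ) ^ k) •
      ∑ j ∈ Finset.range J, M.Y (divPow (D.L 1) j u) (2 * k - 2 - j - n) w := by
  rw [oppositeY_of_mem_wt hD M hu, oppComponent_eq_sum _ hJ, LinearMap.smul_apply,
    LinearMap.sum_apply]
  congr 1
  refine Finset.sum_congr rfl fun i _ => ?_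
  rw [show -(n - 2 * k) - 2 - (i : ℤ) = 2 * k - 2 - i - n by ring]

/-- The iterate side of the Jacobi identity for opposite operators. -/
theorem oppComponent_iterate (hD : IsStronglyGradedVertexAlgebra κ D)
    (h₁ : IsVertexAction κ D M₁) (hN : ∀ w, ∃ m : ℕ, ((M₁.L 1) ^ m) w = 0)
    (I : W₁ →ₗ[ℂ] R → W₂ →ₗ[ℂ] W₃) {k : ℤ} {u : V} (hu : u ∈ D.wt k) (l m : ℤ) (n : R)
    (w : W₁) (w₂ : W₂) {J S : ℕ} (hJ : ((D.L 1) ^ J) u = 0) (hS : ((M₁.L 1) ^ S) w = 0) :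
    ∀ᶠ N : ℕ in Filter.atTop,
    ∑ i ∈ Finset.range N, binom m i • (((-1 : ℂ) ^ (k - l - i - 1)) •
      oppComponent (M₁.L 1) hN I (M₁.Y u (l + i) w)
        ((m : R) + n - i - (2 * (k - l - i - 1) : ℤ)) w₂)
    = (-((-1 : ℂ) ^ k * (-1 : ℂ) ^ l)) • ∑ j ∈ Finset.range J, ∑ s ∈ Finset.range S,
      ∑ i ∈ Finset.range N, binom (2 * k - 2 - j - m - l) i •
        I (M₁.Y (divPow (D.L 1) j u) (l + i) (divPow (M₁.L 1) s w))
          (((2 * k - 2 - j - m - l : ℤ) : R) + (-n - l - 2 - s) - i) w₂ := by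
  have ht : ∀ (u : V) (w : W₁), ∃ N : ℕ, ∀ i : ℕ, N ≤ i → M₁.Y u (l + i) w = 0 := by
    intro u w
    obtain ⟨N, hN⟩ := h₁.truncation u w
    exact ⟨(N - l).toNat, fun i hi => hN _ (by omega)⟩
  obtain ⟨N₀, hN₀⟩ := ht u w
  -- One truncation bound for all j and s: only finitely many pairs have nonzero divided powers.
  have ht' : ∃ N₁ : ℕ, ∀ j s i : ℕ, N₁ ≤ i →
      M₁.Y (divPow (D.L 1) j u) (l + i) (divPow (M₁.L 1) s w) = 0 := by
    choose f hf using fun j s => ht (divPow (D.L 1) j u) (divPow (M₁.L 1) s w)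
    refine ⟨(Finset.range J).sup fun j => (Finset.range S).sup fun s => f j s, fun j s i hi => ?_⟩
    by_cases hj : J ≤ j
    · rw [divPow_eq_zero hJ hj]; simp
    by_cases hs : S ≤ s
    · rw [divPow_eq_zero hS hs]; simp
    refine hf j s i (le_trans ?_ hi)
    exact le_trans (Finset.le_sup (f := fun s => f j s) (Finset.mem_range.2 (not_le.1 hs)))
      (Finset.le_sup (f := fun j => (Finset.range S).sup fun s => f j s)
        (Finset.mem_range.2 (not_le.1 hj)))
  obtain ⟨N₁, hN₁⟩ := ht'
  -- One nilpotency exponent for all i: only finitely many u_{l+i}w are nonzero.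
  have hS' : ∃ S' : ℕ, ∀ i : ℕ, ((M₁.L 1) ^ S') (M₁.Y u (l + i) w) = 0 := by
    choose f hf using fun i : ℕ => hN (M₁.Y u (l + i) w)
    refine ⟨(Finset.range N₀).sup f, fun i => ?_⟩
    by_cases hi : N₀ ≤ i
    · rw [hN₀ i hi, map_zero]
    · have : f i ≤ (Finset.range N₀).sup f := Finset.le_sup (Finset.mem_range.2 (not_le.1 hi))
      rw [← Nat.sub_add_cancel this, pow_add, Module.End.mul_apply, hf i, map_zero]
  obtain ⟨S', hS'⟩ := hS'
  filter_upwards [Filter.eventually_ge_atTop N₀, Filter.eventually_ge_atTop N₁] with N hge₀ hge₁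
  -- In every term of either side the component index is c - t, where t is the total degree of the
  -- term. In degree t both sides are therefore images under one linear map G t.
  set c : R := (2 * k - 4 - m - 2 * l : ℤ) - n with hc
  set G : ℕ → W₁ →ₗ[ℂ] W₃ := fun t => (LinearMap.applyₗ w₂) ∘ₗ LinearMap.proj (c - t) ∘ₗ I with hG
  have hGa : ∀ t w, G t w = I w (c - t) w₂ := fun t w => rfl
  set T := N + S' + (N + J + S) with hT
  have eL : ∑ i ∈ Finset.range N, binom m i • (((-1 : ℂ) ^ (k - l - i - 1)) •
        oppComponent (M₁.L 1) hN I (M₁.Y u (l + i) w)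
          ((m : R) + n - i - (2 * (k - l - i - 1) : ℤ)) w₂)
      = (-((-1 : ℂ) ^ k * (-1 : ℂ) ^ l)) • ∑ i ∈ Finset.range N, ∑ s ∈ Finset.range S',
        G (i + s) (((-1 : ℂ) ^ i * binom m i) • divPow (M₁.L 1) s (M₁.Y u (l + i) w)) := by
    rw [Finset.smul_sum]
    refine Finset.sum_congr rfl fun i _ => ?_
    rw [oppComponent_eq_sum _ (hS' i), LinearMap.sum_apply, smul_smul, Finset.smul_sum,
      Finset.smul_sum]
    refine Finset.sum_congr rfl fun s _ => ?_
    rw [map_smul, smul_smul, hGa]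
    congr 1
    · have : (-1 : ℂ) ^ (k - l - i - 1) = -((-1 : ℂ) ^ k * (-1 : ℂ) ^ l) * (-1 : ℂ) ^ i := by
        have h1 : (-1 : ℂ) ≠ 0 := by norm_num
        rw [zpow_sub₀ h1, zpow_sub₀ h1, zpow_sub₀ h1, zpow_one, zpow_natCast]
        have h2 : ((-1 : ℂ) ^ l)⁻¹ = (-1 : ℂ) ^ l := by rw [← inv_zpow]; norm_num
        have h3 : ((-1 : ℂ) ^ i)⁻¹ = (-1 : ℂ) ^ i := by rw [← inv_pow]; norm_num
        rw [div_eq_mul_inv, div_eq_mul_inv, div_eq_mul_inv, h2, h3]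
        norm_num
      rw [this]; ring
    · rw [show (m : R) + n - i - (2 * (k - l - i - 1) : ℤ) = -c + i - 2 by rw [hc]; push_cast; ring,
        show -(-c + (i : R) - 2) - 2 - s = c - ((i + s : ℕ) : R) by push_cast; ring]
  have eR : ∑ j ∈ Finset.range J, ∑ s ∈ Finset.range S,
      ∑ i ∈ Finset.range N, binom (2 * k - 2 - j - m - l) i •
        I (M₁.Y (divPow (D.L 1) j u) (l + i) (divPow (M₁.L 1) s w))
          (((2 * k - 2 - j - m - l : ℤ) : R) + (-n - l - 2 - s) - i) w₂
      = ∑ j ∈ Finset.range J, ∑ s ∈ Finset.range S, ∑ i ∈ Finset.range N,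
        G (i + j + s) (binom (2 * k - j - 2 - m - l) i •
          M₁.Y (divPow (D.L 1) j u) (l + i) (divPow (M₁.L 1) s w)) := by
    refine Finset.sum_congr rfl fun j _ => Finset.sum_congr rfl fun s _ =>
      Finset.sum_congr rfl fun i _ => ?_
    rw [map_smul, hGa, show 2 * k - (j : ℤ) - 2 - m - l = 2 * k - 2 - j - m - l by ring]
    rw [show ((2 * k - 2 - j - m - l : ℤ) : R) + (-n - l - 2 - s) - i
      = c - ((i + j + s : ℕ) : R) by rw [hc]; push_cast; ring]
  -- Both sides are regrouped by total degree; in degree t the arguments of G t agree by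
  -- `sum_divPow_L_one_Y`.
  rw [eL, eR, sum_range_range_eq_sum_antidiagonal (T := T), sum_range_range_range_eq_sum_tripleSum
    (f := fun i j s => G (i + j + s) (binom (2 * k - j - 2 - m - l) i •
          M₁.Y (divPow (D.L 1) j u) (l + i) (divPow (M₁.L 1) s w))) (T := T)]
  · congr 1
    refine Finset.sum_congr rfl fun t _ => ?_
    have e1 : ∑ x ∈ Finset.HasAntidiagonal.antidiagonal t, G (x.1 + x.2)
          (((-1 : ℂ) ^ x.1 * binom m x.1) • divPow (M₁.L 1) x.2 (M₁.Y u (l + x.1) w))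
        = G t (∑ x ∈ Finset.HasAntidiagonal.antidiagonal t, ((-1 : ℂ) ^ x.1 * binom m x.1) •
          divPow (M₁.L 1) x.2 (M₁.Y u (l + x.1) w)) := by
      rw [map_sum]
      refine Finset.sum_congr rfl fun x hx => ?_
      rw [Finset.HasAntidiagonal.mem_antidiagonal.1 hx]
    rw [e1, sum_divPow_L_one_Y hD.toIsVertexAction h₁ hu]
    have e2 := map_tripleSum (G t).toAddMonoidHom t fun i j r =>
      binom (2 * k - j - 2 - m - l) i •
        M₁.Y (divPow (D.L 1) j u) (l + i) (divPow (M₁.L 1) r w)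
    refine e2.trans (tripleSum_congr fun i j r hijr => ?_)
    rw [hijr]
    rfl
  · intro i j s hi
    simp only [hN₁ j s i (hge₁.trans hi), smul_zero, map_zero]
  · intro i j s hj
    simp only [divPow_eq_zero hJ hj, map_zero, Pi.zero_apply, LinearMap.zero_apply, smul_zero]
  · intro i j s hs
    simp only [divPow_eq_zero hS hs, map_zero, smul_zero]
  · omega
  · intro i s hi
    simp only [hN₀ i (hge₀.trans hi), smul_zero, map_zero]
  · intro i s hs
    simp only [divPow_eq_zero (hS' i) hs, smul_zero, map_zero]
  · omega

/-- The Jacobi identity for the operators opposite to those of an intertwining operator. -/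
theorem oppComponent_jacobi (hD : IsStronglyGradedVertexAlgebra κ D)
    (h₁ : IsVertexAction κ D M₁) (hN : ∀ w, ∃ m : ℕ, ((M₁.L 1) ^ m) w = 0)
    {I : W₁ →ₗ[ℂ] R → W₂ →ₗ[ℂ] W₃}
    (hI : ∀ u, JacobiIdentity (M₁.Y u) (M₂.Y u) (M₃.Y u) fun w (n : R) w₂ => I w n w₂)
    {k : ℤ} {u : V} (hu : u ∈ D.wt k) (l m : ℤ) (n : R) (w : W₁) (w₂ : W₂) :
    ∀ᶠ N : ℕ in Filter.atTop,
    (∑ i ∈ Finset.range N, ((-1 : ℂ) ^ i * binom l i) •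
        oppComponent (M₁.L 1) hN I w (n + i) (oppositeY hD M₂ u (m + l - i) w₂))
      - ((-1 : ℂ) ^ l) • (∑ i ∈ Finset.range N, ((-1 : ℂ) ^ i * binom l i) •
        oppositeY hD M₃ u (m + i) (oppComponent (M₁.L 1) hN I w (n + l - i) w₂))
    = ∑ i ∈ Finset.range N, binom m i • (((-1 : ℂ) ^ (k - l - i - 1)) •
      oppComponent (M₁.L 1) hN I (M₁.Y u (l + i) w)
        ((m : R) + n - i - (2 * (k - l - i - 1) : ℤ)) w₂) := by
  obtain ⟨J, hJ⟩ := hD.L_one_nilpotent u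
  obtain ⟨S, hS⟩ := hN w
  -- The indices are those for which the opposite operators with indices m and n appear after x₁, x₂
  -- ↦ x₁⁻¹, x₂⁻¹: the shift -j comes from L(1)^j u, and -s from L(1)^s w.
  have hjac : ∀ᶠ N : ℕ in Filter.atTop, ∀ j ∈ Finset.range J, ∀ s ∈ Finset.range S, _ :=
    (Filter.eventually_all_finset _).2 fun j _ => (Filter.eventually_all_finset _).2 fun s _ =>
      hI (divPow (D.L 1) j u) l (2 * k - 2 - j - m - l) (-n - l - 2 - s) (divPow (M₁.L 1) s w) w₂
  filter_upwards [hjac, oppComponent_iterate hD h₁ hN I hu l m n w w₂ hJ hS] with N hjac hit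
  rw [hit]
  rw [Finset.sum_congr rfl fun j hj => Finset.sum_congr rfl fun s hs => (hjac j hj s hs).symm]
  simp only [Finset.sum_sub_distrib, ← Finset.smul_sum]
  have e1 : ∑ i ∈ Finset.range N, ((-1 : ℂ) ^ i * binom l i) •
        oppComponent (M₁.L 1) hN I w (n + i) (oppositeY hD M₂ u (m + l - i) w₂)
      = ((-1 : ℂ) ^ k) • ∑ j ∈ Finset.range J, ∑ s ∈ Finset.range S, ∑ i ∈ Finset.range N,
        ((-1 : ℂ) ^ i * binom l i) • I (divPow (M₁.L 1) s w) (-n - l - 2 - s + l - i)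
          (M₂.Y (divPow (D.L 1) j u) (2 * k - 2 - j - m - l + i) w₂) := by
    have : ∀ i : ℕ, ((-1 : ℂ) ^ i * binom l i) •
        oppComponent (M₁.L 1) hN I w (n + i) (oppositeY hD M₂ u (m + l - i) w₂)
      = ((-1 : ℂ) ^ k) • ∑ j ∈ Finset.range J, ∑ s ∈ Finset.range S,
        ((-1 : ℂ) ^ i * binom l i) • I (divPow (M₁.L 1) s w) (-n - l - 2 - s + l - i)
          (M₂.Y (divPow (D.L 1) j u) (2 * k - 2 - j - m - l + i) w₂) := by
      intro i
      rw [oppositeY_eq_sum hD M₂ hu hJ, oppComponent_eq_sum _ hS, map_smul, smul_comm, map_sum,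
        Finset.smul_sum]
      congr 1
      refine Finset.sum_congr rfl fun j _ => ?_
      rw [LinearMap.sum_apply, Finset.smul_sum]
      refine Finset.sum_congr rfl fun s _ => ?_
      rw [show -(n + i) - 2 - (s : R) = -n - l - 2 - s + l - i by ring,
        show 2 * k - 2 - (j : ℤ) - (m + l - i) = 2 * k - 2 - j - m - l + i by ring]
    rw [Finset.sum_congr rfl fun i _ => this i, ← Finset.smul_sum, Finset.sum_comm]
    congr 1
    exact Finset.sum_congr rfl fun j _ => Finset.sum_comm
  have e2 : ∑ i ∈ Finset.range N, ((-1 : ℂ) ^ i * binom l i) •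
        oppositeY hD M₃ u (m + i) (oppComponent (M₁.L 1) hN I w (n + l - i) w₂)
      = ((-1 : ℂ) ^ k) • ∑ j ∈ Finset.range J, ∑ s ∈ Finset.range S, ∑ i ∈ Finset.range N,
        ((-1 : ℂ) ^ i * binom l i) • M₃.Y (divPow (D.L 1) j u) (2 * k - 2 - j - m - l + l - i)
          (I (divPow (M₁.L 1) s w) (-n - l - 2 - s + i) w₂) := by
    have : ∀ i : ℕ, ((-1 : ℂ) ^ i * binom l i) •
        oppositeY hD M₃ u (m + i) (oppComponent (M₁.L 1) hN I w (n + l - i) w₂)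
      = ((-1 : ℂ) ^ k) • ∑ j ∈ Finset.range J, ∑ s ∈ Finset.range S,
        ((-1 : ℂ) ^ i * binom l i) • M₃.Y (divPow (D.L 1) j u) (2 * k - 2 - j - m - l + l - i)
          (I (divPow (M₁.L 1) s w) (-n - l - 2 - s + i) w₂) := by
      intro i
      rw [oppositeY_eq_sum hD M₃ hu hJ, oppComponent_eq_sum _ hS, smul_comm, Finset.smul_sum]
      congr 1
      refine Finset.sum_congr rfl fun j _ => ?_
      rw [LinearMap.sum_apply, map_sum, Finset.smul_sum]
      refine Finset.sum_congr rfl fun s _ => ?_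
      rw [show -(n + l - i) - 2 - (s : R) = -n - l - 2 - s + i by ring,
        show 2 * k - 2 - (j : ℤ) - (m + i) = 2 * k - 2 - j - m - l + l - i by ring]
    rw [Finset.sum_congr rfl fun i _ => this i, ← Finset.smul_sum, Finset.sum_comm]
    congr 1
    exact Finset.sum_congr rfl fun j _ => Finset.sum_comm
  rw [e1, e2, smul_comm ((-1 : ℂ) ^ l), ← smul_sub, neg_smul, mul_smul, ← smul_neg]
  congr 1
  -- The two product terms have exchanged roles, so the factor (-1)^l must move from one to the
  -- other; it does since its square is 1.
  have hl : (-1 : ℂ) ^ l * (-1 : ℂ) ^ l = 1 := by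
    rw [← mul_zpow]; norm_num
  rw [smul_sub, smul_smul, hl, one_smul, neg_sub]

end OppJacobi

/-! ### Projections onto homogeneous subspaces -/

section Projection

variable {ι W : Type*} [AddCommGroup W] [Module ℂ W] {p : ι → Submodule ℂ W}

open Classical in
/-- The projection of `W = ∐ᵢ p i` onto `p i`. -/
noncomputable def IsDirectSum.proj (h : IsDirectSum p) (i : ι) : W →ₗ[ℂ] W :=
  h.lift fun j => if j = i then (p j).subtype else 0

theorem IsDirectSum.proj_of_mem (h : IsDirectSum p) {i : ι} {w : W} (hw : w ∈ p i) :
    h.proj i w = w := by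
  classical
  have := h.lift_apply (fun j => if j = i then (p j).subtype else 0) i ⟨w, hw⟩
  simpa [IsDirectSum.proj] using this

theorem IsDirectSum.proj_of_mem_ne (h : IsDirectSum p) {i j : ι} (hij : j ≠ i) {w : W}
    (hw : w ∈ p j) : h.proj i w = 0 := by
  classical
  have := h.lift_apply (fun j => if j = i then (p j).subtype else 0) j ⟨w, hw⟩
  simpa [IsDirectSum.proj, hij] using this

theorem IsDirectSum.hom_ext (h : IsDirectSum p) {U : Type*} [AddCommGroup U] [Module ℂ U]
    {S T : W →ₗ[ℂ] U} (hST : ∀ i, ∀ w ∈ p i, S w = T w) : S = T := by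
  have h1 : ⨆ i, p i ≤ LinearMap.eqLocus S T := iSup_le fun i w hw => hST i w hw
  rw [h.2] at h1
  ext w
  exact h1 trivial

theorem IsDirectSum.proj_mem (h : IsDirectSum p) (i : ι) (w : W) : h.proj i w ∈ p i := by
  have h1 : ⨆ j, p j ≤ (p i).comap (h.proj i) := by
    refine iSup_le fun j w hw => ?_
    rw [Submodule.mem_comap]
    by_cases hij : j = i
    · subst hij; rwa [h.proj_of_mem hw]
    · rw [h.proj_of_mem_ne hij hw]; exact Submodule.zero_mem _
  rw [h.2] at h1
  exact h1 trivial

theorem IsDirectSum.exists_sum_proj (h : IsDirectSum p) (w : W) :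
    ∃ s : Finset ι, w = ∑ i ∈ s, h.proj i w := by
  have hw : w ∈ ⨆ i, p i := by rw [h.2]; trivial
  classical
  -- Asking for every larger index set t makes the claim stable under addition, via unions.
  have key : ∃ s : Finset ι, ∀ t : Finset ι, s ⊆ t → w = ∑ i ∈ t, h.proj i w := by
    refine Submodule.iSup_induction p (motive := fun w => ∃ s : Finset ι, ∀ t : Finset ι, s ⊆ t →
      w = ∑ i ∈ t, h.proj i w) hw (fun i w hw => ⟨{i}, fun t ht => ?_⟩)
      ⟨∅, fun t _ => by simp⟩ fun x y ⟨s, hs⟩ ⟨s', hs'⟩ => ⟨s ∪ s', fun t ht => ?_⟩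
    · rw [Finset.sum_eq_single_of_mem i (ht (Finset.mem_singleton_self i)), h.proj_of_mem hw]
      intro j _ hj
      exact h.proj_of_mem_ne (Ne.symm hj) hw
    · simp only [map_add, Finset.sum_add_distrib]
      rw [← hs t (Finset.union_subset_left ht), ← hs' t (Finset.union_subset_right ht)]
  obtain ⟨s, hs⟩ := key
  exact ⟨s, hs s (Finset.Subset.refl s)⟩

theorem IsDirectSum.eq_zero_of_proj (h : IsDirectSum p) {w : W} (hw : ∀ i, h.proj i w = 0) :
    w = 0 := by
  obtain ⟨s, hs⟩ := h.exists_sum_proj w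
  rw [hs]
  exact Finset.sum_eq_zero fun i _ => hw i

end Projection

/-! ### Generalities on generalized eigenspaces -/

section Eigen

variable {W : Type*} [AddCommGroup W] [Module ℂ W]

theorem coe_restrict_sub_pow {T : Module.End ℂ W} {p : Submodule ℂ W} (hT : ∀ w ∈ p, T w ∈ p)
    (n : ℂ) (k : ℕ) (x : p) :
    ((((T.restrict hT : Module.End ℂ p) - n • 1) ^ k) x : W) = ((T - n • 1) ^ k) (x : W) := by
  induction k with
  | zero => simp
  | succ k ih =>
    rw [pow_succ', pow_succ', Module.End.mul_apply, Module.End.mul_apply, ← ih]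
    simp [LinearMap.restrict_apply]

theorem mem_maxGenEigenspace_restrict {T : Module.End ℂ W} {p : Submodule ℂ W}
    (hT : ∀ w ∈ p, T w ∈ p) (n : ℂ) (x : p) :
    x ∈ Module.End.maxGenEigenspace (T.restrict hT : Module.End ℂ p) n
      ↔ (x : W) ∈ Module.End.maxGenEigenspace T n := by
  rw [Module.End.mem_maxGenEigenspace, Module.End.mem_maxGenEigenspace]
  refine exists_congr fun k => ?_
  rw [← coe_restrict_sub_pow hT, Submodule.coe_eq_zero]

/-- The transpose of a locally nilpotent operator need not be locally nilpotent; a uniform exponent,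
read off from finitely many generators, is what passes to functionals. -/
theorem exists_pow_eq_zero_of_finiteDimensional {N : Module.End ℂ W} {p : Submodule ℂ W}
    [FiniteDimensional ℂ p] (h : ∀ w ∈ p, ∃ k : ℕ, (N ^ k) w = 0) :
    ∃ k : ℕ, ∀ w ∈ p, (N ^ k) w = 0 := by
  obtain ⟨S, hS⟩ := (Module.Finite.iff_fg.1 ‹_› : p.FG)
  have hSp : ∀ s ∈ S, s ∈ p := fun s hs => hS ▸ Submodule.subset_span hs
  choose f hf using fun s : S => h s (hSp s s.2)
  refine ⟨S.attach.sup f, fun w hw => ?_⟩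
  rw [← hS] at hw
  have hle : Submodule.span ℂ (S : Set W) ≤ LinearMap.ker (N ^ (S.attach.sup f)) := by
    rw [Submodule.span_le]
    intro s hs
    have h1 : f ⟨s, hs⟩ ≤ S.attach.sup f := Finset.le_sup (Finset.mem_attach _ _)
    change (N ^ (S.attach.sup f)) s = 0
    rw [← Nat.sub_add_cancel h1, pow_add, Module.End.mul_apply, hf ⟨s, hs⟩, map_zero]
  exact hle hw

theorem mem_maxGenEigenspace_of_sub_mem {T : Module.End ℂ W} {n : ℂ} {w : W}
    (h : T w - n • w ∈ Module.End.maxGenEigenspace T n) :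
    w ∈ Module.End.maxGenEigenspace T n := by
  rw [Module.End.mem_maxGenEigenspace] at h ⊢
  obtain ⟨k, hk⟩ := h
  refine ⟨k + 1, ?_⟩
  rw [pow_succ, Module.End.mul_apply]
  simpa using hk

theorem dualMap_sub_pow_apply (T : Module.End ℂ W) (n : ℂ) (k : ℕ) (f : Module.Dual ℂ W) (w : W) :
    (((T.dualMap : Module.End ℂ (Module.Dual ℂ W)) - n • 1) ^ k) f w = f (((T - n • 1) ^ k) w) := by
  induction k generalizing w with
  | zero => simp
  | succ k ih =>
    rw [pow_succ', Module.End.mul_apply, pow_succ, Module.End.mul_apply, ← ih]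
    simp

/-- A generalized eigenvector of the transpose vanishes on the other generalized eigenspaces. -/
theorem apply_eq_zero_of_mem_maxGenEigenspace {T : Module.End ℂ W} {n m : ℂ} (hnm : m ≠ n)
    {f : Module.Dual ℂ W}
    (hf : f ∈ Module.End.maxGenEigenspace (T.dualMap : Module.End ℂ (Module.Dual ℂ W)) n) {w : W}
    (hw : w ∈ Module.End.maxGenEigenspace T m) : f w = 0 := by
  rw [Module.End.mem_maxGenEigenspace] at hf hw
  obtain ⟨k, hk⟩ := hf
  obtain ⟨l, hl⟩ := hw
  -- Bézout writes w as a(T)(T-n)^k w + b(T)(T-m)^l w. The second term is zero, and f kills the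
  -- first because f ∘ (T-n)^k = 0.
  have hcop : IsCoprime ((Polynomial.X - Polynomial.C n) ^ k : Polynomial ℂ)
      ((Polynomial.X - Polynomial.C m) ^ l) :=
    (Polynomial.isCoprime_X_sub_C_of_isUnit_sub
      (sub_ne_zero.2 (Ne.symm hnm)).isUnit).pow
  obtain ⟨a, b, hab⟩ := hcop
  have e : ∀ (z : ℂ) (j : ℕ), Polynomial.aeval T ((Polynomial.X - Polynomial.C z) ^ j)
      = (T - z • 1) ^ j := by
    intro z j
    rw [map_pow, map_sub, Polynomial.aeval_X, Polynomial.aeval_C, Algebra.algebraMap_eq_smul_one]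
  have h1 := congrArg (fun q => f (Polynomial.aeval T q w)) hab
  simp only [map_add, map_mul, e, map_one, LinearMap.add_apply, Module.End.mul_apply, hl, map_zero,
    add_zero, Module.End.one_apply] at h1
  rw [← h1, ← Module.End.mul_apply, ← e n k, ← map_mul, mul_comm, map_mul, e n k,
    Module.End.mul_apply, ← dualMap_sub_pow_apply, hk, LinearMap.zero_apply]

end Eigen

/-! ### The derivative property of opposite operators -/

section OppDerivative

variable {R W₁ W₂ W₃ : Type*} [CommRing R] [AddCommGroup W₁] [Module ℂ W₁]
  [AddCommGroup W₂] [Module ℂ W₂] [AddCommGroup W₃] [Module ℂ W₃]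

/-- The operator `t d/dt` on `W[t]`. -/
noncomputable def eulerPoly : (ℕ →₀ W₁) →ₗ[ℂ] (ℕ →₀ W₁) :=
  Finsupp.lsum ℂ fun s : ℕ => (s : ℂ) • Finsupp.lsingle s

theorem eulerPoly_single (s : ℕ) (w : W₁) :
    eulerPoly (Finsupp.single s w) = Finsupp.single s ((s : ℂ) • w) := by
  simp [eulerPoly]

theorem eulerPoly_apply (g : ℕ →₀ W₁) (s : ℕ) : eulerPoly g s = (s : ℂ) • g s := by
  induction g using Finsupp.induction_linear with
  | zero => simp
  | add f g hf hg => rw [map_add, Finsupp.add_apply, Finsupp.add_apply, hf, hg, smul_add]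
  | single t w =>
    rw [eulerPoly_single]
    by_cases h : t = s
    · subst h; simp
    · simp [Finsupp.single_eq_of_ne' h]

/-- Both sides are t·d/dt of e^{tN}w. -/
theorem mulVar_coeffwise_expPoly {N : Module.End ℂ W₁} (hN : ∀ w, ∃ m : ℕ, (N ^ m) w = 0) (w : W₁) :
    mulVar (coeffwise N (expPoly N hN w)) = eulerPoly (expPoly N hN w) := by
  ext s
  rw [eulerPoly_apply]
  cases s with
  | zero => rw [mulVar_zero]; simp
  | succ s =>
    rw [mulVar_succ]
    simp only [Finsupp.mapRange.linearMap_apply, Finsupp.mapRange_apply, expSeries_apply,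
      apply_divPow]
    push_cast
    rfl

variable {L₁ : SignType → Module.End ℂ W₁} {I J : W₁ →ₗ[ℂ] R → W₂ →ₗ[ℂ] W₃}
  {hN : ∀ w, ∃ m : ℕ, ((L₁ 1) ^ m) w = 0}

/-- The derivative property of `I(e^{xL(1)} w, x⁻¹)`; here `J` accounts for the derivative of
powers of logarithms. -/
theorem oppComponent_derivative (χ : R →+* ℂ) (hL : Sl2Relations L₁)
    (hI : ∀ w n, I (L₁ (-1) w) n = (-χ n) • I w (n - 1) + J w (n - 1)) (w : W₁) (n : R) :
    oppComponent (L₁ 1) hN I (L₁ (-1) w) (n - 2)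
      = (2 : ℂ) • oppComponent (L₁ 1) hN I (L₁ 0 w) (n - 1)
        + χ n • oppComponent (L₁ 1) hN I w (n - 1) + oppComponent (L₁ 1) hN J w (n - 1) := by
  -- At the power tˢ the index of I is -n - s, so the derivative property contributes χ n plus s,
  -- and the latter is the Euler operator t·d/dt. The Euler term then cancels the t²L(1) term in the
  -- conjugation formula for L(-1).
  have key : ∀ g : ℕ →₀ W₁, seriesComponent I (n - 2) (coeffwise (L₁ (-1)) g)
      = χ n • seriesComponent I (n - 1) g + seriesComponent I (n - 1) (eulerPoly g)
        + seriesComponent J (n - 1) g := by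
    intro g
    induction g using Finsupp.induction_linear with
    | zero => simp
    | add f g hf hg => simp only [map_add, hf, hg, smul_add]; abel
    | single s w =>
      rw [eulerPoly_single]
      simp only [Finsupp.mapRange.linearMap_apply, Finsupp.mapRange_single, seriesComponent_single]
      rw [hI, map_smul, show -(n - 2) - 2 - (s : R) - 1 = -(n - 1) - 2 - s by ring]
      simp only [map_sub, map_neg, map_natCast, map_ofNat, Pi.smul_apply]
      module
  have h1 := key (expPoly (L₁ 1) hN w)
  rw [coeffwise_L_neg_one_expPoly hL, map_add, map_sub, map_smul, seriesComponent_mulVar,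
    seriesComponent_mulVar, mulVar_coeffwise_expPoly] at h1
  simp only [oppComponent_apply]
  rw [show n - 2 + 1 = n - 1 by ring] at h1
  have h2 := eq_sub_iff_add_eq.2 h1
  rw [sub_eq_iff_eq_add] at h2
  rw [h2]
  abel

end OppDerivative

/-! ### Jacobi identities tested on vectors -/

section JacobiTest

variable {R W₁ W₂ W₃ X : Type*} [Ring R] [AddCommGroup W₁] [Module ℂ W₁]
  [AddCommGroup W₂] [Module ℂ W₂] [AddCommGroup W₃] [Module ℂ W₃]

/-- Testing on vectors gives a threshold depending on x; since F is eventually constant, each x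
tests the same functional F N₀. -/
theorem eventually_eq_zero_of_apply [AddCommGroup X] [Module ℂ X] {p : Submodule ℂ (Module.Dual ℂ X)}
    {F : ℕ → p} {N₀ : ℕ} (hF : ∀ N, N₀ ≤ N → F N = F N₀)
    (h : ∀ x, ∀ᶠ N in Filter.atTop, (F N : Module.Dual ℂ X) x = 0) :
    ∀ᶠ N in Filter.atTop, F N = 0 := by
  have h0 : F N₀ = 0 := by
    ext x
    obtain ⟨N, hN, hge⟩ := ((h x).and (Filter.eventually_ge_atTop N₀)).exists
    rw [← hF N hge, hN]; rfl
  filter_upwards [Filter.eventually_ge_atTop N₀] with N hN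
  rw [hF N hN, h0]

theorem sum_range_eq_of_le {W : Type*} [AddCommGroup W] {f : ℕ → W} {K N₀ N : ℕ}
    (hf : ∀ i, K ≤ i → f i = 0) (hK : K ≤ N₀) (hN : N₀ ≤ N) :
    ∑ i ∈ Finset.range N, f i = ∑ i ∈ Finset.range N₀, f i := by
  symm
  refine Finset.sum_subset (Finset.range_subset_range.2 hN) fun i _ hi => hf i ?_
  rw [Finset.mem_range] at hi
  omega

/-- A Jacobi identity with values in a space of functionals may be tested on vectors. -/
theorem JacobiIdentity.of_apply [AddCommGroup X] [Module ℂ X] {p : Submodule ℂ (Module.Dual ℂ X)}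
    {a₁ : ℤ → Module.End ℂ W₁} {a₂ : ℤ → Module.End ℂ W₂} {a₃ : ℤ → Module.End ℂ p}
    {I : W₁ →ₗ[ℂ] R → W₂ →ₗ[ℂ] p}
    (h₁ : ∀ w, ∃ N : ℤ, ∀ n ≥ N, a₁ n w = 0) (h₂ : ∀ w, ∃ N : ℤ, ∀ n ≥ N, a₂ n w = 0)
    (h₃ : ∀ w n w₂, ∃ N : ℕ, ∀ m : ℕ, N ≤ m → I w (n + m) w₂ = 0)
    (h : ∀ (l m : ℤ) (n : R) (w₁ : W₁) (w₂ : W₂) (x : X), ∀ᶠ N : ℕ in Filter.atTop,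
      (∑ i ∈ Finset.range N, ((-1 : ℂ) ^ i * binom l i) •
        (a₃ (m + l - i) (I w₁ (n + i) w₂) : Module.Dual ℂ X) x)
      - ((-1 : ℂ) ^ l) • (∑ i ∈ Finset.range N, ((-1 : ℂ) ^ i * binom l i) •
        (I w₁ (n + l - i) (a₂ (m + i) w₂) : Module.Dual ℂ X) x)
      = ∑ i ∈ Finset.range N, binom m i • (I (a₁ (l + i) w₁) (m + n - i) w₂ : Module.Dual ℂ X) x) :
    JacobiIdentity a₁ a₂ a₃ fun w (n : R) w₂ => I w n w₂ := by
  intro l m n w₁ w₂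
  obtain ⟨K₁, hK₁⟩ := h₁ w₁
  obtain ⟨K₂, hK₂⟩ := h₂ w₂
  obtain ⟨K₃, hK₃⟩ := h₃ w₁ n w₂
  -- Beyond N₀ all three partial sums are constant by lower truncation.
  set N₀ := (K₁ - l).toNat + (K₂ - m).toNat + K₃ with hN₀
  set F : ℕ → p := fun N =>
    (∑ i ∈ Finset.range N, ((-1 : ℂ) ^ i * binom l i) • a₃ (m + l - i) (I w₁ (n + i) w₂))
      - ((-1 : ℂ) ^ l) • (∑ i ∈ Finset.range N, ((-1 : ℂ) ^ i * binom l i) •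
        I w₁ (n + l - i) (a₂ (m + i) w₂))
      - ∑ i ∈ Finset.range N, binom m i • I (a₁ (l + i) w₁) (m + n - i) w₂ with hF
  have hc : ∀ N, N₀ ≤ N → F N = F N₀ := by
    intro N hN
    rw [hF]
    simp only
    rw [sum_range_eq_of_le (K := K₃) (fun i hi => by rw [hK₃ i hi, map_zero, smul_zero])
        (by omega) hN,
      sum_range_eq_of_le (K := (K₂ - m).toNat) (fun i hi => by
        rw [hK₂ (m + i) (by omega), map_zero, smul_zero]) (by omega) hN,
      sum_range_eq_of_le (K := (K₁ - l).toNat) (fun i hi => by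
        rw [hK₁ (l + i) (by omega), map_zero, Pi.zero_apply, LinearMap.zero_apply, smul_zero])
        (by omega) hN]
  have := eventually_eq_zero_of_apply hc fun x => by
    filter_upwards [h l m n w₁ w₂ x] with N hN
    rw [hF]
    simp only [AddSubgroupClass.coe_sub, Submodule.coe_smul, AddSubmonoidClass.coe_finsetSum,
      LinearMap.sub_apply, LinearMap.smul_apply, LinearMap.sum_apply]
    rw [hN, sub_self]
  filter_upwards [this] with N hN
  exact sub_eq_zero.1 hN

theorem JacobiIdentity.add {a₁ b₁ : ℤ → Module.End ℂ W₁} {a₂ b₂ : ℤ → Module.End ℂ W₂}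
    {a₃ b₃ : ℤ → Module.End ℂ W₃} {I : W₁ →ₗ[ℂ] R → W₂ →ₗ[ℂ] W₃}
    (ha : JacobiIdentity a₁ a₂ a₃ fun w (n : R) w₂ => I w n w₂)
    (hb : JacobiIdentity b₁ b₂ b₃ fun w (n : R) w₂ => I w n w₂) :
    JacobiIdentity (a₁ + b₁) (a₂ + b₂) (a₃ + b₃) fun w (n : R) w₂ => I w n w₂ := by
  intro l m n w₁ w₂
  filter_upwards [ha l m n w₁ w₂, hb l m n w₁ w₂] with N h1 h2
  simp only [Pi.add_apply, LinearMap.add_apply, map_add, smul_add, Finset.sum_add_distrib]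
  rw [← h1, ← h2]
  abel

theorem JacobiIdentity.zero {I : W₁ →ₗ[ℂ] R → W₂ →ₗ[ℂ] W₃} :
    JacobiIdentity 0 0 0 fun w (n : R) w₂ => I w n w₂ := by
  intro l m n w₁ w₂
  exact Filter.Eventually.of_forall fun N => by simp

end JacobiTest

/-! ### The contragredient module -/

section Contragredient

variable {B V W : Type*} [AddCommGroup B] {A : AddSubgroup B} [AddCommGroup V] [Module ℂ V]
  [AddCommGroup W] [Module ℂ W] {κ : Kind V} {D : VertexData A V} {M : ModData B V W}

theorem IsStronglyGradedVertexAlgebra.induction (hD : IsStronglyGradedVertexAlgebra κ D)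
    {P : V → Prop} (h0 : P 0) (hadd : ∀ x y, P x → P y → P (x + y))
    (h : ∀ α k, ∀ v ∈ D.wt k ⊓ D.gr α, P v) (v : V) : P v :=
  iSup_iSup_induction hD.gr_directSum.2 hD.gr_compatible h0 hadd h v

theorem IsStronglyGradedModule.induction (hM : IsStronglyGradedModule κ D M)
    {P : W → Prop} (h0 : P 0) (hadd : ∀ x y, P x → P y → P (x + y))
    (h : ∀ β n, ∀ w ∈ M.wt n ⊓ M.gr β, P w) (w : W) : P w :=
  iSup_iSup_induction hM.gr_directSum.2 hM.gr_compatible h0 hadd h w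

theorem IsStronglyGradedModule.hom_ext (hM : IsStronglyGradedModule κ D M) {U : Type*}
    [AddCommGroup U] [Module ℂ U] {S T : W →ₗ[ℂ] U}
    (h : ∀ β n, ∀ w ∈ M.wt n ⊓ M.gr β, S w = T w) : S = T := by
  ext w
  exact hM.induction (P := fun w => S w = T w) (by simp)
    (fun x y hx hy => by rw [map_add, map_add, hx, hy]) h w

theorem ModData.dualWt_hom_ext (hM : IsStronglyGradedModule κ D M) {β : B} {n : ℂ}
    {f g : Module.Dual ℂ W} (hf : f ∈ M.dualWt β n) (hg : g ∈ M.dualWt β n)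
    (h : ∀ w ∈ M.wt n ⊓ M.gr β, f w = g w) : f = g := by
  refine hM.hom_ext fun γ m w hw => ?_
  by_cases hne : (γ, m) = (β, n)
  · rw [Prod.mk.injEq] at hne
    rw [hne.1, hne.2] at hw
    exact h w hw
  · rw [hf γ m hne w hw, hg γ m hne w hw]

theorem ModData.apply_eq_zero_of_mem_gr (hM : IsStronglyGradedModule κ D M) {β γ : B} {n : ℂ}
    {f : Module.Dual ℂ W} (hf : f ∈ M.dualWt β n) (hne : γ ≠ β) {w : W} (hw : w ∈ M.gr γ) :
    f w = 0 := by
  have : f ∘ₗ hM.gr_directSum.proj γ = 0 := by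
    refine hM.hom_ext fun δ m x hx => ?_
    rw [LinearMap.comp_apply, LinearMap.zero_apply]
    by_cases h : δ = γ
    · subst h
      rw [hM.gr_directSum.proj_of_mem hx.2]
      exact hf _ _ (fun h' => hne (Prod.mk.inj h').1) x hx
    · rw [hM.gr_directSum.proj_of_mem_ne h hx.2, map_zero]
  rw [← hM.gr_directSum.proj_of_mem hw, ← LinearMap.comp_apply, this, LinearMap.zero_apply]

theorem ModData.comp_proj_mem_dualWt (hM : IsStronglyGradedModule κ D M) (β : B) (n : ℂ)
    (g : Module.Dual ℂ W) :
    g ∘ₗ hM.wt_directSum.proj n ∘ₗ hM.gr_directSum.proj β ∈ M.dualWt β n := by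
  intro γ m hne w hw
  simp only [LinearMap.comp_apply]
  by_cases h : γ = β
  · subst h
    rw [hM.gr_directSum.proj_of_mem hw.2,
      hM.wt_directSum.proj_of_mem_ne (fun h' => hne (by rw [h'])) hw.1, map_zero]
  · rw [hM.gr_directSum.proj_of_mem_ne h hw.2, map_zero, map_zero]

theorem ModData.dualSpace_ind {P : M.dualSpace → Prop} (h0 : P 0)
    (hadd : ∀ f g, P f → P g → P (f + g))
    (h : ∀ (β : B) (n : ℂ) (f : Module.Dual ℂ W) (hf : f ∈ M.dualWt β n),
      P ⟨f, ModData.mem_dualSpace hf⟩) (f : M.dualSpace) : P f := by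
  have key : ∀ f ∈ M.dualSpace, ∃ hf : f ∈ M.dualSpace, P ⟨f, hf⟩ := by
    intro f hf
    refine Submodule.iSup_induction _ (motive := fun f => ∃ hf : f ∈ M.dualSpace, P ⟨f, hf⟩) hf
      (fun β f hf => ?_) ⟨Submodule.zero_mem _, h0⟩
      (fun x y ⟨hx, hx'⟩ ⟨hy, hy'⟩ => ⟨Submodule.add_mem _ hx hy, hadd _ _ hx' hy'⟩)
    exact Submodule.iSup_induction _ (motive := fun f => ∃ hf : f ∈ M.dualSpace, P ⟨f, hf⟩) hf
      (fun n f hf => ⟨ModData.mem_dualSpace hf, h β n f hf⟩) ⟨Submodule.zero_mem _, h0⟩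
      (fun x y ⟨hx, hx'⟩ ⟨hy, hy'⟩ => ⟨Submodule.add_mem _ hx hy, hadd _ _ hx' hy'⟩)
  obtain ⟨_, h'⟩ := key f f.2
  exact h'

theorem ModData.dualWt_eq_bot (hM : IsStronglyGradedModule κ D M) {β : B} {n : ℂ}
    (h : M.wt n ⊓ M.gr β = ⊥) : M.dualWt β n = ⊥ := by
  rw [eq_bot_iff]
  intro f hf
  rw [Submodule.mem_bot]
  refine ModData.dualWt_hom_ext hM hf (Submodule.zero_mem _) fun w hw => ?_
  rw [h, Submodule.mem_bot] at hw
  rw [hw, map_zero, map_zero]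

/-- A functional vanishing outside degree β equals its composite with the projection to W^{(β)}, and
that composition fixes each (W_{[n]}^{(β)})^* and kills those of other degrees. Degrees in W' can
thus be tested without weights. -/
theorem ModData.iSup_dualWt_iff (hM : IsStronglyGradedModule κ D M) {β : B}
    {f : Module.Dual ℂ W} (hf : f ∈ M.dualSpace) :
    f ∈ ⨆ n, M.dualWt β n ↔ ∀ γ ≠ β, ∀ w ∈ M.gr γ, f w = 0 := by
  constructor
  · intro hf γ hγ w hw
    refine Submodule.iSup_induction _ (motive := fun f => f w = 0) hf (fun n f hf => ?_) rfl
      (fun x y hx hy => by rw [LinearMap.add_apply, hx, hy, add_zero])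
    exact ModData.apply_eq_zero_of_mem_gr hM hf hγ hw
  · intro h
    have e : f = (hM.gr_directSum.proj β).dualMap f := by
      refine hM.hom_ext fun γ n w hw => ?_
      rw [LinearMap.dualMap_apply]
      by_cases hγ : γ = β
      · subst hγ
        rw [hM.gr_directSum.proj_of_mem hw.2]
      · rw [hM.gr_directSum.proj_of_mem_ne hγ hw.2, map_zero, h γ hγ w hw.2]
    rw [e]
    refine ModData.dualSpace_induction hf fun γ n f hf => ?_
    by_cases hγ : γ = β
    · subst hγ
      refine Submodule.mem_iSup_of_mem n ?_
      intro δ m hne w hw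
      rw [LinearMap.dualMap_apply]
      by_cases hδ : δ = γ
      · subst hδ
        rw [hM.gr_directSum.proj_of_mem hw.2]
        exact hf _ _ hne _ hw
      · rw [hM.gr_directSum.proj_of_mem_ne hδ hw.2, map_zero]
    · have : (hM.gr_directSum.proj β).dualMap f = 0 := by
        ext w
        rw [LinearMap.dualMap_apply]
        exact ModData.apply_eq_zero_of_mem_gr hM hf (Ne.symm hγ) (hM.gr_directSum.proj_mem β w)
      rw [this]
      exact Submodule.zero_mem _

/-- Finite-dimensionality of W_{[n]}^{(β)} gives one power of L(0) - n that kills all of it, hence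
kills its functionals after transposition. -/
theorem ModData.dualWt_le_maxGenEigenspace (hM : IsStronglyGradedModule κ D M) (β : B) (n : ℂ) :
    M.dualWt β n ≤ Module.End.maxGenEigenspace
      ((M.L 0).dualMap : Module.End ℂ (Module.Dual ℂ W)) n := by
  intro f hf
  have := hM.finiteDimensional β n
  obtain ⟨k, hk⟩ := exists_pow_eq_zero_of_finiteDimensional (N := M.L 0 - n • 1)
    (p := M.wt n ⊓ M.gr β) fun w hw => (Module.End.mem_maxGenEigenspace _ _ _).1 hw.1
  rw [Module.End.mem_maxGenEigenspace]
  refine ⟨k, ?_⟩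
  have hL : ∀ (j : ℕ) (m : ℂ) (γ : B), ∀ w ∈ M.wt m ⊓ M.gr γ,
      ((M.L 0 - n • 1) ^ j) w ∈ M.wt m ⊓ M.gr γ := by
    intro j m γ w hw
    induction j with
    | zero => simpa using hw
    | succ j ih =>
      rw [pow_succ', Module.End.mul_apply, LinearMap.sub_apply]
      refine Submodule.sub_mem _ ⟨?_, hM.L_mem 0 γ _ ih.2⟩ (Submodule.smul_mem _ _ ih)
      have := ModData.L_mem_wt hM.sl2 0 ih.1
      simpa using this
  refine hM.hom_ext fun γ m w hw => ?_
  rw [dualMap_sub_pow_apply, LinearMap.zero_apply]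
  by_cases hne : (γ, m) = (β, n)
  · rw [Prod.mk.injEq] at hne
    rw [hne.1, hne.2] at hw
    rw [hk w hw, map_zero]
  · exact hf _ _ hne _ (hL k m γ w hw)

variable (hD : IsStronglyGradedVertexAlgebra κ D) (hM : IsStronglyGradedModule κ D M)

theorem contragredient_Y_apply (v : V) (n : ℤ) (f : M.dualSpace) (w : W) :
    ((contragredient hD hM).Y v n f : Module.Dual ℂ W) w
      = (f : Module.Dual ℂ W) (oppositeY hD M v n w) := rfl

theorem contragredient_L_apply (j : SignType) (f : M.dualSpace) (w : W) :
    ((contragredient hD hM).L j f : Module.Dual ℂ W) w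
      = (f : Module.Dual ℂ W) (M.L (-j) w) := rfl

theorem contragredient_L_one_apply (f : M.dualSpace) (w : W) :
    ((contragredient hD hM).L 1 f : Module.Dual ℂ W) w
      = (f : Module.Dual ℂ W) (M.L (-1) w) := rfl

theorem contragredient_L_zero_apply (f : M.dualSpace) (w : W) :
    ((contragredient hD hM).L 0 f : Module.Dual ℂ W) w
      = (f : Module.Dual ℂ W) (M.L 0 w) := rfl

theorem contragredient_L_neg_one_apply (f : M.dualSpace) (w : W) :
    ((contragredient hD hM).L (-1) f : Module.Dual ℂ W) w
      = (f : Module.Dual ℂ W) (M.L 1 w) := rfl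

theorem mem_contragredient_gr {β : B} {f : M.dualSpace} :
    f ∈ (contragredient hD hM).gr β
      ↔ ∀ γ ≠ -β, ∀ w ∈ M.gr γ, (f : Module.Dual ℂ W) w = 0 :=
  ModData.iSup_dualWt_iff hM f.2

theorem mem_contragredient_wt_iff {n : ℂ} {f : M.dualSpace} :
    f ∈ (contragredient hD hM).wt n ↔ (f : Module.Dual ℂ W) ∈
      Module.End.maxGenEigenspace ((M.L 0).dualMap : Module.End ℂ (Module.Dual ℂ W)) n :=
  mem_maxGenEigenspace_restrict (dual_L_mem hM 0) n f

/-- The weight spaces of W' are generalized eigenspaces of L'(0), not dual spaces by definition.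
Distinct generalized eigenvalues pair to zero in one direction; finite-dimensionality gives the
other. -/
theorem mem_contragredient_wt_inf_gr {n : ℂ} {β : B} {f : M.dualSpace} :
    f ∈ (contragredient hD hM).wt n ⊓ (contragredient hD hM).gr β
      ↔ (f : Module.Dual ℂ W) ∈ M.dualWt (-β) n := by
  constructor
  · rintro ⟨h1, h2⟩ γ m hne w hw
    by_cases hγ : γ = -β
    · refine apply_eq_zero_of_mem_maxGenEigenspace (fun h => hne (by rw [hγ, h]))
        ((mem_contragredient_wt_iff hD hM).1 h1) hw.1
    · exact (mem_contragredient_gr hD hM).1 h2 γ hγ w hw.2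
  · intro h
    refine ⟨(mem_contragredient_wt_iff hD hM).2 (ModData.dualWt_le_maxGenEigenspace hM _ _ h), ?_⟩
    exact Submodule.mem_iSup_of_mem n h

theorem dualMap_oppositeY_mem_dualWt (hM : IsStronglyGradedModule κ D M) {α : A}
    {k n : ℤ} {v : V} (hv : v ∈ D.wt k ⊓ D.gr α) {β : B} {m : ℂ} {f : Module.Dual ℂ W} (hf : f ∈ M.dualWt β m) :
    (oppositeY hD M v n).dualMap f ∈ M.dualWt (β - α) (m - n - 1 + k) := by
  intro γ m' h w hw
  refine hf _ _ (fun h' => h ?_) _ (oppositeY_mem hD hM hv hw)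
  simp only [Prod.mk.injEq] at h' ⊢
  exact ⟨by rw [← h'.1]; abel, by rw [← h'.2]; ring⟩

theorem coe_neg_one_signType : (((-1 : SignType) : ℤ) : ℂ) = -1 := by simp

theorem VertexData.L_neg_one_mem_wt (h : Sl2Relations D.L) {k : ℤ} {v : V} (hv : v ∈ D.wt k) :
    D.L (-1) v ∈ D.wt (k + 1) := by
  have h1 := sl2_comm_zero h (-1) v
  rw [VertexData.L_zero_of_mem_wt hv, map_smul] at h1
  rw [VertexData.wt, Module.End.mem_eigenspace_iff, h1, coe_neg_one_signType]
  push_cast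
  module

/-- Since 𝟏₋₁ is the identity, the bracket of L(1) with it is zero; applied to 𝟏, the bracket
formula leaves only (L(1)𝟏)₋₁𝟏 = L(1)𝟏. Thus e^{xL(1)} fixes the vacuum. -/
theorem IsStronglyGradedVertexAlgebra.L_one_one (hD : IsStronglyGradedVertexAlgebra κ D) :
    D.L 1 D.one = 0 := by
  have h := hD.toIsVertexAction.bracket_one hD.toIsVertexAction D.one (-1) D.one
  have h0 : D.L 0 D.one = 0 := by
    rw [VertexData.L_zero_of_mem_wt hD.one_mem]; simp
  rw [h0, hD.toIsVertexAction.derivative, hD.vacuum, (hD.creation (D.L 1 D.one)).1, hD.vacuum] at h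
  simpa using h.symm

theorem oppositeY_one (hM : IsStronglyGradedModule κ D M) (n : ℤ) :
    oppositeY hD M D.one n = if n = -1 then 1 else 0 := by
  rw [oppositeY_of_mem_wt hD M hD.one_mem,
    oppComponent_eq_sum (m := 1) _ (by simpa using hD.L_one_one)]
  simp only [Finset.range_one, Finset.sum_singleton, zpow_zero, one_smul, divPow_zero_apply,
    hM.vacuum]
  congr 1
  rw [eq_iff_iff]
  push_cast
  constructor <;> intro h <;> omega

/-- L(-1)v has weight k + 1, which changes the sign and moves the shift from 2k to 2k + 2. This and
its two companions refer everything to the weight k of v, so that the terms of one bracket relation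
can be compared. -/
theorem oppositeY_L_neg_one {k : ℤ} {v : V} (hv : v ∈ D.wt k) (n : ℤ) :
    oppositeY hD M (D.L (-1) v) n
      = (-(-1 : ℂ) ^ k) • oppComponent (D.L 1) hD.L_one_nilpotent M.Y (D.L (-1) v)
        (n - 2 * k - 2) := by
  rw [oppositeY_of_mem_wt hD M (VertexData.L_neg_one_mem_wt hD.sl2 hv),
    zpow_add₀ (by norm_num), zpow_one, mul_neg_one,
    show n - 2 * (k + 1) = n - 2 * k - 2 by ring]

theorem oppositeY_L_one {k : ℤ} {v : V} (hv : v ∈ D.wt k) (n : ℤ) :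
    oppositeY hD M (D.L 1 v) n
      = (-(-1 : ℂ) ^ k) • oppComponent (D.L 1) hD.L_one_nilpotent M.Y (D.L 1 v)
        (n - 2 * k + 2) := by
  rw [oppositeY_of_mem_wt hD M (VertexData.L_one_mem_wt hD.sl2 hv),
    zpow_sub₀ (by norm_num), zpow_one, div_neg, div_one,
    show n - 2 * (k - 1) = n - 2 * k + 2 by ring]

theorem oppositeY_L_zero {k : ℤ} {v : V} (hv : v ∈ D.wt k) (n : ℤ) :
    oppositeY hD M (D.L 0 v) n
      = ((-1 : ℂ) ^ k) • oppComponent (D.L 1) hD.L_one_nilpotent M.Y (D.L 0 v) (n - 2 * k) := by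
  rw [VertexData.L_zero_of_mem_wt hv, map_smul, map_smul, Pi.smul_apply, Pi.smul_apply,
    oppositeY_of_mem_wt hD M hv, smul_comm]

theorem oppositeY_derivative (hM : IsStronglyGradedModule κ D M) (v : V) (n : ℤ) :
    oppositeY hD M (D.L (-1) v) n = (-(n : ℂ)) • oppositeY hD M v (n - 1) := by
  refine hD.induction (P := fun v => oppositeY hD M (D.L (-1) v) n
    = (-(n : ℂ)) • oppositeY hD M v (n - 1)) (by simp) (fun x y hx hy => ?_)
    (fun α k v hv => ?_) v
  · simp only [map_add, Pi.add_apply, hx, hy, smul_add]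
  · have h := oppComponent_derivative (hN := hD.L_one_nilpotent) (I := M.Y) (J := 0)
      (Int.castRingHom ℂ) hD.sl2 (fun v n => by simp [hM.derivative]) v (n - 2 * k)
    rw [oppositeY_L_neg_one hD hv.1, h, oppositeY_of_mem_wt hD M hv.1,
      VertexData.L_zero_of_mem_wt hv.1, show n - 1 - 2 * k = n - 2 * k - 1 by ring]
    have h0 : oppComponent (D.L 1) hD.L_one_nilpotent (0 : V →ₗ[ℂ] ℤ → W →ₗ[ℂ] W) v
        (n - 2 * k - 1) = 0 := by
      obtain ⟨m, hm⟩ := hD.L_one_nilpotent v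
      rw [oppComponent_eq_sum _ hm]
      simp
    rw [h0, map_smul]
    simp only [Pi.smul_apply, eq_intCast]
    push_cast
    module

/-- Raising n lowers the weight of v_n f by integers at fixed degree, and there the weights are
bounded below. -/
theorem contragredient_truncation (v : V) (f : M.dualSpace) :
    ∃ N : ℤ, ∀ n ≥ N, (contragredient hD hM).Y v n f = 0 := by
  refine ModData.dualSpace_ind (P := fun f => ∃ N : ℤ, ∀ n ≥ N, (contragredient hD hM).Y v n f = 0)
    ⟨0, by simp⟩ ?_ (fun β m f hf => ?_) f
  · rintro f g ⟨N, hN⟩ ⟨N', hN'⟩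
    exact ⟨max N N', fun n hn => by
      rw [map_add, hN n (le_of_max_le_left hn), hN' n (le_of_max_le_right hn), add_zero]⟩
  · refine hD.induction (P := fun v => ∃ N : ℤ, ∀ n ≥ N, (contragredient hD hM).Y v n ⟨f, _⟩ = 0)
      ⟨0, by simp⟩ ?_ (fun α k v hv => ?_) v
    · rintro x y ⟨N, hN⟩ ⟨N', hN'⟩
      exact ⟨max N N', fun n hn => by
        rw [map_add, Pi.add_apply, LinearMap.add_apply, hN n (le_of_max_le_left hn),
          hN' n (le_of_max_le_right hn), add_zero]⟩
    · obtain ⟨N, hN⟩ := hM.wt_bounded (β - α) (m - 1 + k)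
      refine ⟨1 - N, fun n hn => ?_⟩
      have h1 := dualMap_oppositeY_mem_dualWt hD hM (n := n) hv hf
      rw [show m - n - 1 + k = m - 1 + k + ((-n : ℤ) : ℂ) by push_cast; ring,
        ModData.dualWt_eq_bot hM (hN (-n) (by omega)), Submodule.mem_bot] at h1
      exact Subtype.ext h1

theorem contragredient_jacobi (u : V) :
    JacobiIdentity (D.Y u) ((contragredient hD hM).Y u) ((contragredient hD hM).Y u)
      (fun v (n : ℤ) w => (contragredient hD hM).Y v n w) := by
  refine hD.induction (P := fun u => JacobiIdentity (D.Y u) ((contragredient hD hM).Y u)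
    ((contragredient hD hM).Y u) (fun v (n : ℤ) w => (contragredient hD hM).Y v n w)) ?_
    (fun x y hx hy => ?_) (fun α k u hu => ?_) u
  · simp only [map_zero]
    exact JacobiIdentity.zero
  · have := JacobiIdentity.add hx hy
    rwa [← map_add, ← map_add] at this
  -- `oppComponent_jacobi` holds from a threshold depending on the vector of W, so the identity
  -- between functionals is tested vector by vector.
  · refine JacobiIdentity.of_apply (hD.truncation u) (contragredient_truncation hD hM u)
      (fun v n f => ?_) fun l m n v f w => ?_
    · obtain ⟨N, hN⟩ := contragredient_truncation hD hM v f
      exact ⟨(N - n).toNat, fun m hm => hN _ (by omega)⟩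
    refine hD.induction (P := fun v => ∀ᶠ N : ℕ in Filter.atTop,
      (∑ i ∈ Finset.range N, ((-1 : ℂ) ^ i * binom l i) •
        ((contragredient hD hM).Y u (m + l - i) ((contragredient hD hM).Y v (n + i) f) :
          Module.Dual ℂ W) w)
      - ((-1 : ℂ) ^ l) • (∑ i ∈ Finset.range N, ((-1 : ℂ) ^ i * binom l i) •
        ((contragredient hD hM).Y v (n + l - i) ((contragredient hD hM).Y u (m + i) f) :
          Module.Dual ℂ W) w)
      = ∑ i ∈ Finset.range N, binom m i •
        ((contragredient hD hM).Y (D.Y u (l + i) v) (m + n - i) f : Module.Dual ℂ W) w)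
      ?_ (fun x y hx hy => ?_) (fun β h v hv => ?_) v
    · exact Filter.Eventually.of_forall fun N => by simp
    · filter_upwards [hx, hy] with N h1 h2
      simp only [Pi.add_apply, LinearMap.add_apply, map_add, smul_add, Finset.sum_add_distrib,
        Submodule.coe_add]
      rw [← h1, ← h2]
      abel
    · filter_upwards [oppComponent_jacobi hD hD.toIsVertexAction hD.L_one_nilpotent hM.jacobi
        hu.1 l m (n - 2 * h) v w] with N hN
      have h2 := congrArg (fun x => ((-1 : ℂ) ^ h) • (f : Module.Dual ℂ W) x) hN
      simp only [map_sub, map_sum, map_smul, smul_sub, Finset.smul_sum] at h2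
      simp only [contragredient_Y_apply, Finset.smul_sum]
      refine Eq.trans (congrArg₂ _ (Finset.sum_congr rfl fun i _ => ?_)
        (Finset.sum_congr rfl fun i _ => ?_)) (h2.trans (Finset.sum_congr rfl fun i _ => ?_))
      · rw [oppositeY_of_mem_wt hD M hv.1, LinearMap.smul_apply, map_smul, smul_comm,
          show n + i - 2 * h = n - 2 * h + i by ring]
      · rw [oppositeY_of_mem_wt hD M hv.1, LinearMap.smul_apply, map_smul, map_smul,
          smul_comm ((-1 : ℂ) ^ h) ((-1 : ℂ) ^ l), smul_comm ((-1 : ℂ) ^ h) (_ * _),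
          show n + l - i - 2 * h = n - 2 * h + l - i by ring]
        rfl
      -- The iterate has weight h + (k - l - i - 1); the second summand produces the extra sign and
      -- shift already present in `oppComponent_jacobi`.
      · have hmem : D.Y u (l + i) v ∈ D.wt (h + (k - l - i - 1)) := by
          have hb := hD.toIsVertexAction.bracket_zero_of_mem_wt hD.toIsVertexAction hu.1 (l + i) v
          rw [VertexData.L_zero_of_mem_wt hv.1, map_smul] at hb
          rw [VertexData.wt, Module.End.mem_eigenspace_iff, hb]
          push_cast
          module
        rw [oppositeY_of_mem_wt hD M hmem, LinearMap.smul_apply, map_smul,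
          zpow_add₀ (by norm_num), mul_smul, smul_comm ((-1 : ℂ) ^ h) (binom m i),
          show m + n - i - 2 * (h + (k - l - i - 1))
            = m + (n - 2 * h) - i - 2 * (k - l - i - 1) by ring]
        rfl

/-- Transposition reverses brackets and L'(j) = L(-j)^* exchanges L(1) with L(-1); the two effects
compensate. -/
theorem sl2Relations_contragredient : Sl2Relations (contragredient hD hM).L := by
  refine ⟨?_, ?_, ?_⟩
  · ext f w
    simp only [Ring.lie_def, LinearMap.sub_apply, Module.End.mul_apply, AddSubgroupClass.coe_sub,
      contragredient_L_zero_apply, contragredient_L_neg_one_apply]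
    rw [← map_sub, L_one_apply_zero hM.sl2]
    congr 1
    abel
  · ext f w
    simp only [Ring.lie_def, LinearMap.sub_apply, Module.End.mul_apply, AddSubgroupClass.coe_sub,
      contragredient_L_zero_apply, contragredient_L_one_apply, LinearMap.neg_apply,
      NegMemClass.coe_neg]
    rw [← map_sub, ← map_neg, sl2_comm_zero hM.sl2 (-1) w, coe_neg_one_signType]
    congr 1
    module
  · ext f w
    simp only [Ring.lie_def, LinearMap.sub_apply, Module.End.mul_apply, AddSubgroupClass.coe_sub,
      contragredient_L_zero_apply, contragredient_L_one_apply, contragredient_L_neg_one_apply,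
      LinearMap.smul_apply, Submodule.coe_smul]
    rw [← map_sub, ← map_smul, L_neg_one_apply_one hM.sl2]
    congr 1
    module

theorem sl2BracketRelations_contragredient
    (h : Sl2BracketRelations D.L M.L M.L fun v (n : ℤ) w => M.Y v n w) :
    Sl2BracketRelations D.L (contragredient hD hM).L (contragredient hD hM).L
      fun v (n : ℤ) f => (contragredient hD hM).Y v n f := by
  intro v n f
  refine hD.induction (P := fun v =>
    (contragredient hD hM).L (-1) ((contragredient hD hM).Y v n f)
        - (contragredient hD hM).Y v n ((contragredient hD hM).L (-1) f)
      = (contragredient hD hM).Y (D.L (-1) v) n f ∧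
    (contragredient hD hM).L 0 ((contragredient hD hM).Y v n f)
        - (contragredient hD hM).Y v n ((contragredient hD hM).L 0 f)
      = (contragredient hD hM).Y (D.L 0 v) n f
        + (contragredient hD hM).Y (D.L (-1) v) (n + 1) f ∧
    (contragredient hD hM).L 1 ((contragredient hD hM).Y v n f)
        - (contragredient hD hM).Y v n ((contragredient hD hM).L 1 f)
      = (contragredient hD hM).Y (D.L 1 v) n f
        + (2 : ℂ) • (contragredient hD hM).Y (D.L 0 v) (n + 1) f
        + (contragredient hD hM).Y (D.L (-1) v) (n + 2) f) ?_ (fun x y hx hy => ?_) (fun α k v hv => ?_) v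
  · simp
  · obtain ⟨a1, a2, a3⟩ := hx
    obtain ⟨b1, b2, b3⟩ := hy
    simp only [map_add, Pi.add_apply, LinearMap.add_apply, smul_add]
    refine ⟨?_, ?_, ?_⟩
    · rw [← a1, ← b1]; abel
    · rw [add_sub_add_comm, a2, b2]; abel
    · rw [add_sub_add_comm, a3, b3]; abel
  · have hE : ∀ (w : W) (n : ℤ), oppositeY hD M v n w = ((-1 : ℂ) ^ k) •
        oppComponent (D.L 1) hD.L_one_nilpotent M.Y v (n - 2 * k) w := fun w n => by
      rw [oppositeY_of_mem_wt hD M hv.1, LinearMap.smul_apply]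
    -- L'(-1) is the transpose of L(1), so the bracket with L(1) gives the first relation and the
    -- bracket with L(-1) the third.
    have b1 := fun w => oppComponent_bracket_one (hN := hD.L_one_nilpotent) (I := M.Y) hD.sl2 h v
      (n - 2 * k) w
    have b0 := fun w => oppComponent_bracket_zero (hN := hD.L_one_nilpotent) (I := M.Y) hD.sl2 h v
      (n - 2 * k) w
    have bm := fun w => oppComponent_bracket_neg_one (hN := hD.L_one_nilpotent) (I := M.Y) hD.sl2 h
      v (n - 2 * k) w
    refine ⟨?_, ?_, ?_⟩
    · ext w
      simp only [AddSubgroupClass.coe_sub, LinearMap.sub_apply, contragredient_Y_apply,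
        contragredient_L_neg_one_apply]
      rw [oppositeY_L_neg_one hD hv.1, hE, hE, LinearMap.smul_apply, ← b1]
      simp only [map_smul, map_sub]
      module
    · ext w
      simp only [AddSubgroupClass.coe_sub, LinearMap.sub_apply, contragredient_Y_apply,
        contragredient_L_zero_apply, Submodule.coe_add, LinearMap.add_apply]
      have b0' := eq_sub_iff_add_eq.1 (b0 w)
      rw [oppositeY_L_neg_one hD hv.1, oppositeY_L_zero hD hv.1, hE, hE, LinearMap.smul_apply,
        LinearMap.smul_apply, show n + 1 - 2 * k - 2 = n - 2 * k - 1 by ring, ← b0']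
      simp only [map_smul, map_sub, map_add]
      module
    · ext w
      simp only [AddSubgroupClass.coe_sub, LinearMap.sub_apply, contragredient_Y_apply,
        contragredient_L_one_apply, Submodule.coe_add, LinearMap.add_apply, Submodule.coe_smul,
        LinearMap.smul_apply]
      have bm' := sub_eq_iff_eq_add.1 (bm w)
      rw [oppositeY_L_neg_one hD hv.1, oppositeY_L_zero hD hv.1, oppositeY_L_one hD hv.1, hE, hE,
        LinearMap.smul_apply, LinearMap.smul_apply, LinearMap.smul_apply,
        show n + 2 - 2 * k - 2 = n - 2 * k by ring, show n + 1 - 2 * k = n - 2 * k + 1 by ring,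
        map_smul (M.L (-1)), bm']
      simp only [map_smul, map_sub, map_add]
      module

end Contragredient

/-! ### The conformal case, the module W', and W = W'' -/

section Contragredient

variable {B V W : Type*} [AddCommGroup B] {A : AddSubgroup B} [AddCommGroup V] [Module ℂ V]
  [AddCommGroup W] [Module ℂ W] {κ : Kind V} {D : VertexData A V} {M : ModData B V W}
  (hD : IsStronglyGradedVertexAlgebra κ D) (hM : IsStronglyGradedModule κ D M)

/-- ω = L(-2)𝟏, while L(1)𝟏 = 0 and [L(1), L(-2)] = 3L(-1) kills the vacuum. -/
theorem L_one_omega {ω : V} {c : ℂ} {D : VertexData A V}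
    (hD : IsStronglyGradedVertexAlgebra (.conformal ω c) D) : D.L 1 ω = 0 := by
  obtain ⟨-, -, h1, hvir⟩ := hD.L_relations
  have h := congrArg (fun T : Module.End ℂ V => T D.one) (hvir 1 (-2))
  obtain ⟨hω, hann⟩ := hD.creation ω
  simp only [Ring.lie_def, LinearMap.sub_apply, Module.End.mul_apply, LinearMap.add_apply,
    LinearMap.smul_apply] at h
  rw [show (1 : ℤ) + 1 = 2 by norm_num, show (-2 : ℤ) + 1 = -1 by norm_num,
    show (1 : ℤ) + -2 + 1 = 0 by norm_num, hω, hann 2 (by norm_num), hann 0 le_rfl] at h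
  rw [h1]
  simpa using h

/-- As ω has weight 2 and L(1)ω = 0, only one term with sign +1 remains: the opposite of L(j) is
L(-j). Hence L'(j) is also a component of Y'(ω,x). -/
theorem oppositeY_omega {ω : V} {c : ℂ} {D : VertexData A V}
    (hD : IsStronglyGradedVertexAlgebra (.conformal ω c) D) (M : ModData B V W) (n : ℤ) :
    oppositeY hD M ω n = M.Y ω (2 - n) := by
  rw [oppositeY_of_mem_wt hD M (hD.omega_mem ω c rfl),
    oppComponent_eq_sum (m := 1) _ (by simpa using L_one_omega hD)]
  simp only [Finset.range_one, Finset.sum_singleton, divPow_zero_apply]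
  rw [show -(n - 2 * 2) - 2 - ((0 : ℕ) : ℤ) = 2 - n by push_cast; ring]
  norm_num

theorem contragredient_LRelations : (contragredient hD hM).LRelations D.L κ := by
  have hL := hM.L_relations
  cases κ with
  | mobius =>
    exact ⟨sl2Relations_contragredient hD hM, sl2BracketRelations_contragredient hD hM hL.2⟩
  | conformal ω c =>
    obtain ⟨hm, h0, h1, hvir⟩ := hL
    refine ⟨?_, ?_, ?_, fun m n => ?_⟩
    · ext f w
      rw [contragredient_L_neg_one_apply, contragredient_Y_apply, oppositeY_omega, h1]
      rfl
    · ext f w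
      rw [contragredient_L_zero_apply, contragredient_Y_apply, oppositeY_omega, h0]
      rfl
    · ext f w
      rw [contragredient_L_one_apply, contragredient_Y_apply, oppositeY_omega, hm]
      rfl
    · ext f w
      -- Transposition reverses order, so [L'(m), L'(n)] is the transpose of [L(-n), L(-m)].
      have h := congrArg (fun T : Module.End ℂ W => (f : Module.Dual ℂ W) (T w)) (hvir (-n) (-m))
      simp only [Ring.lie_def, LinearMap.sub_apply, Module.End.mul_apply, LinearMap.add_apply,
        LinearMap.smul_apply, map_sub, map_add, map_smul, Module.End.one_apply] at h ⊢
      simp only [AddSubgroupClass.coe_sub, Submodule.coe_add, Submodule.coe_smul,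
        LinearMap.sub_apply, LinearMap.add_apply, LinearMap.smul_apply, contragredient_Y_apply,
        oppositeY_omega]
      rw [show 2 - (n + 1) = -n + 1 by ring, show 2 - (m + 1) = -m + 1 by ring,
        show 2 - (m + n + 1) = -n + -m + 1 by ring, h]
      congr 1
      · congr 1
        push_cast
        ring
      · congr 1
        by_cases hmn : n + m = 0
        · rw [if_pos hmn, if_pos (by omega)]
          obtain rfl : n = -m := by omega
          push_cast
          ring
        · rw [if_neg hmn, if_neg (by omega)]

theorem mem_contragredient_of_dualWt {β : B} {n : ℂ} {f : Module.Dual ℂ W} (hf : f ∈ M.dualWt β n) :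
    (⟨f, ModData.mem_dualSpace hf⟩ : M.dualSpace)
      ∈ (contragredient hD hM).wt n ⊓ (contragredient hD hM).gr (-β) := by
  rw [mem_contragredient_wt_inf_gr, neg_neg]
  exact hf

theorem contragredient_L_mem_gr (j : SignType) (β : B) (f : M.dualSpace)
    (hf : f ∈ (contragredient hD hM).gr β) :
    (contragredient hD hM).L j f ∈ (contragredient hD hM).gr β := by
  rw [mem_contragredient_gr] at hf ⊢
  intro γ hγ w hw
  rw [contragredient_L_apply]
  exact hf γ hγ _ (hM.L_mem _ γ w hw)

theorem oppositeY_mem_gr (hM : IsStronglyGradedModule κ D M) {α : A} {v : V} (hv : v ∈ D.gr α)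
    (n : ℤ) {β : B} {w : W} (hw : w ∈ M.gr β) : oppositeY hD M v n w ∈ M.gr ((α : B) + β) := by
  rw [hD.gr_compatible] at hv
  rw [hM.gr_compatible] at hw
  refine Submodule.iSup_induction _ (motive := fun v => oppositeY hD M v n w ∈ M.gr ((α : B) + β)) hv
    (fun k v hv => ?_) (by simp) (fun x y hx hy => ?_)
  · refine Submodule.iSup_induction _
      (motive := fun w => oppositeY hD M v n w ∈ M.gr ((α : B) + β)) hw
      (fun m w hw => (oppositeY_mem hD hM hv hw).2) (by simp) (fun x y hx hy => ?_)
    rw [map_add]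
    exact Submodule.add_mem _ hx hy
  · rw [map_add, Pi.add_apply, LinearMap.add_apply]
    exact Submodule.add_mem _ hx hy

theorem contragredient_Y_mem_gr (α : A) (β : B) (v : V) (hv : v ∈ D.gr α) (l : ℤ) (f : M.dualSpace)
    (hf : f ∈ (contragredient hD hM).gr β) :
    (contragredient hD hM).Y v l f ∈ (contragredient hD hM).gr ((α : B) + β) := by
  rw [mem_contragredient_gr] at hf ⊢
  intro γ hγ w hw
  rw [contragredient_Y_apply]
  refine hf _ (fun h => hγ ?_) _ (oppositeY_mem_gr hD hM hv l hw)
  rw [neg_add, ← h]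
  abel

theorem IsDirectSum.of_dualSpace {ι : Type*} {p : ι → Submodule ℂ M.dualSpace} (hp : iSupIndep p)
    (h : ∀ (β : B) (n : ℂ) (f : Module.Dual ℂ W) (hf : f ∈ M.dualWt β n),
      ∃ i, (⟨f, ModData.mem_dualSpace hf⟩ : M.dualSpace) ∈ p i) : IsDirectSum p := by
  refine ⟨hp, eq_top_iff.2 fun f _ => ?_⟩
  refine ModData.dualSpace_ind (P := fun f => f ∈ ⨆ i, p i) (Submodule.zero_mem _)
    (fun f g hf hg => Submodule.add_mem _ hf hg) (fun β n f hf => ?_) f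
  obtain ⟨i, hi⟩ := h β n f hf
  exact Submodule.mem_iSup_of_mem i hi

theorem contragredient_gr_iSupIndep : iSupIndep (contragredient hD hM).gr := by
  intro β
  rw [Submodule.disjoint_def]
  intro f hf hf'
  have h2 : ∀ w ∈ M.gr (-β), (f : Module.Dual ℂ W) w = 0 := by
    intro w hw
    have hle : (⨆ γ, ⨆ (_ : γ ≠ β), (contragredient hD hM).gr γ)
        ≤ LinearMap.ker ((LinearMap.applyₗ w : Module.Dual ℂ W →ₗ[ℂ] ℂ) ∘ₗ M.dualSpace.subtype) := by
      refine iSup_le fun γ => iSup_le fun hγ g hg => ?_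
      exact (mem_contragredient_gr hD hM).1 hg (-β) (fun h => hγ (neg_injective h).symm) w hw
    exact hle hf'
  apply Subtype.ext
  refine hM.hom_ext fun γ n w hw => ?_
  by_cases hγ : γ = -β
  · subst hγ
    exact h2 w hw.2
  · exact (mem_contragredient_gr hD hM).1 hf γ hγ w hw.2

theorem contragredient_finiteDimensional (β : B) (n : ℂ) :
    FiniteDimensional ℂ ((contragredient hD hM).wt n ⊓ (contragredient hD hM).gr β :
      Submodule ℂ M.dualSpace) := by
  have := hM.finiteDimensional (-β) n
  let T : ((contragredient hD hM).wt n ⊓ (contragredient hD hM).gr β : Submodule ℂ M.dualSpace)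
      →ₗ[ℂ] Module.Dual ℂ (M.wt n ⊓ M.gr (-β) : Submodule ℂ W) :=
    (M.wt n ⊓ M.gr (-β)).subtype.dualMap ∘ₗ M.dualSpace.subtype ∘ₗ Submodule.subtype _
  refine FiniteDimensional.of_injective T fun f g hfg => ?_
  apply Subtype.ext
  apply Subtype.ext
  refine ModData.dualWt_hom_ext hM ((mem_contragredient_wt_inf_gr hD hM).1 f.2)
    ((mem_contragredient_wt_inf_gr hD hM).1 g.2) fun w hw => ?_
  exact congrArg (fun φ => φ ⟨w, hw⟩) hfg

/-- The contragredient of a strongly graded generalized module is again one. -/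
theorem isStronglyGradedModule_contragredient :
    IsStronglyGradedModule κ D (contragredient hD hM) where
  truncation := contragredient_truncation hD hM
  vacuum n := by
    ext f w
    rw [contragredient_Y_apply, oppositeY_one hD hM]
    split_ifs <;> simp
  jacobi := contragredient_jacobi hD hM
  derivative v n := by
    ext f w
    rw [contragredient_Y_apply, oppositeY_derivative hD hM]
    simp [contragredient_Y_apply]
  L_relations := contragredient_LRelations hD hM
  wt_directSum := IsDirectSum.of_dualSpace (Module.End.independent_maxGenEigenspace _)
    fun β n f hf => ⟨n, (mem_contragredient_of_dualWt hD hM hf).1⟩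
  gr_directSum := IsDirectSum.of_dualSpace (contragredient_gr_iSupIndep hD hM)
    fun β n f hf => ⟨-β, (mem_contragredient_of_dualWt hD hM hf).2⟩
  gr_compatible β := by
    refine le_antisymm (fun f hf => ?_) (iSup_le fun n => inf_le_right)
    have key : (⨆ n, M.dualWt (-β) n) ≤ (⨆ n, (contragredient hD hM).wt n ⊓
        (contragredient hD hM).gr β).map M.dualSpace.subtype := by
      refine iSup_le fun n g hg => ?_
      refine ⟨⟨g, ModData.mem_dualSpace hg⟩, Submodule.mem_iSup_of_mem n ?_, rfl⟩
      exact (mem_contragredient_wt_inf_gr hD hM).2 hg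
    obtain ⟨g, hg, hgf⟩ := key hf
    rwa [← Subtype.ext hgf]
  wt_bounded β n := by
    obtain ⟨N, hN⟩ := hM.wt_bounded (-β) n
    refine ⟨N, fun k hk => ?_⟩
    rw [eq_bot_iff]
    intro f hf
    rw [mem_contragredient_wt_inf_gr, ModData.dualWt_eq_bot hM (hN k hk), Submodule.mem_bot] at hf
    exact Subtype.ext hf
  finiteDimensional := contragredient_finiteDimensional hD hM
  Y_mem := contragredient_Y_mem_gr hD hM
  L_mem := contragredient_L_mem_gr hD hM

/-! ### The double contragredient -/

theorem eval_mem_dualWt {β : B} {n : ℂ} {w : W} (hw : w ∈ M.wt n ⊓ M.gr β) :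
    (LinearMap.applyₗ w : Module.Dual ℂ W →ₗ[ℂ] ℂ) ∘ₗ M.dualSpace.subtype
      ∈ (contragredient hD hM).dualWt (-β) n := by
  intro γ m hne f hf
  rw [mem_contragredient_wt_inf_gr] at hf
  refine hf β n (fun h => hne ?_) w hw
  rw [Prod.mk.injEq] at h
  rw [h.1, h.2, neg_neg]

theorem eval_mem_dualSpace (w : W) :
    (LinearMap.applyₗ w : Module.Dual ℂ W →ₗ[ℂ] ℂ) ∘ₗ M.dualSpace.subtype
      ∈ (contragredient hD hM).dualSpace := by
  refine hM.induction (P := fun w => (LinearMap.applyₗ w : Module.Dual ℂ W →ₗ[ℂ] ℂ) ∘ₗ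
    M.dualSpace.subtype ∈ (contragredient hD hM).dualSpace) ?_ (fun x y hx hy => ?_)
    (fun β n w hw => ModData.mem_dualSpace (eval_mem_dualWt hD hM hw)) w
  · rw [map_zero, LinearMap.zero_comp]; exact Submodule.zero_mem _
  · rw [map_add, LinearMap.add_comp]; exact Submodule.add_mem _ hx hy

/-- The evaluation map `W → W''`. -/
noncomputable def evalDouble : W →ₗ[ℂ] (contragredient hD hM).dualSpace where
  toFun w := ⟨_, eval_mem_dualSpace hD hM w⟩
  map_add' x y := by ext f; simp
  map_smul' c x := by ext f; simp

/-- W' separates points, because any functional preceded by a bihomogeneous projection lies in W'.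
-/
theorem eq_zero_of_dualSpace (hM : IsStronglyGradedModule κ D M) {w : W}
    (h : ∀ f ∈ M.dualSpace, f w = 0) : w = 0 := by
  refine hM.gr_directSum.eq_zero_of_proj fun β => hM.wt_directSum.eq_zero_of_proj fun n => ?_
  refine (Module.forall_dual_apply_eq_zero_iff ℂ _).1 fun g => ?_
  exact h _ (ModData.mem_dualSpace (ModData.comp_proj_mem_dualWt hM β n g))

theorem evalDouble_injective : Function.Injective (evalDouble hD hM) := by
  rw [injective_iff_map_eq_zero]
  intro w hw
  refine eq_zero_of_dualSpace hM fun f hf => ?_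
  have := congrArg (fun φ : (contragredient hD hM).dualSpace =>
    (φ : Module.Dual ℂ M.dualSpace) ⟨f, hf⟩) hw
  exact this

theorem wt_proj_mem_gr (hM : IsStronglyGradedModule κ D M) (n : ℂ) {β : B} {w : W}
    (hw : w ∈ M.gr β) : hM.wt_directSum.proj n w ∈ M.gr β := by
  rw [hM.gr_compatible] at hw
  refine Submodule.iSup_induction _ (motive := fun w => hM.wt_directSum.proj n w ∈ M.gr β) hw
    (fun m w hw => ?_) (by simp) (fun x y hx hy => ?_)
  · by_cases h : m = n
    · subst h
      rw [hM.wt_directSum.proj_of_mem hw.1]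
      exact hw.2
    · rw [hM.wt_directSum.proj_of_mem_ne h hw.1]
      exact Submodule.zero_mem _
  · rw [map_add]
    exact Submodule.add_mem _ hx hy

/-- Reflexivity of the finite-dimensional space p = W_{[n]}^{(-β)}. Extending functionals on p by
the projection q turns a bihomogeneous φ ∈ W'' into an element Ψ of the double dual of p, hence into
a vector of p, whose evaluation agrees with φ on the only piece of W' where φ can be nonzero. -/
theorem evalDouble_surjective : Function.Surjective (evalDouble hD hM) := by
  rw [← LinearMap.range_eq_top, eq_top_iff]
  intro φ _
  refine ModData.dualSpace_ind (P := fun φ => φ ∈ LinearMap.range (evalDouble hD hM))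
    (Submodule.zero_mem _) (fun f g hf hg => Submodule.add_mem _ hf hg) (fun β n φ hφ => ?_) φ
  have := hM.finiteDimensional (-β) n
  let p := M.wt n ⊓ M.gr (-β)
  let q : W →ₗ[ℂ] p := LinearMap.codRestrict p
    (hM.wt_directSum.proj n ∘ₗ hM.gr_directSum.proj (-β)) fun w =>
      ⟨hM.wt_directSum.proj_mem n _, wt_proj_mem_gr hM n (hM.gr_directSum.proj_mem (-β) w)⟩
  have hq : ∀ w (hw : w ∈ p), q w = ⟨w, hw⟩ := by
    intro w hw
    apply Subtype.ext
    change hM.wt_directSum.proj n (hM.gr_directSum.proj (-β) w) = w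
    rw [hM.gr_directSum.proj_of_mem hw.2, hM.wt_directSum.proj_of_mem hw.1]
  have hmem : ∀ g : Module.Dual ℂ p, g ∘ₗ q ∈ M.dualWt (-β) n := by
    intro g γ m hne w hw
    rw [LinearMap.comp_apply]
    have : q w = 0 := by
      apply Subtype.ext
      change hM.wt_directSum.proj n (hM.gr_directSum.proj (-β) w) = 0
      by_cases h : γ = -β
      · rw [h] at hw
        rw [hM.gr_directSum.proj_of_mem hw.2,
          hM.wt_directSum.proj_of_mem_ne (fun h' => hne (by rw [h, h'])) hw.1]
      · rw [hM.gr_directSum.proj_of_mem_ne h hw.2, map_zero]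
    rw [this, map_zero]
  let Ψ : Module.Dual ℂ (Module.Dual ℂ p) :=
    { toFun := fun g => φ ⟨g ∘ₗ q, ModData.mem_dualSpace (hmem g)⟩
      map_add' := fun g g' => by rw [← map_add]; rfl
      map_smul' := fun c g => by rw [RingHom.id_apply, ← map_smul]; rfl }
  let w₀ : p := (Module.evalEquiv ℂ p).symm Ψ
  have hw₀ : ∀ g : Module.Dual ℂ p, g w₀ = Ψ g := by
    intro g
    have h := (Module.evalEquiv ℂ p).apply_symm_apply Ψ
    rw [← h]
    rfl
  refine ⟨w₀, Subtype.ext ?_⟩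
  have h1 := eval_mem_dualWt hD hM w₀.2
  rw [neg_neg] at h1
  refine ModData.dualWt_hom_ext (isStronglyGradedModule_contragredient hD hM) h1 hφ fun f hf => ?_
  have hf' := (mem_contragredient_wt_inf_gr hD hM).1 hf
  have e : (f : Module.Dual ℂ W) = ((f : Module.Dual ℂ W) ∘ₗ p.subtype) ∘ₗ q := by
    refine ModData.dualWt_hom_ext hM hf' (hmem _) fun w hw => ?_
    rw [LinearMap.comp_apply, hq w hw]
    rfl
  change (f : Module.Dual ℂ W) w₀ = φ f
  have h2 := hw₀ ((f : Module.Dual ℂ W) ∘ₗ p.subtype)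
  change (f : Module.Dual ℂ W) w₀ = φ ⟨_, _⟩ at h2
  rw [h2]
  congr 1
  exact Subtype.ext e.symm

/-- The identification `W = W''`. -/
noncomputable def doubleEquiv : W ≃ₗ[ℂ] (contragredient hD hM).dualSpace :=
  LinearEquiv.ofBijective (evalDouble hD hM)
    ⟨evalDouble_injective hD hM, evalDouble_surjective hD hM⟩

theorem doubleEquiv_apply (w : W) (f : M.dualSpace) :
    (doubleEquiv hD hM w : Module.Dual ℂ M.dualSpace) f = (f : Module.Dual ℂ W) w := rfl

/-- Taking opposites twice applies e^{xL(1)} twice. The inner vector L(1)^j v has weight k - j, so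
its sign (-1)^{k-j} turns one exponential into e^{-xL(1)}, and the product is 1. -/
theorem oppositeY_oppositeY_of_mem_wt {k : ℤ} {v : V} (hv : v ∈ D.wt k) (n : ℤ) (f : M.dualSpace)
    (w : W) : (oppositeY hD (contragredient hD hM) v n f : Module.Dual ℂ W) w
      = (f : Module.Dual ℂ W) (M.Y v n w) := by
  obtain ⟨J, hJ⟩ := hD.L_one_nilpotent v
  rw [oppositeY_eq_sum hD _ hv hJ]
  have e1 : ∀ j ∈ Finset.range J, (((contragredient hD hM).Y (divPow (D.L 1) j v)
      (2 * k - 2 - j - n) f : M.dualSpace) : Module.Dual ℂ W) w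
      = ((-1 : ℂ) ^ k) • ∑ i ∈ Finset.range J, (f : Module.Dual ℂ W)
        (M.Y (divPow (D.L 1) i (divPow ((-1 : ℂ) • D.L 1) j v)) (n - ((i + j : ℕ) : ℤ)) w) := by
    intro j _
    have hJ' : ((D.L 1) ^ J) (divPow (D.L 1) j v) = 0 := by
      unfold divPow
      rw [LinearMap.smul_apply, map_smul, ← Module.End.mul_apply, ← pow_add, add_comm, pow_add,
        Module.End.mul_apply, hJ, map_zero, smul_zero]
    rw [contragredient_Y_apply, oppositeY_eq_sum hD _ (divPow_L_one_mem_wt hD.sl2 hv j) hJ',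
      zpow_sub₀ (by norm_num), map_smul, div_eq_mul_inv, mul_smul, map_sum, Finset.smul_sum]
    congr 1
    refine Finset.sum_congr rfl fun i _ => ?_
    rw [divPow_smul, LinearMap.smul_apply, map_smul, map_smul, Pi.smul_apply, LinearMap.smul_apply,
      map_smul, show 2 * (k - (j : ℤ)) - 2 - i - (2 * k - 2 - j - n) = n - ((i + j : ℕ) : ℤ) by
        push_cast; ring]
    congr 1
    rw [zpow_natCast, ← inv_pow]
    norm_num
  have e2 : ((((-1 : ℂ) ^ k) • ∑ j ∈ Finset.range J, (contragredient hD hM).Y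
      (divPow (D.L 1) j v) (2 * k - 2 - j - n) f : M.dualSpace) : Module.Dual ℂ W) w
      = ((-1 : ℂ) ^ k) • ∑ j ∈ Finset.range J, (((contragredient hD hM).Y (divPow (D.L 1) j v)
      (2 * k - 2 - j - n) f : M.dualSpace) : Module.Dual ℂ W) w := by
    simp only [Submodule.coe_smul, AddSubmonoidClass.coe_finsetSum, LinearMap.smul_apply,
      LinearMap.sum_apply]
  have hk : (-1 : ℂ) ^ k * (-1 : ℂ) ^ k = 1 := by
    rw [← mul_zpow]; norm_num
  rw [e2, Finset.sum_congr rfl e1, ← Finset.smul_sum, smul_smul, hk, one_smul, Finset.sum_comm]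
  rw [sum_range_range_eq_sum_antidiagonal (T := J + J + 1) (f := fun i j => (f : Module.Dual ℂ W)
        (M.Y (divPow (D.L 1) i (divPow ((-1 : ℂ) • D.L 1) j v)) (n - ((i + j : ℕ) : ℤ)) w))]
  · rw [Finset.sum_range_succ', Finset.sum_eq_zero, zero_add]
    · simp [divPow_zero]
    · intro t _
      have e3 : ∀ x ∈ Finset.HasAntidiagonal.antidiagonal (t + 1), (f : Module.Dual ℂ W)
          (M.Y (divPow (D.L 1) x.1 (divPow ((-1 : ℂ) • D.L 1) x.2 v)) (n - ((x.1 + x.2 : ℕ) : ℤ)) w)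
          = ((f : Module.Dual ℂ W) ∘ₗ LinearMap.applyₗ w ∘ₗ
            LinearMap.proj (n - ((t + 1 : ℕ) : ℤ)) ∘ₗ M.Y)
            (divPow (D.L 1) x.1 (divPow ((-1 : ℂ) • D.L 1) x.2 v)) := by
        intro x hx
        rw [Finset.HasAntidiagonal.mem_antidiagonal.1 hx]
        rfl
      rw [Finset.sum_congr rfl e3, ← map_sum, sum_divPow_neg _ (Nat.succ_ne_zero t), map_zero]
  · intro i j hi
    rw [divPow_smul, LinearMap.smul_apply, map_smul, divPow_divPow, divPow_eq_zero hJ (by omega)]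
    simp
  · intro i j hj
    rw [divPow_smul, LinearMap.smul_apply, map_smul, divPow_divPow, divPow_eq_zero hJ (by omega)]
    simp
  · omega

theorem oppositeY_oppositeY (v : V) (n : ℤ) (f : M.dualSpace) (w : W) :
    (oppositeY hD (contragredient hD hM) v n f : Module.Dual ℂ W) w
      = (f : Module.Dual ℂ W) (M.Y v n w) := by
  refine hD.induction (P := fun v => (oppositeY hD (contragredient hD hM) v n f :
    Module.Dual ℂ W) w = (f : Module.Dual ℂ W) (M.Y v n w)) (by simp) (fun x y hx hy => ?_)
    (fun α k v hv => oppositeY_oppositeY_of_mem_wt hD hM hv.1 n f w) v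
  simp only [map_add, Pi.add_apply, LinearMap.add_apply, Submodule.coe_add, hx, hy]

theorem doubleEquiv_Y (v : V) (n : ℤ) (w : W) :
    doubleEquiv hD hM (M.Y v n w) = (contragredient hD
      (isStronglyGradedModule_contragredient hD hM)).Y v n (doubleEquiv hD hM w) := by
  ext f
  rw [contragredient_Y_apply, doubleEquiv_apply, doubleEquiv_apply, oppositeY_oppositeY]

theorem doubleEquiv_L (j : SignType) (w : W) :
    doubleEquiv hD hM (M.L j w) = (contragredient hD
      (isStronglyGradedModule_contragredient hD hM)).L j (doubleEquiv hD hM w) := by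
  ext f
  rw [contragredient_L_apply, doubleEquiv_apply, doubleEquiv_apply, contragredient_L_apply, neg_neg]

theorem doubleEquiv_mem_gr {β : B} {w : W} :
    doubleEquiv hD hM w ∈ (contragredient hD (isStronglyGradedModule_contragredient hD hM)).gr β
      ↔ w ∈ M.gr β := by
  rw [mem_contragredient_gr]
  constructor
  · intro h
    have e : w = hM.gr_directSum.proj β w := by
      rw [← sub_eq_zero]
      refine hM.gr_directSum.eq_zero_of_proj fun γ => hM.wt_directSum.eq_zero_of_proj fun n => ?_
      refine (Module.forall_dual_apply_eq_zero_iff ℂ _).1 fun g => ?_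
      have hg := ModData.comp_proj_mem_dualWt hM γ n g
      by_cases hγ : γ = β
      · subst hγ
        rw [map_sub, hM.gr_directSum.proj_of_mem (hM.gr_directSum.proj_mem γ w), sub_self, map_zero,
          map_zero]
      · rw [map_sub, hM.gr_directSum.proj_of_mem_ne (Ne.symm hγ) (hM.gr_directSum.proj_mem β w),
          sub_zero]
        exact h (-γ) (fun h' => hγ (neg_injective h')) ⟨_, ModData.mem_dualSpace hg⟩
          (mem_contragredient_of_dualWt hD hM hg).2
    rw [e]
    exact hM.gr_directSum.proj_mem β w
  · intro hw γ hγ f hf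
    exact (mem_contragredient_gr hD hM).1 hf β (fun h => hγ (by rw [h, neg_neg])) w hw

end Contragredient

/-! ### Finite logarithmic sums -/

section LogPoly

variable {W W' : Type*} [AddCommGroup W] [Module ℂ W] [AddCommGroup W'] [Module ℂ W']

/-- Multiplication by the monomial `x^{c.1} (log x)^{c.2}` on finite sums. -/
noncomputable def mulMon (c : ℂ × ℕ) : LogPoly W →ₗ[ℂ] LogPoly W :=
  Finsupp.lmapDomain W ℂ fun q => c + q

theorem mulMon_single (c p : ℂ × ℕ) (w : W) :
    mulMon c (Finsupp.single p w) = Finsupp.single (c + p) w := by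
  simp [mulMon, Finsupp.mapDomain_single]

theorem mulMon_mulMon (c d : ℂ × ℕ) (g : LogPoly W) :
    mulMon c (mulMon d g) = mulMon (c + d) g := by
  induction g using Finsupp.induction_linear with
  | zero => simp
  | add f g hf hg => simp only [map_add, hf, hg]
  | single p w => simp only [mulMon_single, add_assoc]

theorem mulMon_zero (g : LogPoly W) : mulMon 0 g = g := by
  induction g using Finsupp.induction_linear with
  | zero => simp
  | add f g hf hg => simp only [map_add, hf, hg]
  | single p w => simp only [mulMon_single, zero_add]

theorem coeffwise_single {α : Type*} (T : W →ₗ[ℂ] W') (p : α) (w : W) :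
    coeffwise T (Finsupp.single p w) = Finsupp.single p (T w) := by simp

theorem coeffwise_mulMon (T : W →ₗ[ℂ] W') (c : ℂ × ℕ) (g : LogPoly W) :
    coeffwise T (mulMon c g) = mulMon c (coeffwise T g) := by
  induction g using Finsupp.induction_linear with
  | zero => simp
  | add f g hf hg => simp only [map_add, hf, hg]
  | single p w => simp only [mulMon_single, coeffwise_single]

theorem LogPoly.apply_single (T : W →ₗ[ℂ] LogPoly W') (p : ℂ × ℕ) (w : W) :
    LogPoly.apply T (Finsupp.single p w) = mulMon p (T w) := by
  simp [LogPoly.apply, mulMon]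

theorem LogPoly.apply_mulMon (T : W →ₗ[ℂ] LogPoly W') (c : ℂ × ℕ) (g : LogPoly W) :
    LogPoly.apply T (mulMon c g) = mulMon c (LogPoly.apply T g) := by
  induction g using Finsupp.induction_linear with
  | zero => simp
  | add f g hf hg => simp only [map_add, hf, hg]
  | single p w => simp only [mulMon_single, LogPoly.apply_single, mulMon_mulMon]

theorem LogPoly.apply_coeffwise {T : W →ₗ[ℂ] LogPoly W} {S : Module.End ℂ W} {c : ℂ × ℕ}
    (h : ∀ w, T (S w) = mulMon c (coeffwise S (T w))) (g : LogPoly W) :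
    LogPoly.apply T (coeffwise S g) = mulMon c (coeffwise S (LogPoly.apply T g)) := by
  induction g using Finsupp.induction_linear with
  | zero => simp
  | add f g hf hg => simp only [map_add, hf, hg]
  | single p w =>
    rw [coeffwise_single, LogPoly.apply_single, LogPoly.apply_single, h, coeffwise_mulMon,
      mulMon_mulMon, mulMon_mulMon, add_comm]

/-- The derivative `d/dx` on finite sums. -/
noncomputable def logDeriv : LogPoly W →ₗ[ℂ] LogPoly W :=
  Finsupp.lsum ℂ fun p : ℂ × ℕ => p.1 • Finsupp.lsingle (p.1 - 1, p.2)
    + (p.2 : ℂ) • Finsupp.lsingle (p.1 - 1, p.2 - 1)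

theorem logDeriv_single (p : ℂ × ℕ) (w : W) : logDeriv (Finsupp.single p w)
    = p.1 • Finsupp.single (p.1 - 1, p.2) w + (p.2 : ℂ) • Finsupp.single (p.1 - 1, p.2 - 1) w := by
  simp [logDeriv]

theorem coeffwise_logDeriv (T : W →ₗ[ℂ] W') (g : LogPoly W) :
    coeffwise T (logDeriv g) = logDeriv (coeffwise T g) := by
  induction g using Finsupp.induction_linear with
  | zero => simp
  | add f g hf hg => simp only [map_add, hf, hg]
  | single p w =>
    rw [coeffwise_single, logDeriv_single, logDeriv_single, map_add, map_smul, map_smul,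
      coeffwise_single, coeffwise_single]

theorem logDeriv_mulMon (p : ℂ × ℕ) (g : LogPoly W) : logDeriv (mulMon p g)
    = p.1 • mulMon (p.1 - 1, p.2) g + (p.2 : ℂ) • mulMon (p.1 - 1, p.2 - 1) g
      + mulMon p (logDeriv g) := by
  induction g using Finsupp.induction_linear with
  | zero => simp
  | add f g hf hg => simp only [map_add, hf, hg, smul_add]; abel
  | single q w =>
    obtain ⟨p₁, p₂⟩ := p
    obtain ⟨q₁, q₂⟩ := q
    simp only [mulMon_single, logDeriv_single, map_add, map_smul, Prod.mk_add_mk]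
    rw [show p₁ - 1 + q₁ = p₁ + q₁ - 1 by ring, show p₁ + (q₁ - 1) = p₁ + q₁ - 1 by ring]
    -- The truncated p₂ - 1 is wrong at p₂ = 0, where the coefficient vanishes; the same holds for
    -- q₂ below.
    have e1 : (p₂ : ℂ) • (Finsupp.single (p₁ + q₁ - 1, p₂ - 1 + q₂) w : LogPoly W)
        = (p₂ : ℂ) • Finsupp.single (p₁ + q₁ - 1, p₂ + q₂ - 1) w := by
      cases p₂ with
      | zero => simp
      | succ p₂ => rw [show p₂ + 1 - 1 + q₂ = p₂ + 1 + q₂ - 1 by omega]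
    have e2 : (q₂ : ℂ) • (Finsupp.single (p₁ + q₁ - 1, p₂ + (q₂ - 1)) w : LogPoly W)
        = (q₂ : ℂ) • Finsupp.single (p₁ + q₁ - 1, p₂ + q₂ - 1) w := by
      cases q₂ with
      | zero => simp
      | succ q₂ => rw [show p₂ + (q₂ + 1 - 1) = p₂ + (q₂ + 1) - 1 by omega]
    rw [e1, e2]
    push_cast
    module

theorem logDeriv_apply (T : W →ₗ[ℂ] LogPoly W') (g : LogPoly W) :
    logDeriv (LogPoly.apply T g)
      = LogPoly.apply T (logDeriv g) + LogPoly.apply (logDeriv ∘ₗ T) g := by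
  induction g using Finsupp.induction_linear with
  | zero => simp
  | add f g hf hg => simp only [map_add, hf, hg]; abel
  | single p w =>
    rw [LogPoly.apply_single, logDeriv_mulMon, logDeriv_single, LogPoly.apply_single, map_add,
      map_smul, map_smul, LogPoly.apply_single, LogPoly.apply_single, LinearMap.comp_apply]

/-- Finite sums of terms `u x^c (log x)^i` with `u ∈ q`. -/
noncomputable def homogPoly (c : ℂ) (q : Submodule ℂ W) : Submodule ℂ (LogPoly W) :=
  Submodule.span ℂ {g | ∃ (i : ℕ), ∃ u ∈ q, g = Finsupp.single (c, i) u}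

theorem single_mem_homogPoly {c : ℂ} {q : Submodule ℂ W} (i : ℕ) {u : W} (hu : u ∈ q) :
    (Finsupp.single (c, i) u : LogPoly W) ∈ homogPoly c q :=
  Submodule.subset_span ⟨i, u, hu, rfl⟩

theorem map_mem_of_mem_homogPoly {U : Type*} [AddCommGroup U] [Module ℂ U] {c : ℂ}
    {q : Submodule ℂ W} {g : LogPoly W} (hg : g ∈ homogPoly c q) {S : Submodule ℂ U}
    (T : LogPoly W →ₗ[ℂ] U) (h : ∀ i, ∀ u ∈ q, T (Finsupp.single (c, i) u) ∈ S) : T g ∈ S := by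
  have : homogPoly c q ≤ S.comap T := by
    refine Submodule.span_le.2 ?_
    rintro _ ⟨i, u, hu, rfl⟩
    exact h i u hu
  exact this hg

theorem mulMon_mem_homogPoly {c : ℂ} {q : Submodule ℂ W} {g : LogPoly W} (p : ℂ × ℕ)
    (hg : g ∈ homogPoly c q) : mulMon p g ∈ homogPoly (p.1 + c) q := by
  refine map_mem_of_mem_homogPoly hg _ fun i u hu => ?_
  rw [mulMon_single]
  exact single_mem_homogPoly _ hu

end LogPoly

/-! ### The operators `x^{-L(0)}` and `e^{aL(0)}` -/

section PowL0

variable {B V W : Type*} [AddCommGroup B] {A : AddSubgroup B} [AddCommGroup V] [Module ℂ V]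
  [AddCommGroup W] [Module ℂ W] {κ : Kind V} {D : VertexData A V} {M : ModData B V W}

theorem pow_smul_apply_eq_zero {N : Module.End ℂ W} {m : ℕ} {w : W} (c : ℂ) (h : (N ^ m) w = 0) :
    ((c • N) ^ m) w = 0 := by
  rw [smul_pow, LinearMap.smul_apply, h, smul_zero]

theorem xPowNegL0_of_mem_wt (hM : IsStronglyGradedModule κ D M) {n : ℂ} {w : W} (hw : w ∈ M.wt n)
    {m : ℕ} (hm : ((M.L 0 - n • 1) ^ m) w = 0) :
    xPowNegL0 hM w = ∑ i ∈ Finset.range m,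
      Finsupp.single (-n, i) (divPow ((-1 : ℂ) • (M.L 0 - n • 1)) i w) := by
  have h1 := hM.wt_directSum.lift_apply (fun n => Finsupp.lmapDomain W ℂ (fun i : ℕ => (-n, i)) ∘ₗ
    expSeries ((-1 : ℂ) • (M.L 0 - n • 1)) (M.wt n).subtype (wt_nilpotent M n (-1))) n ⟨w, hw⟩
  have h2 := expSeries_sum (j := (M.wt n).subtype) (h := wt_nilpotent M n (-1)) (s := ⟨w, hw⟩)
    (m := m) (pow_smul_apply_eq_zero (-1) hm) (fun i : ℕ => Finsupp.lsingle (R := ℂ) (-n, i))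
  refine h1.trans (Eq.trans ?_ h2)
  rw [LinearMap.comp_apply, Finsupp.lmapDomain_apply, Finsupp.lsum_apply]
  rfl

theorem expL0_of_mem_wt (hM : IsStronglyGradedModule κ D M) (a : ℂ) {n : ℂ} {w : W}
    (hw : w ∈ M.wt n) {m : ℕ} (hm : ((M.L 0 - n • 1) ^ m) w = 0) :
    expL0 hM a w = Complex.exp (a * n) •
      ∑ i ∈ Finset.range m, divPow (a • (M.L 0 - n • 1)) i w := by
  have h1 := hM.wt_directSum.lift_apply (fun n => Complex.exp (a * n) •
    (Finsupp.lsum ℂ (fun _ : ℕ => LinearMap.id) ∘ₗ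
      expSeries (a • (M.L 0 - n • 1)) (M.wt n).subtype (wt_nilpotent M n a))) n ⟨w, hw⟩
  have h2 := expSeries_sum (j := (M.wt n).subtype) (h := wt_nilpotent M n a) (s := ⟨w, hw⟩)
    (m := m) (pow_smul_apply_eq_zero a hm) (fun _ : ℕ => LinearMap.id)
  refine h1.trans ?_
  rw [LinearMap.smul_apply, LinearMap.comp_apply, h2]
  rfl

theorem divPow_shift {L₀ T : Module.End ℂ W} {d : ℂ}
    (hT : ∀ w, L₀ (T w) = T (L₀ w) + d • T w) (c n : ℂ) (i : ℕ) (w : W) :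
    divPow (c • (L₀ - (n + d) • 1)) i (T w) = T (divPow (c • (L₀ - n • 1)) i w) := by
  unfold divPow
  rw [LinearMap.smul_apply, LinearMap.smul_apply, map_smul]
  congr 1
  induction i generalizing w with
  | zero => simp
  | succ i ih =>
    rw [pow_succ, Module.End.mul_apply, pow_succ, Module.End.mul_apply, ← ih]
    congr 1
    simp only [LinearMap.smul_apply, LinearMap.sub_apply, Module.End.one_apply, map_smul, map_sub]
    rw [hT]
    module

theorem sub_pow_shift {L₀ T : Module.End ℂ W} {d : ℂ}
    (hT : ∀ w, L₀ (T w) = T (L₀ w) + d • T w) (n : ℂ) (i : ℕ) (w : W) :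
    ((L₀ - (n + d) • 1) ^ i) (T w) = T (((L₀ - n • 1) ^ i) w) := by
  induction i generalizing w with
  | zero => simp
  | succ i ih =>
    rw [pow_succ, Module.End.mul_apply, pow_succ, Module.End.mul_apply, ← ih]
    congr 1
    simp only [LinearMap.smul_apply, LinearMap.sub_apply, Module.End.one_apply, map_smul, map_sub]
    rw [hT]
    module

set_option linter.unusedSectionVars false in
theorem shift_mem_wt {T : Module.End ℂ W} {d : ℂ}
    (hT : ∀ w, M.L 0 (T w) = T (M.L 0 w) + d • T w) {n : ℂ} {w : W} (hw : w ∈ M.wt n) :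
    T w ∈ M.wt (n + d) := by
  refine mem_maxGenEigenspace_of_shift (fun u => ?_) hw
  rw [hT, map_sub, map_smul]
  module

/-- An operator of degree d carries L(0) - n into L(0) - (n + d), so the nilpotent exponential
passes through it and only the power of x changes. -/
theorem xPowNegL0_shift (hM : IsStronglyGradedModule κ D M) {T : Module.End ℂ W} {d : ℂ}
    (hT : ∀ w, M.L 0 (T w) = T (M.L 0 w) + d • T w) (w : W) :
    xPowNegL0 hM (T w) = mulMon (-d, 0) (coeffwise T (xPowNegL0 hM w)) := by
  suffices xPowNegL0 hM ∘ₗ T = mulMon (-d, 0) ∘ₗ coeffwise T ∘ₗ xPowNegL0 hM from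
    LinearMap.congr_fun this w
  refine hM.wt_directSum.hom_ext fun n w hw => ?_
  obtain ⟨m, hm⟩ := (Module.End.mem_maxGenEigenspace _ _ _).1 hw
  simp only [LinearMap.comp_apply]
  rw [xPowNegL0_of_mem_wt hM hw hm, xPowNegL0_of_mem_wt hM (shift_mem_wt hT hw) (m := m)
    (by rw [sub_pow_shift hT, hm, map_zero]), map_sum, map_sum]
  refine Finset.sum_congr rfl fun i _ => ?_
  rw [coeffwise_single, mulMon_single, divPow_shift hT, Prod.mk_add_mk, zero_add,
    show -(n + d) = -d + -n by ring]

theorem expL0_shift (hM : IsStronglyGradedModule κ D M) (a : ℂ) {T : Module.End ℂ W} {d : ℂ}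
    (hT : ∀ w, M.L 0 (T w) = T (M.L 0 w) + d • T w) (w : W) :
    expL0 hM a (T w) = Complex.exp (a * d) • T (expL0 hM a w) := by
  suffices expL0 hM a ∘ₗ T = Complex.exp (a * d) • T ∘ₗ expL0 hM a from
    LinearMap.congr_fun this w
  refine hM.wt_directSum.hom_ext fun n w hw => ?_
  obtain ⟨m, hm⟩ := (Module.End.mem_maxGenEigenspace _ _ _).1 hw
  simp only [LinearMap.comp_apply, LinearMap.smul_apply]
  rw [expL0_of_mem_wt hM a hw hm, expL0_of_mem_wt hM a (shift_mem_wt hT hw) (m := m)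
    (by rw [sub_pow_shift hT, hm, map_zero]), map_smul, map_sum, smul_smul, ← Complex.exp_add,
    show a * (n + d) = a * d + a * n by ring]
  congr 1
  refine Finset.sum_congr rfl fun i _ => ?_
  rw [divPow_shift hT]

set_option linter.unusedSectionVars false in
theorem L_zero_shift_zero (M : ModData B V W) (w : W) :
    M.L 0 (M.L 0 w) = M.L 0 (M.L 0 w) + (0 : ℂ) • M.L 0 w := by simp

theorem expL0_comm (hM : IsStronglyGradedModule κ D M) (a : ℂ) (w : W) :
    expL0 hM a (M.L 0 w) = M.L 0 (expL0 hM a w) := by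
  rw [expL0_shift hM a (L_zero_shift_zero M)]
  simp

/-- This is d/dx x^{-L(0)} = -x⁻¹L(0)x^{-L(0)}: differentiating x^{-n} gives the semisimple part and
differentiating the powers of log x gives the nilpotent part. -/
theorem logDeriv_xPowNegL0 (hM : IsStronglyGradedModule κ D M) (w : W) :
    logDeriv (xPowNegL0 hM w)
      = (-1 : ℂ) • mulMon (-1, 0) (coeffwise (M.L 0) (xPowNegL0 hM w)) := by
  suffices logDeriv ∘ₗ xPowNegL0 hM
      = (-1 : ℂ) • mulMon (-1, 0) ∘ₗ coeffwise (M.L 0) ∘ₗ xPowNegL0 hM from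
    LinearMap.congr_fun this w
  refine hM.wt_directSum.hom_ext fun n w hw => ?_
  obtain ⟨m, hm⟩ := (Module.End.mem_maxGenEigenspace _ _ _).1 hw
  simp only [LinearMap.comp_apply, LinearMap.smul_apply]
  rw [xPowNegL0_of_mem_wt hM hw hm]
  set N := (-1 : ℂ) • (M.L 0 - n • 1) with hN
  have hL : ∀ u, M.L 0 u = n • u - N u := by
    intro u
    rw [hN]
    simp only [LinearMap.smul_apply, LinearMap.sub_apply, Module.End.one_apply]
    module
  simp only [map_sum, coeffwise_single, mulMon_single, logDeriv_single, Prod.mk_add_mk, zero_add]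
  have e1 : ∀ i, (Finsupp.single (-1 + -n, i) (M.L 0 (divPow N i w)) : LogPoly W)
      = n • Finsupp.single (-n - 1, i) (divPow N i w)
        - ((i : ℂ) + 1) • Finsupp.single (-n - 1, i) (divPow N (i + 1) w) := by
    intro i
    rw [hL, apply_divPow, Finsupp.single_sub, Finsupp.smul_single, Finsupp.smul_single,
      show -1 + -n = -n - 1 by ring]
  simp only [e1]
  -- Reindexing i ↦ i + 1: the term i = 0 has coefficient 0, and the new top term vanishes because
  -- the m-th power of the nilpotent part kills w.
  have e2 : ∑ i ∈ Finset.range m, (i : ℂ) •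
        (Finsupp.single (-n - 1, i - 1) (divPow N i w) : LogPoly W)
      = ∑ i ∈ Finset.range m, ((i : ℂ) + 1) •
        (Finsupp.single (-n - 1, i) (divPow N (i + 1) w) : LogPoly W) := by
    have e3 := Finset.sum_range_succ (fun i : ℕ => (i : ℂ) •
        (Finsupp.single (-n - 1, i - 1) (divPow N i w) : LogPoly W)) m
    rw [divPow_eq_zero (pow_smul_apply_eq_zero (-1) hm) le_rfl, Finset.sum_range_succ'] at e3
    simpa using e3.symm
  rw [Finset.sum_add_distrib, e2, Finset.smul_sum, ← Finset.sum_add_distrib]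
  refine Finset.sum_congr rfl fun i _ => ?_
  module

set_option linter.unusedSectionVars false in
theorem sub_pow_mem {q : Submodule ℂ W} (hL : ∀ w ∈ q, M.L 0 w ∈ q) (c n : ℂ) {w : W}
    (hw : w ∈ q) (i : ℕ) : ((c • (M.L 0 - n • 1)) ^ i) w ∈ q := by
  induction i with
  | zero => simpa using hw
  | succ i ih =>
    rw [pow_succ', Module.End.mul_apply]
    exact Submodule.smul_mem _ _ (Submodule.sub_mem _ (hL _ ih) (Submodule.smul_mem _ _ ih))

theorem xPowNegL0_mem_homogPoly (hM : IsStronglyGradedModule κ D M) {n : ℂ} {q : Submodule ℂ W}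
    (hq : q ≤ M.wt n) (hL : ∀ w ∈ q, M.L 0 w ∈ q) {w : W} (hw : w ∈ q) :
    xPowNegL0 hM w ∈ homogPoly (-n) q := by
  obtain ⟨m, hm⟩ := (Module.End.mem_maxGenEigenspace _ _ _).1 (hq hw)
  rw [xPowNegL0_of_mem_wt hM (hq hw) hm]
  refine Submodule.sum_mem _ fun i _ => single_mem_homogPoly _ (Submodule.smul_mem _ _ ?_)
  exact sub_pow_mem hL _ _ hw i

theorem expL0_mem (hM : IsStronglyGradedModule κ D M) (a : ℂ) {n : ℂ} {q : Submodule ℂ W}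
    (hq : q ≤ M.wt n) (hL : ∀ w ∈ q, M.L 0 w ∈ q) {w : W} (hw : w ∈ q) :
    expL0 hM a w ∈ q := by
  obtain ⟨m, hm⟩ := (Module.End.mem_maxGenEigenspace _ _ _).1 (hq hw)
  rw [expL0_of_mem_wt hM a (hq hw) hm]
  refine Submodule.smul_mem _ _ (Submodule.sum_mem _ fun i _ => Submodule.smul_mem _ _ ?_)
  exact sub_pow_mem hL _ _ hw i

/-! ### The operator `e^{(2r+1)πi L(0)} (x^{-L(0)})²` -/

/-- `e^{(2r+1)πi L(0)} (x^{-L(0)})² w`. -/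
noncomputable def scalingArg (hM : IsStronglyGradedModule κ D M) (r : ℤ) : W →ₗ[ℂ] LogPoly W :=
  coeffwise (expL0 hM ((2 * r + 1) * Real.pi * Complex.I)) ∘ₗ
    LogPoly.apply (xPowNegL0 hM) ∘ₗ xPowNegL0 hM

theorem contragredientArg_eq (hM : IsStronglyGradedModule κ D M) (r : ℤ) (w : W) :
    contragredientArg hM r w = LogPoly.apply (expXL1 hM) (scalingArg hM r w) := rfl

/-- This is why odd multiples of πi occur: on integral weight differences each of them gives the
sign (-1)^d, independently of r. -/
theorem exp_odd_pi_mul_int (r d : ℤ) :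
    Complex.exp ((2 * r + 1) * Real.pi * Complex.I * d) = (-1) ^ d := by
  rw [show ((2 * r + 1) * Real.pi * Complex.I * d : ℂ)
      = d * (Real.pi * Complex.I + r * (2 * Real.pi * Complex.I)) by ring,
    Complex.exp_int_mul, Complex.exp_add, Complex.exp_pi_mul_I, Complex.exp_int_mul_two_pi_mul_I,
    mul_one]

/-- Relative to integral shifts of weight the scaling behaves like (-x⁻²)^{L(0)}, although
individual weights are arbitrary complex numbers and L(0) need not be semisimple. The Jacobi
identity and brackets need nothing else of it. -/
theorem scalingArg_shift (hM : IsStronglyGradedModule κ D M) (r : ℤ) {T : Module.End ℂ W} {d : ℤ}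
    (hT : ∀ w, M.L 0 (T w) = T (M.L 0 w) + (d : ℂ) • T w) (w : W) :
    scalingArg hM r (T w)
      = ((-1 : ℂ) ^ d) • mulMon (-(2 * d : ℂ), 0) (coeffwise T (scalingArg hM r w)) := by
  unfold scalingArg
  simp only [LinearMap.comp_apply]
  have e : ∀ g : LogPoly W, coeffwise (expL0 hM ((2 * r + 1) * Real.pi * Complex.I)) (coeffwise T g)
      = ((-1 : ℂ) ^ d) • coeffwise T (coeffwise (expL0 hM ((2 * r + 1) * Real.pi * Complex.I)) g) := by
    intro g
    ext p
    simp only [Finsupp.mapRange.linearMap_apply, Finsupp.mapRange_apply, Finsupp.smul_apply]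
    rw [expL0_shift hM _ hT, exp_odd_pi_mul_int]
  rw [xPowNegL0_shift hM hT, LogPoly.apply_mulMon, LogPoly.apply_coeffwise (xPowNegL0_shift hM hT),
    mulMon_mulMon, coeffwise_mulMon, e, map_smul, Prod.mk_add_mk, add_zero,
    show -(d : ℂ) + -d = -(2 * d) by ring]

theorem logDeriv_scalingArg (hM : IsStronglyGradedModule κ D M) (r : ℤ) (w : W) :
    logDeriv (scalingArg hM r w)
      = (-2 : ℂ) • mulMon (-1, 0) (coeffwise (M.L 0) (scalingArg hM r w)) := by
  unfold scalingArg
  simp only [LinearMap.comp_apply]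
  have e : ∀ g : LogPoly W, coeffwise (expL0 hM ((2 * r + 1) * Real.pi * Complex.I))
      (coeffwise (M.L 0) g)
      = coeffwise (M.L 0) (coeffwise (expL0 hM ((2 * r + 1) * Real.pi * Complex.I)) g) := by
    intro g
    ext p
    simp only [Finsupp.mapRange.linearMap_apply, Finsupp.mapRange_apply]
    rw [expL0_comm]
  have h0 : ∀ w, xPowNegL0 hM (M.L 0 w) = mulMon 0 (coeffwise (M.L 0) (xPowNegL0 hM w)) := by
    intro w
    have := xPowNegL0_shift hM (L_zero_shift_zero M) w
    rwa [neg_zero] at this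
  have h1 : ∀ g : LogPoly W, LogPoly.apply (logDeriv ∘ₗ xPowNegL0 hM) g
      = (-1 : ℂ) • mulMon (-1, 0) (coeffwise (M.L 0) (LogPoly.apply (xPowNegL0 hM) g)) := by
    intro g
    induction g using Finsupp.induction_linear with
    | zero => simp
    | add f g hf hg => simp only [map_add, hf, hg, smul_add]
    | single p w =>
      rw [LogPoly.apply_single, LogPoly.apply_single, LinearMap.comp_apply, logDeriv_xPowNegL0,
        map_smul, coeffwise_mulMon, mulMon_mulMon, mulMon_mulMon, add_comm]
  rw [← coeffwise_logDeriv, logDeriv_apply, h1, logDeriv_xPowNegL0, map_smul, LogPoly.apply_mulMon,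
    LogPoly.apply_coeffwise h0, mulMon_zero, ← add_smul, map_smul, coeffwise_mulMon, e]
  norm_num

theorem scalingArg_mem_homogPoly (hM : IsStronglyGradedModule κ D M) (r : ℤ) {n : ℂ} {β : B}
    {w : W} (hw : w ∈ M.wt n ⊓ M.gr β) :
    scalingArg hM r w ∈ homogPoly (-(2 * n)) (M.wt n ⊓ M.gr β) := by
  have hq : M.wt n ⊓ M.gr β ≤ M.wt n := inf_le_left
  have hL : ∀ w ∈ M.wt n ⊓ M.gr β, M.L 0 w ∈ M.wt n ⊓ M.gr β := by
    intro w hw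
    refine ⟨?_, hM.L_mem 0 β w hw.2⟩
    simpa using ModData.L_mem_wt hM.sl2 0 hw.1
  refine map_mem_of_mem_homogPoly (xPowNegL0_mem_homogPoly hM hq hL hw)
    (coeffwise (expL0 hM ((2 * r + 1) * Real.pi * Complex.I)) ∘ₗ LogPoly.apply (xPowNegL0 hM))
    fun i u hu => ?_
  rw [LinearMap.comp_apply, LogPoly.apply_single]
  have h1 := mulMon_mem_homogPoly (-n, i) (xPowNegL0_mem_homogPoly hM hq hL hu)
  rw [show -n + -n = -(2 * n) by ring] at h1
  refine map_mem_of_mem_homogPoly h1 _ fun j u hu => ?_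
  rw [coeffwise_single]
  exact single_mem_homogPoly j (expL0_mem hM _ hq hL hu)

end PowL0

/-! ### Components of a logarithmic intertwining operator at `x⁻¹` -/

section LogComponent

variable {B V W₁ W₂ W₃ : Type*} [AddCommGroup V] [Module ℂ V]
  [AddCommGroup W₁] [Module ℂ W₁] [AddCommGroup W₂] [Module ℂ W₂] [AddCommGroup W₃] [Module ℂ W₃]

/-- The components `(w₁)_{n;k} w₂`, as multilinear maps. -/
noncomputable def componentHom (𝒴 : W₁ →ₗ[ℂ] W₂ →ₗ[ℂ] LogSeries W₃) (k : ℕ) :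
    W₁ →ₗ[ℂ] ℂ → W₂ →ₗ[ℂ] W₃ :=
  LinearMap.pi fun n => 𝒴.compr₂ (LogSeries.coeff (-n - 1) k)

theorem componentHom_apply (𝒴 : W₁ →ₗ[ℂ] W₂ →ₗ[ℂ] LogSeries W₃) (k : ℕ) (w₁ : W₁) (n : ℂ)
    (w₂ : W₂) : componentHom 𝒴 k w₁ n w₂ = component 𝒴 k w₁ n w₂ := rfl

/-- The coefficient of `x^{-n-1} (log x)ᵏ` in `𝒴(e^{xN} g(x), x⁻¹)`. -/
noncomputable def logComponent (N : Module.End ℂ W₁) (hN : ∀ w, ∃ m : ℕ, (N ^ m) w = 0)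
    (𝒴 : W₁ →ₗ[ℂ] W₂ →ₗ[ℂ] LogSeries W₃) (n : ℂ) (k : ℕ) : LogPoly W₁ →ₗ[ℂ] W₂ →ₗ[ℂ] W₃ :=
  Finsupp.lsum ℂ fun p : ℂ × ℕ => if p.2 ≤ k then ((-1 : ℂ) ^ (k - p.2)) •
    (LinearMap.proj (n + p.1) ∘ₗ oppComponent N hN (componentHom 𝒴 (k - p.2))) else 0

section

variable {N : Module.End ℂ W₁} {hN : ∀ w, ∃ m : ℕ, (N ^ m) w = 0}
  {𝒴 : W₁ →ₗ[ℂ] W₂ →ₗ[ℂ] LogSeries W₃}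

theorem logComponent_single_of_le (n : ℂ) {k : ℕ} {p : ℂ × ℕ} (h : p.2 ≤ k) (w : W₁) :
    logComponent N hN 𝒴 n k (Finsupp.single p w)
      = ((-1 : ℂ) ^ (k - p.2)) • oppComponent N hN (componentHom 𝒴 (k - p.2)) w (n + p.1) := by
  simp [logComponent, h]

theorem logComponent_single_of_lt (n : ℂ) {k : ℕ} {p : ℂ × ℕ} (h : k < p.2) (w : W₁) :
    logComponent N hN 𝒴 n k (Finsupp.single p w) = 0 := by
  simp [logComponent, not_le.2 h]

theorem logComponent_mulMon (n c : ℂ) (k : ℕ) (g : LogPoly W₁) :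
    logComponent N hN 𝒴 n k (mulMon (c, 0) g) = logComponent N hN 𝒴 (n + c) k g := by
  induction g using Finsupp.induction_linear with
  | zero => simp
  | add f g hf hg => simp only [map_add, hf, hg]
  | single p w =>
    obtain ⟨p, q⟩ := p
    rw [mulMon_single, Prod.mk_add_mk, zero_add]
    rcases le_or_gt q k with h | h
    · rw [logComponent_single_of_le _ h, logComponent_single_of_le _ h, add_assoc]
    · rw [logComponent_single_of_lt _ h, logComponent_single_of_lt _ h]

theorem evalAtInv_single (p : ℂ × ℕ) (w : W₁) (w₂ : W₂) : evalAtInv 𝒴 (Finsupp.single p w) w₂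
    = LogSeries.mulMonomial p (LogSeries.substInv (𝒴 w w₂)) := by
  simp [evalAtInv]

/-- Links the definition of A_r to components. The sign (-1)^{k-q} arises because log x ↦ -log x
affects the logarithms of 𝒴 but not the q logarithms already in g. -/
theorem evalAtInv_apply_expXL1 {B : Type*} [AddCommGroup B] {A : AddSubgroup B} {κ : Kind V}
    {D : VertexData A V} {M₁ : ModData B V W₁} (h₁ : IsStronglyGradedModule κ D M₁)
    (g : LogPoly W₁) (w₂ : W₂) (n : ℂ) (k : ℕ) :
    evalAtInv 𝒴 (LogPoly.apply (expXL1 h₁) g) w₂ (-n - 1) k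
      = logComponent (M₁.L 1) h₁.L_one_nilpotent 𝒴 n k g w₂ := by
  have key : ∀ (p : ℂ × ℕ) (h : ℕ →₀ W₁),
      evalAtInv 𝒴 (mulMon p (Finsupp.lmapDomain W₁ ℂ (fun i : ℕ => ((i : ℂ), 0)) h)) w₂ (-n - 1) k
        = if p.2 ≤ k then ((-1 : ℂ) ^ (k - p.2)) •
          seriesComponent (componentHom 𝒴 (k - p.2)) (n + p.1) h w₂ else 0 := by
    intro p h
    induction h using Finsupp.induction_linear with
    | zero => simp
    | add f g hf hg =>
      simp only [map_add, LinearMap.add_apply, Pi.add_apply, hf, hg]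
      split_ifs <;> simp
    | single s w =>
      rw [Finsupp.lmapDomain_apply, Finsupp.mapDomain_single, mulMon_single, evalAtInv_single,
        seriesComponent_single, componentHom_apply]
      obtain ⟨p, q⟩ := p
      change (if q + 0 ≤ k then
          ((-1 : ℂ) ^ (k - (q + 0))) • 𝒴 w w₂ (-(-n - 1 - (p + s))) (k - (q + 0)) else 0)
        = if q ≤ k then ((-1 : ℂ) ^ (k - q)) • 𝒴 w w₂ (-(-(n + p) - 2 - s) - 1) (k - q) else 0
      rw [add_zero, show -(-n - 1 - (p + s)) = -(-(n + p) - 2 - s) - 1 by ring]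
  induction g using Finsupp.induction_linear with
  | zero => simp
  | add f g hf hg => simp only [map_add, LinearMap.add_apply, Pi.add_apply, hf, hg]
  | single p w =>
    rw [LogPoly.apply_single]
    refine (key p _).trans ?_
    rcases le_or_gt p.2 k with h | h
    · rw [logComponent_single_of_le _ h, if_pos h]; rfl
    · rw [logComponent_single_of_lt _ h, if_neg (not_le.2 h)]; rfl

end

variable {M₁ : ModData B V W₁} {M₂ : ModData B V W₂} {M₃ : ModData B V W₃}
  {𝒴 : W₁ →ₗ[ℂ] W₂ →ₗ[ℂ] LogSeries W₃} {hN : ∀ w, ∃ m : ℕ, ((M₁.L 1) ^ m) w = 0}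

theorem IsLogIntertwining.componentHom_L_neg_one (h : IsLogIntertwining M₁ M₂ M₃ 𝒴) (k : ℕ)
    (w : W₁) (n : ℂ) : componentHom 𝒴 k (M₁.L (-1) w) n = (-n) • componentHom 𝒴 k w (n - 1)
      + (((k : ℂ) + 1) • componentHom 𝒴 (k + 1)) w (n - 1) := by
  ext w₂
  have := congrFun (congrFun (h.derivative w w₂) (-n - 1)) k
  refine this.trans ?_
  change (-n - 1 + 1) • 𝒴 w w₂ (-n - 1 + 1) k + ((k : ℂ) + 1) • 𝒴 w w₂ (-n - 1 + 1) (k + 1)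
    = (-n) • 𝒴 w w₂ (-(n - 1) - 1) k + ((k : ℂ) + 1) • 𝒴 w w₂ (-(n - 1) - 1) (k + 1)
  rw [show -n - 1 + 1 = -n by ring, show -(n - 1) - 1 = -n by ring]

theorem logComponent_bracket_one (hL : Sl2Relations M₁.L) (h : IsLogIntertwining M₁ M₂ M₃ 𝒴)
    (n : ℂ) (k : ℕ) (g : LogPoly W₁) (w₂ : W₂) :
    M₃.L 1 (logComponent (M₁.L 1) hN 𝒴 n k g w₂) - logComponent (M₁.L 1) hN 𝒴 n k g (M₂.L 1 w₂)
      = logComponent (M₁.L 1) hN 𝒴 (n - 2) k (coeffwise (M₁.L (-1)) g) w₂ := by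
  induction g using Finsupp.induction_linear with
  | zero => simp
  | add f g hf hg =>
    simp only [map_add, LinearMap.add_apply]
    rw [add_sub_add_comm, hf, hg]
  | single p w =>
    rw [coeffwise_single]
    rcases le_or_gt p.2 k with hp | hp
    · simp only [logComponent_single_of_le _ hp, LinearMap.smul_apply, map_smul]
      rw [← smul_sub, oppComponent_bracket_one hL (h.bracket (k - p.2)),
        show n - 2 + p.1 = n + p.1 - 2 by ring]
    · simp [logComponent_single_of_lt _ hp]

theorem logComponent_bracket_zero (hL : Sl2Relations M₁.L) (h : IsLogIntertwining M₁ M₂ M₃ 𝒴)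
    (n : ℂ) (k : ℕ) (g : LogPoly W₁) (w₂ : W₂) :
    M₃.L 0 (logComponent (M₁.L 1) hN 𝒴 n k g w₂) - logComponent (M₁.L 1) hN 𝒴 n k g (M₂.L 0 w₂)
      = logComponent (M₁.L 1) hN 𝒴 (n - 1) k (coeffwise (M₁.L (-1)) g) w₂
        - logComponent (M₁.L 1) hN 𝒴 n k (coeffwise (M₁.L 0) g) w₂ := by
  induction g using Finsupp.induction_linear with
  | zero => simp
  | add f g hf hg =>
    simp only [map_add, LinearMap.add_apply]
    rw [add_sub_add_comm, hf, hg]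
    abel
  | single p w =>
    rw [coeffwise_single, coeffwise_single]
    rcases le_or_gt p.2 k with hp | hp
    · simp only [logComponent_single_of_le _ hp, LinearMap.smul_apply, map_smul]
      rw [← smul_sub, oppComponent_bracket_zero hL (h.bracket (k - p.2)), smul_sub,
        show n - 1 + p.1 = n + p.1 - 1 by ring]
    · simp [logComponent_single_of_lt _ hp]

theorem logComponent_bracket_neg_one (hL : Sl2Relations M₁.L) (h : IsLogIntertwining M₁ M₂ M₃ 𝒴)
    (n : ℂ) (k : ℕ) (g : LogPoly W₁) (w₂ : W₂) :
    M₃.L (-1) (logComponent (M₁.L 1) hN 𝒴 n k g w₂)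
        - logComponent (M₁.L 1) hN 𝒴 n k g (M₂.L (-1) w₂)
      = logComponent (M₁.L 1) hN 𝒴 n k (coeffwise (M₁.L (-1)) g) w₂
        - (2 : ℂ) • logComponent (M₁.L 1) hN 𝒴 (n + 1) k (coeffwise (M₁.L 0) g) w₂
        + logComponent (M₁.L 1) hN 𝒴 (n + 2) k (coeffwise (M₁.L 1) g) w₂ := by
  induction g using Finsupp.induction_linear with
  | zero => simp
  | add f g hf hg =>
    simp only [map_add, LinearMap.add_apply, smul_add]
    rw [add_sub_add_comm, hf, hg]
    abel
  | single p w =>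
    rw [coeffwise_single, coeffwise_single, coeffwise_single]
    rcases le_or_gt p.2 k with hp | hp
    · simp only [logComponent_single_of_le _ hp, LinearMap.smul_apply, map_smul]
      rw [← smul_sub, oppComponent_bracket_neg_one hL (h.bracket (k - p.2)), smul_add, smul_sub,
        smul_comm (2 : ℂ), show n + 1 + p.1 = n + p.1 + 1 by ring,
        show n + 2 + p.1 = n + p.1 + 2 by ring]
    · simp [logComponent_single_of_lt _ hp]

theorem oppComponent_smul (N : Module.End ℂ W₁) (hN : ∀ w, ∃ m : ℕ, (N ^ m) w = 0) (c : ℂ)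
    (I : W₁ →ₗ[ℂ] ℂ → W₂ →ₗ[ℂ] W₃) (w : W₁) (n : ℂ) :
    oppComponent N hN (c • I) w n = c • oppComponent N hN I w n := by
  obtain ⟨m, hm⟩ := hN w
  rw [oppComponent_eq_sum _ hm, oppComponent_eq_sum _ hm, Finset.smul_sum]
  rfl

/-- The chain rule for 𝒴(e^{xL(1)}g(x), x⁻¹). Differentiating x⁻¹ brings -x⁻²L(-1); commuting it
past e^{xL(1)} gives 2x⁻¹L(0) and a term -L(1), which cancels the derivative of e^{xL(1)}. -/
theorem logComponent_derivative (hL : Sl2Relations M₁.L) (h : IsLogIntertwining M₁ M₂ M₃ 𝒴)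
    (n : ℂ) (k : ℕ) (g : LogPoly W₁) :
    (-n) • logComponent (M₁.L 1) hN 𝒴 (n - 1) k g
        + ((k : ℂ) + 1) • logComponent (M₁.L 1) hN 𝒴 (n - 1) (k + 1) g
      = logComponent (M₁.L 1) hN 𝒴 n k (logDeriv g)
        - logComponent (M₁.L 1) hN 𝒴 (n - 2) k (coeffwise (M₁.L (-1)) g)
        + (2 : ℂ) • logComponent (M₁.L 1) hN 𝒴 (n - 1) k (coeffwise (M₁.L 0) g) := by
  induction g using Finsupp.induction_linear with
  | zero => simp
  | add f g hf hg =>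
    simp only [map_add, smul_add]
    rw [add_add_add_comm, hf, hg]
    abel
  | single p w =>
    obtain ⟨p, q⟩ := p
    rw [coeffwise_single, coeffwise_single, logDeriv_single, map_add, map_smul, map_smul]
    rcases le_or_gt q k with hp | hp
    · obtain ⟨j, rfl⟩ := Nat.exists_eq_add_of_le hp
      have h1 := oppComponent_derivative (hN := hN) (RingHom.id ℂ) hL
        (h.componentHom_L_neg_one j) w (n + p)
      rw [oppComponent_smul, RingHom.id_apply] at h1
      -- The factor q removes the case q = 0, in which the truncated q - 1 would be wrong.
      have h2 : (q : ℂ) • logComponent (M₁.L 1) hN 𝒴 n (q + j) (Finsupp.single (p - 1, q - 1) w)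
          = (q : ℂ) • ((-1 : ℂ) ^ (j + 1)) •
            oppComponent (M₁.L 1) hN (componentHom 𝒴 (j + 1)) w (n + p - 1) := by
        cases q with
        | zero => simp
        | succ q =>
          rw [logComponent_single_of_le _ (show (p - 1, q + 1 - 1).2 ≤ q + 1 + j by dsimp; omega)]
          dsimp only
          rw [show q + 1 + j - (q + 1 - 1) = j + 1 by omega, add_sub_assoc]
      rw [h2, logComponent_single_of_le _ (show (p, q).2 ≤ q + j by dsimp; omega),
        logComponent_single_of_le _ (show (p, q).2 ≤ q + j + 1 by dsimp; omega),
        logComponent_single_of_le _ (show (p - 1, q).2 ≤ q + j by dsimp; omega),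
        logComponent_single_of_le _ (show (p, q).2 ≤ q + j by dsimp; omega),
        logComponent_single_of_le _ (show (p, q).2 ≤ q + j by dsimp; omega)]
      dsimp only
      rw [show q + j + 1 - q = j + 1 by omega, show q + j - q = j by omega,
        show n - 2 + p = n + p - 2 by ring, show n - 1 + p = n + p - 1 by ring,
        show n + (p - 1) = n + p - 1 by ring, h1]
      push_cast
      simp only [pow_succ]
      module
    · rw [logComponent_single_of_lt _ (show k < (p, q).2 from hp),
        logComponent_single_of_lt _ (show k < (p, q).2 from hp),
        logComponent_single_of_lt _ (show k < (p, q).2 from hp),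
        logComponent_single_of_lt _ (show k < (p - 1, q).2 from hp)]
      -- At q = k + 1 the only surviving terms on both sides come from differentiating (log x)^q;
      -- for larger q there are none.
      rcases Nat.eq_or_lt_of_le (Nat.succ_le_of_lt hp) with hq | hq
      · subst hq
        rw [logComponent_single_of_le _ (show (p, k.succ).2 ≤ k + 1 from le_rfl),
          logComponent_single_of_le _ (show (p - 1, k.succ - 1).2 ≤ k from le_rfl)]
        dsimp only
        rw [show k + 1 - k.succ = 0 by omega, show k - (k.succ - 1) = 0 by omega,
          show n - 1 + p = n + (p - 1) by ring]
        push_cast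
        module
      · rw [logComponent_single_of_lt _ (show k + 1 < (p, q).2 from hq),
          logComponent_single_of_lt _ (show k < (p - 1, q - 1).2 by dsimp; omega)]
        simp

theorem exists_logComponent_eq_zero (h : IsLogIntertwining M₁ M₂ M₃ 𝒴) (n : ℂ) (g : LogPoly W₁)
    (w₂ : W₂) : ∃ K : ℕ, ∀ k ≥ K, logComponent (M₁.L 1) hN 𝒴 n k g w₂ = 0 := by
  have hlog : ∀ w₁ (n : ℂ), ∃ K : ℕ, ∀ k ≥ K, componentHom 𝒴 k w₁ n w₂ = 0 := by
    intro w₁ n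
    obtain ⟨K, hK⟩ := (h.isLogPolynomial w₁ w₂ (-n - 1)).bddAbove
    refine ⟨K + 1, fun k hk => ?_⟩
    by_contra hne
    have := hK hne
    omega
  induction g using Finsupp.induction_linear with
  | zero => exact ⟨0, by simp⟩
  | add f g hf hg =>
    obtain ⟨K, hK⟩ := hf
    obtain ⟨K', hK'⟩ := hg
    exact ⟨max K K', fun k hk => by
      rw [map_add, LinearMap.add_apply, hK k (le_of_max_le_left hk), hK' k (le_of_max_le_right hk),
        add_zero]⟩
  | single p w =>
    obtain ⟨m, hm⟩ := hN w
    choose K hK using fun s : ℕ => hlog (divPow (M₁.L 1) s w) (-(n + p.1) - 2 - s)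
    refine ⟨p.2 + (Finset.range m).sup K, fun k hk => ?_⟩
    rw [logComponent_single_of_le _ (by omega), oppComponent_eq_sum _ hm, LinearMap.smul_apply,
      LinearMap.sum_apply, Finset.sum_eq_zero, smul_zero]
    intro s hs
    refine hK s _ ?_
    have := Finset.le_sup (f := K) hs
    omega

/-- L(0) minus the expected weight sends a component to three others: w₂ one nilpotent step further,
w₁ one step further, or k raised by one. The process terminates because both nilpotency orders are
finite and 𝒴(w₁,x)w₂ has finitely many logarithms at each power of x. -/
theorem component_mem_wt (h : IsLogIntertwining M₁ M₂ M₃ 𝒴) {a b : ℂ} {w₁ : W₁} {w₂ : W₂}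
    (hw₁ : w₁ ∈ M₁.wt a) (hw₂ : w₂ ∈ M₂.wt b) (n : ℂ) (k : ℕ) :
    componentHom 𝒴 k w₁ n w₂ ∈ M₃.wt (a + b - n - 1) := by
  obtain ⟨i, hi⟩ := (Module.End.mem_maxGenEigenspace _ _ _).1 hw₁
  obtain ⟨j, hj⟩ := (Module.End.mem_maxGenEigenspace _ _ _).1 hw₂
  clear hw₁ hw₂
  have hL : ∀ w₁ w₂ k, M₃.L 0 (componentHom 𝒴 k w₁ n w₂)
        - (a + b - n - 1) • componentHom 𝒴 k w₁ n w₂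
      = componentHom 𝒴 k w₁ n ((M₂.L 0 - b • 1) w₂) + componentHom 𝒴 k ((M₁.L 0 - a • 1) w₁) n w₂
        + ((k : ℂ) + 1) • componentHom 𝒴 (k + 1) w₁ n w₂ := by
    intro w₁ w₂ k
    have h1 : M₃.L 0 (componentHom 𝒴 k w₁ n w₂) - componentHom 𝒴 k w₁ n (M₂.L 0 w₂)
        = componentHom 𝒴 k (M₁.L 0 w₁) n w₂ + componentHom 𝒴 k (M₁.L (-1) w₁) (n + 1) w₂ :=
      (h.bracket k w₁ n w₂).2.1
    rw [h.componentHom_L_neg_one, sub_eq_iff_eq_add] at h1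
    rw [h1]
    simp only [LinearMap.sub_apply, LinearMap.smul_apply, Module.End.one_apply, map_sub, map_smul,
      Pi.sub_apply, Pi.smul_apply, LinearMap.add_apply, add_sub_cancel_right]
    module
  induction i generalizing w₁ w₂ j k with
  | zero =>
    rw [pow_zero, Module.End.one_apply] at hi
    rw [hi]
    simp
  | succ i ihi =>
    induction j generalizing w₂ k with
    | zero =>
      rw [pow_zero, Module.End.one_apply] at hj
      rw [hj]
      simp
    | succ j ihj =>
      obtain ⟨K, hK⟩ := (h.isLogPolynomial w₁ w₂ (-n - 1)).bddAbove
      -- Descending induction on k from beyond the highest logarithm; d bounds the remaining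
      -- distance.
      have key : ∀ d k, K < k + d → componentHom 𝒴 k w₁ n w₂ ∈ M₃.wt (a + b - n - 1) := by
        intro d
        induction d with
        | zero =>
          intro k hk
          have : componentHom 𝒴 k w₁ n w₂ = 0 := by
            by_contra hne
            have := hK hne
            omega
          rw [this]
          exact Submodule.zero_mem _
        | succ d ihd =>
          intro k hk
          refine mem_maxGenEigenspace_of_sub_mem ?_
          rw [hL]
          refine Submodule.add_mem _ (Submodule.add_mem _ (ihj _ ?_) (ihi _ ?_ (j + 1) hj))
            (Submodule.smul_mem _ _ (ihd (k + 1) (by omega)))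
          · rwa [pow_succ, Module.End.mul_apply] at hj
          · rwa [pow_succ, Module.End.mul_apply] at hi
      exact key (K + 1) k (by omega)

end LogComponent

/-! ### Coefficients of A_r(𝒴): values in W₂', truncation, finitely many logarithms -/

section ContragredientOperator

variable {B V W₁ W₂ W₃ : Type*} [AddCommGroup B] {A : AddSubgroup B} [AddCommGroup V] [Module ℂ V]
  [AddCommGroup W₁] [Module ℂ W₁] [AddCommGroup W₂] [Module ℂ W₂]
  [AddCommGroup W₃] [Module ℂ W₃] {κ : Kind V} {D : VertexData A V}
  {M₁ : ModData B V W₁} {M₂ : ModData B V W₂} {M₃ : ModData B V W₃}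
  {𝒴 : W₁ →ₗ[ℂ] W₂ →ₗ[ℂ] LogSeries W₃}

theorem logComponent_scalingArg_shift (h₁ : IsStronglyGradedModule κ D M₁) (r : ℤ)
    {T : Module.End ℂ W₁} {d : ℤ} (hT : ∀ w, M₁.L 0 (T w) = T (M₁.L 0 w) + (d : ℂ) • T w) (n : ℂ)
    (k : ℕ) (w : W₁) :
    logComponent (M₁.L 1) h₁.L_one_nilpotent 𝒴 n k (scalingArg h₁ r (T w))
      = ((-1 : ℂ) ^ d) • logComponent (M₁.L 1) h₁.L_one_nilpotent 𝒴 (n - 2 * d) k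
        (coeffwise T (scalingArg h₁ r w)) := by
  rw [scalingArg_shift h₁ r hT, map_smul, logComponent_mulMon, sub_eq_add_neg]

theorem divPow_L_one_mem (hM : IsStronglyGradedModule κ D M₁) {n : ℂ} {β : B} {w : W₁}
    (hw : w ∈ M₁.wt n ⊓ M₁.gr β) (s : ℕ) :
    divPow (M₁.L 1) s w ∈ M₁.wt (n - s) ⊓ M₁.gr β := by
  refine Submodule.smul_mem _ _ ?_
  induction s with
  | zero => simpa using hw
  | succ s ih =>
    rw [pow_succ', Module.End.mul_apply]
    have h1 := ModData.L_mem_wt hM.sl2 1 ih.1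
    have h2 : n - (s : ℂ) - (((1 : SignType) : ℤ) : ℂ) = n - ((s + 1 : ℕ) : ℂ) := by
      push_cast [SignType.coe_one]
      ring
    rw [h2] at h1
    exact ⟨h1, hM.L_mem 1 _ _ ih.2⟩

/-- L(1)^s lowers the weight by s, and the index -(n+c)-2-s raises it again by s, so all terms of
the exponential fall in one weight space. -/
theorem logComponent_mem (h₁ : IsStronglyGradedModule κ D M₁) (h : IsLogIntertwining M₁ M₂ M₃ 𝒴)
    (hg : IsGradingCompatible M₁ M₂ M₃ 𝒴) {a b c : ℂ} {β γ : B} {g : LogPoly W₁}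
    (hG : g ∈ homogPoly c (M₁.wt a ⊓ M₁.gr β)) {w₂ : W₂} (hw₂ : w₂ ∈ M₂.wt b ⊓ M₂.gr γ) (n : ℂ)
    (k : ℕ) : logComponent (M₁.L 1) h₁.L_one_nilpotent 𝒴 n k g w₂
      ∈ M₃.wt (c + a + b + n + 1) ⊓ M₃.gr (β + γ) := by
  refine map_mem_of_mem_homogPoly hG
    (LinearMap.applyₗ w₂ ∘ₗ logComponent (M₁.L 1) h₁.L_one_nilpotent 𝒴 n k) fun i u hu => ?_
  rw [LinearMap.comp_apply, LinearMap.applyₗ_apply_apply]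
  rcases le_or_gt i k with hi | hi
  · obtain ⟨m, hm⟩ := h₁.L_one_nilpotent u
    rw [logComponent_single_of_le _ hi, oppComponent_eq_sum _ hm, LinearMap.smul_apply,
      LinearMap.sum_apply]
    refine Submodule.smul_mem _ _ (Submodule.sum_mem _ fun s _ => ?_)
    have hs := divPow_L_one_mem h₁ hu s
    refine ⟨?_, hg _ _ _ hs.2 _ hw₂.2 _ _⟩
    have := component_mem_wt h hs.1 hw₂.1 (-(n + c) - 2 - s) (k - i)
    rwa [show a - s + b - (-(n + c) - 2 - s) - 1 = c + a + b + n + 1 by ring] at this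
  · rw [logComponent_single_of_lt _ hi]
    exact Submodule.zero_mem _

/-- The scaled vector carries x^{-2a}, which turns the weight a into -a in the preceding lemma. The
coefficient of A_r(𝒴) is therefore supported on a single bihomogeneous piece of W₂, which places it
in W₂'. -/
theorem comp_logComponent_mem_dualWt (h₁ : IsStronglyGradedModule κ D M₁)
    (h : IsLogIntertwining M₁ M₂ M₃ 𝒴) (hg : IsGradingCompatible M₁ M₂ M₃ 𝒴) (r : ℤ) {a c : ℂ}
    {β γ : B} {w : W₁} (hw : w ∈ M₁.wt a ⊓ M₁.gr β) {f : Module.Dual ℂ W₃}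
    (hf : f ∈ M₃.dualWt γ c) (n : ℂ) (k : ℕ) :
    f ∘ₗ logComponent (M₁.L 1) h₁.L_one_nilpotent 𝒴 n k (scalingArg h₁ r w)
      ∈ M₂.dualWt (γ - β) (c + a - n - 1) := by
  intro δ m hne w₂ hw₂
  refine hf _ _ (fun h' => hne ?_) _
    (logComponent_mem h₁ h hg (scalingArg_mem_homogPoly h₁ r hw) hw₂ n k)
  rw [Prod.mk.injEq] at h' ⊢
  exact ⟨by rw [← h'.1]; abel, by rw [← h'.2]; ring⟩

theorem comp_logComponent_mem_dualSpace (h₁ : IsStronglyGradedModule κ D M₁)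
    (h : IsLogIntertwining M₁ M₂ M₃ 𝒴) (hg : IsGradingCompatible M₁ M₂ M₃ 𝒴) (r : ℤ) (w : W₁)
    (f : M₃.dualSpace) (n : ℂ) (k : ℕ) :
    (f : Module.Dual ℂ W₃) ∘ₗ logComponent (M₁.L 1) h₁.L_one_nilpotent 𝒴 n k (scalingArg h₁ r w)
      ∈ M₂.dualSpace := by
  refine h₁.induction (P := fun w => (f : Module.Dual ℂ W₃) ∘ₗ
    logComponent (M₁.L 1) h₁.L_one_nilpotent 𝒴 n k (scalingArg h₁ r w) ∈ M₂.dualSpace) ?_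
    (fun x y hx hy => ?_) (fun β a w hw => ?_) w
  · simp
  · rw [map_add, map_add, LinearMap.comp_add]
    exact Submodule.add_mem _ hx hy
  · refine ModData.dualSpace_ind (P := fun f => (f : Module.Dual ℂ W₃) ∘ₗ
      logComponent (M₁.L 1) h₁.L_one_nilpotent 𝒴 n k (scalingArg h₁ r w) ∈ M₂.dualSpace) ?_
      (fun f g hf hg => ?_) (fun γ c f hf =>
        ModData.mem_dualSpace (comp_logComponent_mem_dualWt h₁ h hg r hw hf n k)) f
    · simp
    · rw [Submodule.coe_add, LinearMap.add_comp]
      exact Submodule.add_mem _ hf hg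

theorem contragredientOperator_apply (h₁ : IsStronglyGradedModule κ D M₁) (r : ℤ)
    (𝒴 : W₁ →ₗ[ℂ] W₂ →ₗ[ℂ] LogSeries W₃) (w : W₁) (f : M₃.dualSpace) (n : ℂ) (k : ℕ) :
    contragredientOperator h₁ M₃ r 𝒴 w f (-n - 1) k = (f : Module.Dual ℂ W₃) ∘ₗ
      logComponent (M₁.L 1) h₁.L_one_nilpotent 𝒴 n k (scalingArg h₁ r w) := by
  ext w₂
  rw [LinearMap.comp_apply, ← evalAtInv_apply_expXL1]
  rfl

theorem contragredientOperator_mem_dualSpace (h₁ : IsStronglyGradedModule κ D M₁)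
    (h : IsLogIntertwining M₁ M₂ M₃ 𝒴) (hg : IsGradingCompatible M₁ M₂ M₃ 𝒴) (r : ℤ) (w : W₁)
    (f : M₃.dualSpace) (n : ℂ) (k : ℕ) :
    contragredientOperator h₁ M₃ r 𝒴 w f n k ∈ M₂.dualSpace := by
  have := comp_logComponent_mem_dualSpace h₁ h hg r w f (-n - 1) k
  rwa [← contragredientOperator_apply, show -(-n - 1) - 1 = n by ring] at this

/-- The operator `A_r(𝒴)`, with coefficients in `W₂'`. -/
noncomputable def contragredientHom (h₁ : IsStronglyGradedModule κ D M₁)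
    (h : IsLogIntertwining M₁ M₂ M₃ 𝒴) (hg : IsGradingCompatible M₁ M₂ M₃ 𝒴) (r : ℤ) :
    W₁ →ₗ[ℂ] M₃.dualSpace →ₗ[ℂ] LogSeries M₂.dualSpace :=
  LinearMap.mk₂ ℂ
    (fun w f n k => ⟨contragredientOperator h₁ M₃ r 𝒴 w f n k,
      contragredientOperator_mem_dualSpace h₁ h hg r w f n k⟩)
    (fun w w' f => by ext n k w₂; simp)
    (fun c w f => by ext n k w₂; simp)
    (fun w f g => by ext n k w₂; simp)
    (fun c w f => by ext n k w₂; simp)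

section

variable (hD : IsStronglyGradedVertexAlgebra κ D) (h₁ : IsStronglyGradedModule κ D M₁)
  (h₂ : IsStronglyGradedModule κ D M₂) (h₃ : IsStronglyGradedModule κ D M₃)
  (h : IsLogIntertwining M₁ M₂ M₃ 𝒴) (hg : IsGradingCompatible M₁ M₂ M₃ 𝒴) (r : ℤ)

theorem component_contragredientHom (k : ℕ) (w : W₁) (n : ℂ) (f : M₃.dualSpace) :
    ((component (contragredientHom h₁ h hg r) k w n f : M₂.dualSpace) : Module.Dual ℂ W₂)
      = (f : Module.Dual ℂ W₃) ∘ₗ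
        logComponent (M₁.L 1) h₁.L_one_nilpotent 𝒴 n k (scalingArg h₁ r w) :=
  contragredientOperator_apply h₁ r 𝒴 w f n k

theorem component_contragredientHom_apply (k : ℕ) (w : W₁) (n : ℂ) (f : M₃.dualSpace) (x : W₂) :
    ((component (contragredientHom h₁ h hg r) k w n f : M₂.dualSpace) : Module.Dual ℂ W₂) x
      = (f : Module.Dual ℂ W₃)
        (logComponent (M₁.L 1) h₁.L_one_nilpotent 𝒴 n k (scalingArg h₁ r w) x) := by
  rw [component_contragredientHom]
  rfl

-- Raising the index pushes the supporting weight in W₂ below the lower bound of its degree. That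
-- weight does not involve the power of log x, so the bound is uniform in k.
include h₂ in
theorem contragredientHom_truncation (w : W₁) (f : M₃.dualSpace) (n : ℂ) : ∃ N : ℕ, ∀ m ≥ N, ∀ k,
    component (contragredientHom h₁ h hg r) k w (n + m) f = 0 := by
  have hadd : ∀ (w w' : W₁) (f f' : M₃.dualSpace), (∃ N : ℕ, ∀ m ≥ N, ∀ k,
      componentHom (contragredientHom h₁ h hg r) k w (n + m) f = 0) → (∃ N : ℕ, ∀ m ≥ N, ∀ k,
      componentHom (contragredientHom h₁ h hg r) k w' (n + m) f' = 0) → ∃ N : ℕ, ∀ m ≥ N, ∀ k,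
      componentHom (contragredientHom h₁ h hg r) k w (n + m) f
        + componentHom (contragredientHom h₁ h hg r) k w' (n + m) f' = 0 := by
    rintro w w' f f' ⟨N, hN⟩ ⟨N', hN'⟩
    exact ⟨max N N', fun m hm k => by
      rw [hN m (le_of_max_le_left hm), hN' m (le_of_max_le_right hm), add_zero]⟩
  change ∃ N : ℕ, ∀ m ≥ N, ∀ k, componentHom (contragredientHom h₁ h hg r) k w (n + m) f = 0
  refine h₁.induction (P := fun w => ∃ N : ℕ, ∀ m ≥ N, ∀ k,
    componentHom (contragredientHom h₁ h hg r) k w (n + m) f = 0) ⟨0, by simp⟩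
    (fun x y hx hy => by simpa using hadd x y f f hx hy) (fun β a w hw => ?_) w
  refine ModData.dualSpace_ind (P := fun f => ∃ N : ℕ, ∀ m ≥ N, ∀ k,
    componentHom (contragredientHom h₁ h hg r) k w (n + m) f = 0) ⟨0, by simp⟩
    (fun x y hx hy => by simpa using hadd w w x y hx hy) (fun γ c f hf => ?_) f
  obtain ⟨N, hN⟩ := h₂.wt_bounded (γ - β) (c + a - n - 1)
  refine ⟨(1 - N).toNat, fun m hm k => ?_⟩
  have h1 := comp_logComponent_mem_dualWt h₁ h hg r hw hf (n + m) k
  have h2 := hN (-(m : ℤ)) (by omega)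
  push_cast at h2
  rw [show c + a - n - 1 + -(m : ℂ) = c + a - (n + m) - 1 by ring] at h2
  rw [ModData.dualWt_eq_bot h₂ h2, Submodule.mem_bot] at h1
  rw [componentHom_apply, ← Submodule.coe_eq_zero, component_contragredientHom]
  exact h1

-- For each vector of W₂ there are finitely many logarithms, but with a bound depending on the
-- vector. The functional lives on one finite-dimensional piece, so the bounds on a finite spanning
-- set suffice.
include h₂ in
theorem contragredientHom_isLogPolynomial (w : W₁) (f : M₃.dualSpace) :
    (contragredientHom h₁ h hg r w f).IsLogPolynomial := by
  suffices hs : ∀ n, ∃ K : ℕ, ∀ k ≥ K, componentHom (contragredientHom h₁ h hg r) k w n f = 0 by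
    intro n
    obtain ⟨K, hK⟩ := hs (-n - 1)
    refine (Set.finite_lt_nat K).subset fun k hk => ?_
    by_contra hlt
    have h1 : contragredientHom h₁ h hg r w f (-(-n - 1) - 1) k = 0 := hK k (not_lt.1 hlt)
    rw [show -(-n - 1) - 1 = n by ring] at h1
    exact hk h1
  intro n
  have hadd : ∀ (w w' : W₁) (f f' : M₃.dualSpace), (∃ K : ℕ, ∀ k ≥ K,
      componentHom (contragredientHom h₁ h hg r) k w n f = 0) → (∃ K : ℕ, ∀ k ≥ K,
      componentHom (contragredientHom h₁ h hg r) k w' n f' = 0) → ∃ K : ℕ, ∀ k ≥ K,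
      componentHom (contragredientHom h₁ h hg r) k w n f
        + componentHom (contragredientHom h₁ h hg r) k w' n f' = 0 := by
    rintro w w' f f' ⟨N, hN⟩ ⟨N', hN'⟩
    exact ⟨max N N', fun k hk => by
      rw [hN k (le_of_max_le_left hk), hN' k (le_of_max_le_right hk), add_zero]⟩
  refine h₁.induction (P := fun w => ∃ K : ℕ, ∀ k ≥ K,
    componentHom (contragredientHom h₁ h hg r) k w n f = 0) ⟨0, by simp⟩
    (fun x y hx hy => by simpa using hadd x y f f hx hy) (fun β a w hw => ?_) w
  refine ModData.dualSpace_ind (P := fun f => ∃ K : ℕ, ∀ k ≥ K,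
    componentHom (contragredientHom h₁ h hg r) k w n f = 0) ⟨0, by simp⟩
    (fun x y hx hy => by simpa using hadd w w x y hx hy) (fun γ c f hf => ?_) f
  have hfin := h₂.finiteDimensional (γ - β) (c + a - n - 1)
  obtain ⟨S, hS⟩ := (Module.Finite.iff_fg.1 hfin :
    (M₂.wt (c + a - n - 1) ⊓ M₂.gr (γ - β)).FG)
  choose K hK using fun x => exists_logComponent_eq_zero (hN := h₁.L_one_nilpotent) h n
    (scalingArg h₁ r w) x
  refine ⟨S.sup K, fun k hk => ?_⟩
  rw [componentHom_apply, ← Submodule.coe_eq_zero, component_contragredientHom]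
  refine ModData.dualWt_hom_ext h₂ (comp_logComponent_mem_dualWt h₁ h hg r hw hf n k)
    (Submodule.zero_mem _) fun x hx => ?_
  have hle : Submodule.span ℂ (S : Set W₂) ≤ LinearMap.ker
      (logComponent (M₁.L 1) h₁.L_one_nilpotent 𝒴 n k (scalingArg h₁ r w)) := by
    refine Submodule.span_le.2 fun s hs => ?_
    exact hK s k (le_trans (Finset.le_sup (f := K) hs) hk)
  rw [hS] at hle
  rw [LinearMap.comp_apply, hle hx, map_zero, LinearMap.zero_apply]

include hD h₁ h in
theorem logComponent_jacobi {hN : ∀ w, ∃ m : ℕ, ((M₁.L 1) ^ m) w = 0} {k : ℤ} {u : V}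
    (hu : u ∈ D.wt k) (l m : ℤ) (n : ℂ) (q : ℕ) (g : LogPoly W₁) (w₂ : W₂) :
    ∀ᶠ N : ℕ in Filter.atTop,
    (∑ i ∈ Finset.range N, ((-1 : ℂ) ^ i * binom l i) •
        logComponent (M₁.L 1) hN 𝒴 (n + i) q g (oppositeY hD M₂ u (m + l - i) w₂))
      - ((-1 : ℂ) ^ l) • (∑ i ∈ Finset.range N, ((-1 : ℂ) ^ i * binom l i) •
        oppositeY hD M₃ u (m + i) (logComponent (M₁.L 1) hN 𝒴 (n + l - i) q g w₂))
    = ∑ i ∈ Finset.range N, binom m i • (((-1 : ℂ) ^ (k - l - i - 1)) •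
      logComponent (M₁.L 1) hN 𝒴 ((m : ℂ) + n - i - 2 * ((k - l - i - 1 : ℤ) : ℂ)) q
        (coeffwise (M₁.Y u (l + i)) g) w₂) := by
  induction g using Finsupp.induction_linear with
  | zero => exact Filter.Eventually.of_forall fun N => by simp
  | add f g hf hg =>
    filter_upwards [hf, hg] with N h1 h2
    simp only [map_add, LinearMap.add_apply, smul_add, Finset.sum_add_distrib]
    rw [← h1, ← h2]
    abel
  | single p w =>
    rcases le_or_gt p.2 q with hp | hp
    · have hJ : ∀ v, JacobiIdentity (M₁.Y v) (M₂.Y v) (M₃.Y v)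
          fun w (n : ℂ) w₂ => componentHom 𝒴 (q - p.2) w n w₂ := fun v => h.jacobi v (q - p.2)
      filter_upwards [oppComponent_jacobi hD h₁.toIsVertexAction hN hJ hu l m (n + p.1) w w₂]
        with N hN
      simp only [coeffwise_single, logComponent_single_of_le _ hp, LinearMap.smul_apply, map_smul]
      have e1 : ∀ i : ℕ, n + i + p.1 = n + p.1 + i := fun i => by ring
      have e2 : ∀ i : ℕ, n + l - i + p.1 = n + p.1 + l - i := fun i => by ring
      have e3 : ∀ i : ℕ, (m : ℂ) + n - i - 2 * ((k - l - i - 1 : ℤ) : ℂ) + p.1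
        = m + (n + p.1) - i - ((2 * (k - l - i - 1) : ℤ) : ℂ) := fun i => by push_cast; ring
      simp only [e1, e2, e3, smul_comm _ ((-1 : ℂ) ^ (q - p.2)), ← Finset.smul_sum]
      rw [← smul_sub]
      exact congrArg (fun x => ((-1 : ℂ) ^ (q - p.2)) • x) hN
    · exact Filter.Eventually.of_forall fun N => by
        simp [logComponent_single_of_lt _ hp]

end

end ContragredientOperator

/-! ### A_r(𝒴) is a grading-compatible logarithmic intertwining operator -/

section ContragredientIntertwining

variable {B V W₁ W₂ W₃ : Type*} [AddCommGroup B] {A : AddSubgroup B} [AddCommGroup V] [Module ℂ V]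
  [AddCommGroup W₁] [Module ℂ W₁] [AddCommGroup W₂] [Module ℂ W₂]
  [AddCommGroup W₃] [Module ℂ W₃] {κ : Kind V} {D : VertexData A V}
  {M₁ : ModData B V W₁} {M₂ : ModData B V W₂} {M₃ : ModData B V W₃}
  {𝒴 : W₁ →ₗ[ℂ] W₂ →ₗ[ℂ] LogSeries W₃}
  (hD : IsStronglyGradedVertexAlgebra κ D) (h₁ : IsStronglyGradedModule κ D M₁)
  (h₂ : IsStronglyGradedModule κ D M₂) (h₃ : IsStronglyGradedModule κ D M₃)
  (h : IsLogIntertwining M₁ M₂ M₃ 𝒴) (hg : IsGradingCompatible M₁ M₂ M₃ 𝒴) (r : ℤ)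

theorem contragredientHom_jacobi (v : V) (k : ℕ) :
    JacobiIdentity (M₁.Y v) ((contragredient hD h₃).Y v) ((contragredient hD h₂).Y v)
      (component (contragredientHom h₁ h hg r) k) := by
  change JacobiIdentity (M₁.Y v) ((contragredient hD h₃).Y v) ((contragredient hD h₂).Y v)
      fun w (n : ℂ) w₂ => componentHom (contragredientHom h₁ h hg r) k w n w₂
  refine hD.induction (P := fun v => JacobiIdentity (M₁.Y v) ((contragredient hD h₃).Y v)
    ((contragredient hD h₂).Y v)
      fun w (n : ℂ) w₂ => componentHom (contragredientHom h₁ h hg r) k w n w₂) ?_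
    (fun x y hx hy => ?_) (fun α q u hu => ?_) v
  · simp only [map_zero]
    exact JacobiIdentity.zero
  · have := JacobiIdentity.add hx hy
    rwa [← map_add, ← map_add, ← map_add] at this
  · refine JacobiIdentity.of_apply (h₁.truncation u) (contragredient_truncation hD h₃ u)
      (fun w n f => ?_) fun l m n w f x => ?_
    · obtain ⟨N, hN⟩ := contragredientHom_truncation h₁ h₂ h hg r w f n
      exact ⟨N, fun m hm => hN m hm k⟩
    filter_upwards [logComponent_jacobi (hN := h₁.L_one_nilpotent) hD h₁ h hu.1 l m n k
      (scalingArg h₁ r w) x] with N hN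
    have h2 := congrArg (fun x => (f : Module.Dual ℂ W₃) x) hN
    simp only [map_sub, map_sum, map_smul] at h2
    simp only [contragredient_Y_apply, componentHom_apply, component_contragredientHom_apply]
    refine h2.trans (Finset.sum_congr rfl fun i _ => ?_)
    -- The operator u_{l+i} has degree q - l - i - 1; passing it through the scaling creates exactly
    -- the sign and shift in `logComponent_jacobi`.
    rw [logComponent_scalingArg_shift h₁ r (T := M₁.Y u (l + i)) (d := q - (l + i) - 1)
      (fun w => hD.toIsVertexAction.bracket_zero_of_mem_wt h₁.toIsVertexAction hu.1 (l + i) w),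
      LinearMap.smul_apply, map_smul, show q - (l + i) - 1 = q - l - i - 1 by ring]

theorem contragredientHom_derivative (w : W₁) (f : M₃.dualSpace) :
    contragredientHom h₁ h hg r (M₁.L (-1) w) f = (contragredientHom h₁ h hg r w f).deriv := by
  have hT : ∀ w, M₁.L 0 (M₁.L (-1) w) = M₁.L (-1) (M₁.L 0 w) + ((1 : ℤ) : ℂ) • M₁.L (-1) w := by
    intro w
    rw [sl2_comm_zero h₁.sl2, coe_neg_one_signType]
    push_cast
    module
  have key : ∀ (n : ℂ) (k : ℕ), component (contragredientHom h₁ h hg r) k (M₁.L (-1) w) n f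
      = (-n) • component (contragredientHom h₁ h hg r) k w (n - 1) f
        + ((k : ℂ) + 1) • component (contragredientHom h₁ h hg r) (k + 1) w (n - 1) f := by
    intro n k
    ext x
    simp only [Submodule.coe_add, Submodule.coe_smul, LinearMap.add_apply, LinearMap.smul_apply,
      component_contragredientHom_apply]
    have h3 := logComponent_derivative (hN := h₁.L_one_nilpotent) h₁.sl2 h n k (scalingArg h₁ r w)
    -- The scaling contributes -2x⁻¹L(0), cancelling the 2x⁻¹L(0) of `logComponent_derivative`. Only
    -- the L(-1) term is left, and its sign and shift are those of degree d = 1.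
    rw [logDeriv_scalingArg, map_smul, logComponent_mulMon, ← sub_eq_add_neg] at h3
    have h4 := congrArg (fun T : W₂ →ₗ[ℂ] W₃ => (f : Module.Dual ℂ W₃) (T x)) h3
    simp only [LinearMap.add_apply, LinearMap.sub_apply, LinearMap.smul_apply, map_add, map_sub,
      map_smul] at h4
    rw [h4, logComponent_scalingArg_shift h₁ r hT, LinearMap.smul_apply, map_smul]
    push_cast
    rw [mul_one, zpow_one]
    module
  ext n k : 2
  have h1 := key (-n - 1) k
  unfold component at h1
  rw [show -(-n - 1) - 1 = n by ring, show -(-n - 1 - 1) - 1 = n + 1 by ring,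
    show -(-n - 1) = n + 1 by ring] at h1
  exact h1

/-- Transposition reverses the commutator and exchanges L(1) and L(-1). The resulting signs and
powers of x are compensated by passing L(-1), L(0), L(1), of degrees 1, 0, -1, through the scaling.
-/
theorem contragredientHom_bracket (k : ℕ) : Sl2BracketRelations M₁.L (contragredient hD h₃).L
    (contragredient hD h₂).L (component (contragredientHom h₁ h hg r) k) := by
  have hT : ∀ w, M₁.L 0 (M₁.L (-1) w) = M₁.L (-1) (M₁.L 0 w) + ((1 : ℤ) : ℂ) • M₁.L (-1) w := by
    intro w
    rw [sl2_comm_zero h₁.sl2, coe_neg_one_signType]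
    push_cast
    module
  have hT' : ∀ w, M₁.L 0 (M₁.L 1 w) = M₁.L 1 (M₁.L 0 w) + ((-1 : ℤ) : ℂ) • M₁.L 1 w := by
    intro w
    rw [L_one_apply_zero h₁.sl2]
    push_cast
    module
  have hT0 : ∀ w, M₁.L 0 (M₁.L 0 w) = M₁.L 0 (M₁.L 0 w) + ((0 : ℤ) : ℂ) • M₁.L 0 w := by simp
  intro w n f
  refine ⟨?_, ?_, ?_⟩
  · ext x
    simp only [AddSubgroupClass.coe_sub, LinearMap.sub_apply, component_contragredientHom_apply,
      contragredient_L_neg_one_apply]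
    rw [logComponent_scalingArg_shift h₁ r hT, ← map_sub, ← neg_sub,
      logComponent_bracket_one h₁.sl2 h]
    simp
  · ext x
    simp only [AddSubgroupClass.coe_sub, LinearMap.sub_apply, component_contragredientHom_apply,
      contragredient_L_zero_apply, Submodule.coe_add, LinearMap.add_apply]
    rw [logComponent_scalingArg_shift h₁ r hT, logComponent_scalingArg_shift h₁ r hT0, ← map_sub,
      ← neg_sub, logComponent_bracket_zero h₁.sl2 h]
    push_cast
    rw [show n + 1 - 2 * 1 = n - 1 by ring]
    simp [sub_eq_add_neg]
  · ext x
    simp only [AddSubgroupClass.coe_sub, LinearMap.sub_apply, component_contragredientHom_apply,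
      contragredient_L_one_apply, Submodule.coe_add, LinearMap.add_apply, Submodule.coe_smul,
      LinearMap.smul_apply]
    rw [logComponent_scalingArg_shift h₁ r hT, logComponent_scalingArg_shift h₁ r hT0,
      logComponent_scalingArg_shift h₁ r hT', ← map_sub, ← neg_sub,
      logComponent_bracket_neg_one h₁.sl2 h]
    push_cast
    rw [show n + 2 - 2 * 1 = n by ring, show n + 1 - 2 * 0 = n + 1 by ring,
      show n - 2 * (-1) = n + 2 by ring]
    simp only [LinearMap.smul_apply, map_smul, map_neg, map_add, map_sub, zpow_one, zpow_zero,
      zpow_neg, inv_neg, inv_one]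
    module

theorem contragredientHom_isLogIntertwining : IsLogIntertwining M₁ (contragredient hD h₃)
    (contragredient hD h₂) (contragredientHom h₁ h hg r) where
  isLogPolynomial := contragredientHom_isLogPolynomial h₁ h₂ h hg r
  truncation := contragredientHom_truncation h₁ h₂ h hg r
  jacobi := contragredientHom_jacobi hD h₁ h₂ h₃ h hg r
  derivative := contragredientHom_derivative h₁ h hg r
  bracket := contragredientHom_bracket hD h₁ h₂ h₃ h hg r

theorem contragredientHom_isGradingCompatible : IsGradingCompatible M₁ (contragredient hD h₃)
    (contragredient hD h₂) (contragredientHom h₁ h hg r) := by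
  intro β γ w hw f hf n k
  rw [mem_contragredient_gr hD h₂]
  rw [mem_contragredient_gr hD h₃] at hf
  intro δ hδ x hx
  rw [component_contragredientHom_apply]
  refine hf (β + δ) (fun h' => hδ ?_) _ ?_
  · rw [neg_add, ← h']
    abel
  have key : ∀ w ∈ ⨆ n, M₁.wt n ⊓ M₁.gr β, ∀ x ∈ ⨆ n, M₂.wt n ⊓ M₂.gr δ,
      logComponent (M₁.L 1) h₁.L_one_nilpotent 𝒴 n k (scalingArg h₁ r w) x ∈ M₃.gr (β + δ) := by
    intro w hw x hx
    refine Submodule.iSup_induction _ (motive := fun w => logComponent (M₁.L 1)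
      h₁.L_one_nilpotent 𝒴 n k (scalingArg h₁ r w) x ∈ M₃.gr (β + δ)) hw (fun a w hw => ?_)
      (by simp) (fun y z hy hz => ?_)
    · refine Submodule.iSup_induction _ (motive := fun x => logComponent (M₁.L 1)
        h₁.L_one_nilpotent 𝒴 n k (scalingArg h₁ r w) x ∈ M₃.gr (β + δ)) hx (fun b x hx => ?_)
        (by simp) (fun y z hy hz => ?_)
      · exact (logComponent_mem h₁ h hg (scalingArg_mem_homogPoly h₁ r hw) hx n k).2
      · rw [map_add]
        exact Submodule.add_mem _ hy hz
    · rw [map_add, map_add]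
      exact Submodule.add_mem _ hy hz
  rw [h₁.gr_compatible] at hw
  rw [h₂.gr_compatible] at hx
  exact key w hw x hx

end ContragredientIntertwining

/-! ### The substitution `x ↦ x⁻¹` on finite logarithmic sums -/

section InvVar

variable {W W' W'' : Type*} [AddCommGroup W] [Module ℂ W] [AddCommGroup W'] [Module ℂ W']
  [AddCommGroup W''] [Module ℂ W'']

/-- `f(x) ↦ f(x⁻¹)` on finite sums. -/
noncomputable def invVar : LogPoly W →ₗ[ℂ] LogPoly W :=
  Finsupp.lsum ℂ fun p : ℂ × ℕ => ((-1 : ℂ) ^ p.2) • Finsupp.lsingle (-p.1, p.2)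

theorem invVar_single (p : ℂ × ℕ) (w : W) :
    invVar (Finsupp.single p w) = ((-1 : ℂ) ^ p.2) • Finsupp.single (-p.1, p.2) w := by
  simp [invVar]

theorem invVar_mulMon (p : ℂ × ℕ) (g : LogPoly W) :
    invVar (mulMon p g) = ((-1 : ℂ) ^ p.2) • mulMon (-p.1, p.2) (invVar g) := by
  induction g using Finsupp.induction_linear with
  | zero => simp
  | add f g hf hg => simp only [map_add, hf, hg, smul_add]
  | single q w =>
    rw [mulMon_single, invVar_single, invVar_single, map_smul, mulMon_single, smul_smul, ← pow_add]
    congr 2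
    ext1
    · exact neg_add _ _
    · rfl

theorem coeffwise_invVar (T : W →ₗ[ℂ] W') (g : LogPoly W) :
    coeffwise T (invVar g) = invVar (coeffwise T g) := by
  induction g using Finsupp.induction_linear with
  | zero => simp
  | add f g hf hg => simp only [map_add, hf, hg]
  | single q w => rw [invVar_single, map_smul, coeffwise_single, coeffwise_single, invVar_single]

theorem LogPoly.apply_apply (T : W' →ₗ[ℂ] LogPoly W'') (S : W →ₗ[ℂ] LogPoly W') (g : LogPoly W) :
    LogPoly.apply T (LogPoly.apply S g) = LogPoly.apply (LogPoly.apply T ∘ₗ S) g := by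
  induction g using Finsupp.induction_linear with
  | zero => simp
  | add f g hf hg => simp only [map_add, hf, hg]
  | single q w =>
    rw [LogPoly.apply_single, LogPoly.apply_mulMon, LogPoly.apply_single, LinearMap.comp_apply]

theorem LogPoly.apply_coeffwise_comp (T : W →ₗ[ℂ] LogPoly W') (S : W' →ₗ[ℂ] W'') (g : LogPoly W) :
    LogPoly.apply (coeffwise S ∘ₗ T) g = coeffwise S (LogPoly.apply T g) := by
  induction g using Finsupp.induction_linear with
  | zero => simp
  | add f g hf hg => simp only [map_add, hf, hg]
  | single q w =>
    rw [LogPoly.apply_single, LogPoly.apply_single, coeffwise_mulMon, LinearMap.comp_apply]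

theorem invVar_apply (T : W →ₗ[ℂ] LogPoly W') (g : LogPoly W) :
    invVar (LogPoly.apply T g) = LogPoly.apply (invVar ∘ₗ T) (invVar g) := by
  induction g using Finsupp.induction_linear with
  | zero => simp
  | add f g hf hg => simp only [map_add, hf, hg]
  | single q w =>
    rw [LogPoly.apply_single, invVar_mulMon, invVar_single, map_smul, LogPoly.apply_single,
      LinearMap.comp_apply]

theorem LogPoly.apply_lsingle (g : LogPoly W) : LogPoly.apply (Finsupp.lsingle (0, 0)) g = g := by
  induction g using Finsupp.induction_linear with
  | zero => simp
  | add f g hf hg => simp only [map_add, hf, hg]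
  | single q w =>
    rw [LogPoly.apply_single, Finsupp.lsingle_apply, mulMon_single]
    congr 1
    exact add_zero q

/-- e^{N}e^{-N} = 1 with a record F of the total degree: every degree t > 0 cancels by
`sum_divPow_neg`, whatever F does. -/
theorem sum_sum_divPow_neg {U : Type*} [AddCommGroup U] [Module ℂ U] {N : Module.End ℂ W} {m : ℕ}
    {w : W} (hm : (N ^ m) w = 0) (F : ℕ → W →ₗ[ℂ] U) :
    ∑ i ∈ Finset.range m, ∑ j ∈ Finset.range m, F (i + j) (divPow N i (divPow ((-1 : ℂ) • N) j w))
      = F 0 w := by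
  have hz : ∀ i j, m ≤ i → divPow N i (divPow ((-1 : ℂ) • N) j w) = 0 := by
    intro i j hi
    refine divPow_eq_zero (S := m) ?_ hi
    simp only [divPow, LinearMap.smul_apply, smul_pow, map_smul]
    rw [← Module.End.mul_apply, ← pow_add, add_comm, pow_add, Module.End.mul_apply, hm, map_zero,
      smul_zero, smul_zero]
  rw [sum_range_range_eq_sum_antidiagonal (T := m + m + 1)
    (f := fun i j => F (i + j) (divPow N i (divPow ((-1 : ℂ) • N) j w)))
    (fun i j hi => by rw [hz i j hi, map_zero])
    (fun i j hj => by
      rw [divPow_eq_zero (pow_smul_apply_eq_zero (-1) hm) hj, map_zero, map_zero]) (by omega),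
    Finset.sum_eq_single_of_mem 0 (by simp)]
  · simp [divPow_zero]
  · intro t _ ht
    have : ∀ x ∈ Finset.HasAntidiagonal.antidiagonal t,
        F (x.1 + x.2) (divPow N x.1 (divPow ((-1 : ℂ) • N) x.2 w))
          = F t (divPow N x.1 (divPow ((-1 : ℂ) • N) x.2 w)) := by
      intro x hx
      rw [Finset.HasAntidiagonal.mem_antidiagonal.1 hx]
    rw [Finset.sum_congr rfl this, ← map_sum, sum_divPow_neg N ht, map_zero]

end InvVar

/-! ### Inverting the argument map of A_r -/

section Involution

variable {B V W : Type*} [AddCommGroup B] {A : AddSubgroup B} [AddCommGroup V] [Module ℂ V]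
  [AddCommGroup W] [Module ℂ W] {κ : Kind V} {D : VertexData A V} {M : ModData B V W}
  (hM : IsStronglyGradedModule κ D M)

theorem divPow_mem_wt {n : ℂ} {w : W} (hw : w ∈ M.wt n) (c : ℂ) (i : ℕ) :
    divPow (c • (M.L 0 - n • 1)) i w ∈ M.wt n := by
  refine Submodule.smul_mem _ _ (sub_pow_mem (fun w hw => ?_) c n hw i)
  have := shift_mem_wt (L_zero_shift_zero M) hw
  rwa [add_zero] at this

theorem pow_divPow_eq_zero {N : Module.End ℂ W} {m : ℕ} {w : W} (hm : (N ^ m) w = 0) (c : ℂ)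
    (i : ℕ) : (N ^ m) (divPow (c • N) i w) = 0 := by
  simp only [divPow, LinearMap.smul_apply, smul_pow, map_smul]
  rw [← Module.End.mul_apply, ← pow_add, add_comm, pow_add, Module.End.mul_apply, hm, map_zero,
    smul_zero, smul_zero]

theorem expL0_expL0_neg (a : ℂ) (w : W) : expL0 hM a (expL0 hM (-a) w) = w := by
  suffices expL0 hM a ∘ₗ expL0 hM (-a) = LinearMap.id from LinearMap.congr_fun this w
  refine hM.wt_directSum.hom_ext fun n w hw => ?_
  obtain ⟨m, hm⟩ := (Module.End.mem_maxGenEigenspace _ _ _).1 hw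
  rw [LinearMap.comp_apply, expL0_of_mem_wt hM (-a) hw hm, map_smul, map_sum,
    Finset.sum_congr rfl fun i _ => expL0_of_mem_wt hM a (divPow_mem_wt hw (-a) i)
      (pow_divPow_eq_zero hm (-a) i), ← Finset.smul_sum, smul_smul, ← Complex.exp_add,
    show -a * n + a * n = 0 by ring, Complex.exp_zero, one_smul, Finset.sum_comm,
    LinearMap.id_apply]
  refine Eq.trans (Finset.sum_congr rfl fun i _ => Finset.sum_congr rfl fun j _ => ?_)
    (sum_sum_divPow_neg (pow_smul_apply_eq_zero a hm) fun _ => LinearMap.id)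
  rw [LinearMap.id_apply, smul_smul, neg_one_mul]

theorem apply_invVar_xPowNegL0 (w : W) :
    LogPoly.apply (invVar ∘ₗ xPowNegL0 hM) (xPowNegL0 hM w) = Finsupp.single (0, 0) w := by
  suffices LogPoly.apply (invVar ∘ₗ xPowNegL0 hM) ∘ₗ xPowNegL0 hM = Finsupp.lsingle (0, 0) from
    LinearMap.congr_fun this w
  refine hM.wt_directSum.hom_ext fun n w hw => ?_
  obtain ⟨m, hm⟩ := (Module.End.mem_maxGenEigenspace _ _ _).1 hw
  rw [LinearMap.comp_apply, xPowNegL0_of_mem_wt hM hw hm, map_sum]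
  have key : ∀ i : ℕ, LogPoly.apply (invVar ∘ₗ xPowNegL0 hM)
      (Finsupp.single (-n, i) (divPow ((-1 : ℂ) • (M.L 0 - n • 1)) i w))
      = ∑ j ∈ Finset.range m, Finsupp.single (0, j + i)
        (divPow (M.L 0 - n • 1) j (divPow ((-1 : ℂ) • (M.L 0 - n • 1)) i w)) := by
    intro i
    rw [LogPoly.apply_single, LinearMap.comp_apply, xPowNegL0_of_mem_wt hM (divPow_mem_wt hw (-1) i)
      (pow_divPow_eq_zero hm (-1) i), map_sum, map_sum]
    refine Finset.sum_congr rfl fun j _ => ?_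
    rw [invVar_single, map_smul, mulMon_single, divPow_smul, LinearMap.smul_apply,
      ← Finsupp.smul_single, smul_smul, ← mul_pow, Prod.mk_add_mk, neg_neg, neg_add_cancel, add_comm]
    simp
  rw [Finset.sum_congr rfl fun i _ => key i, Finset.sum_comm]
  exact sum_sum_divPow_neg hm fun t => Finsupp.lsingle (0, t)

theorem xPowNegL0_expL0 (a : ℂ) (w : W) :
    xPowNegL0 hM (expL0 hM a w) = coeffwise (expL0 hM a) (xPowNegL0 hM w) := by
  have := xPowNegL0_shift hM (T := expL0 hM a) (d := 0) (fun w => by rw [expL0_comm]; simp) w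
  rwa [neg_zero, show ((0 : ℂ), 0) = 0 from rfl, mulMon_zero] at this

theorem invVar_scalingArg (r : ℤ) (w : W) : invVar (scalingArg hM r w)
    = coeffwise (expL0 hM ((2 * r + 1) * Real.pi * Complex.I))
      (LogPoly.apply (invVar ∘ₗ xPowNegL0 hM) (invVar (xPowNegL0 hM w))) := by
  unfold scalingArg
  rw [LinearMap.comp_apply, LinearMap.comp_apply, ← coeffwise_invVar, invVar_apply]

/-- Scaling and exponential factors commute, so x^{2L(0)} cancels x^{-2L(0)} and e^{(2r+1)πiL(0)}
cancels e^{(2s+1)πiL(0)} since 2s + 1 = -(2r + 1). This is the origin of the index -r-1. -/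
theorem apply_invVar_scalingArg {r s : ℤ} (hrs : r + s = -1) (w : W) :
    LogPoly.apply (invVar ∘ₗ scalingArg hM r) (scalingArg hM s w) = Finsupp.single (0, 0) w := by
  set Q : W →ₗ[ℂ] LogPoly W := invVar ∘ₗ xPowNegL0 hM with hQ
  have hQP : ∀ g, LogPoly.apply Q (LogPoly.apply (xPowNegL0 hM) g) = g := by
    intro g
    rw [LogPoly.apply_apply, show LogPoly.apply Q ∘ₗ xPowNegL0 hM = Finsupp.lsingle (0, 0) from
      LinearMap.ext fun w => apply_invVar_xPowNegL0 hM w, LogPoly.apply_lsingle]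
  have hK : invVar ∘ₗ scalingArg hM r = coeffwise (expL0 hM ((2 * r + 1) * Real.pi * Complex.I)) ∘ₗ
      (LogPoly.apply Q ∘ₗ Q) := LinearMap.ext fun w => invVar_scalingArg hM r w
  have hQE : ∀ (a : ℂ) (g : LogPoly W), LogPoly.apply Q (coeffwise (expL0 hM a) g)
      = coeffwise (expL0 hM a) (LogPoly.apply Q g) := by
    intro a g
    rw [LogPoly.apply_coeffwise (c := 0) (fun w => by
      rw [hQ, LinearMap.comp_apply, xPowNegL0_expL0, ← coeffwise_invVar, mulMon_zero,
        LinearMap.comp_apply]), mulMon_zero]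
  have ha : ((2 * s + 1) * Real.pi * Complex.I : ℂ) = -((2 * r + 1) * Real.pi * Complex.I) := by
    have : (s : ℂ) = -1 - r := by
      rw [← eq_sub_iff_add_eq'] at hrs
      rw [hrs]
      push_cast
      ring
    rw [this]
    ring
  rw [hK, LogPoly.apply_coeffwise_comp, ← LogPoly.apply_apply]
  unfold scalingArg
  rw [LinearMap.comp_apply, LinearMap.comp_apply, hQE, hQE, hQP, apply_invVar_xPowNegL0, ha,
    coeffwise_single, coeffwise_single, expL0_expL0_neg]

theorem expXL1_eq_sum {m : ℕ} {w : W} (hm : ((M.L 1) ^ m) w = 0) :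
    expXL1 hM w = ∑ t ∈ Finset.range m, Finsupp.single ((t : ℂ), 0) (divPow (M.L 1) t w) := by
  have h := expSeries_sum (j := LinearMap.id) (h := hM.L_one_nilpotent) (s := w) (m := m) hm
    (fun t : ℕ => Finsupp.lsingle (R := ℂ) ((t : ℂ), 0))
  refine Eq.trans ?_ h
  rw [Finsupp.lsum_apply]
  rfl

/-- `e^{x⁻¹L(1)} e^{-x⁻¹L(1)} = 1` on finite sums. -/
theorem eventually_sum_invVar_apply_expXL1 (g : LogPoly W) : ∀ᶠ m : ℕ in Filter.atTop,
    ∑ t ∈ Finset.range m, mulMon (-(t : ℂ), 0) (invVar (LogPoly.apply (expXL1 hM)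
      (coeffwise (divPow ((-1 : ℂ) • M.L 1) t) g))) = invVar g := by
  induction g using Finsupp.induction_linear with
  | zero => exact Filter.Eventually.of_forall fun m => by simp
  | add f g hf hg =>
    filter_upwards [hf, hg] with m h1 h2
    simp only [map_add, Finset.sum_add_distrib, h1, h2]
  | single p w =>
    obtain ⟨m₀, hm₀⟩ := hM.L_one_nilpotent w
    filter_upwards [Filter.eventually_ge_atTop m₀] with m hge
    have hm : ((M.L 1) ^ m) w = 0 := by
      rw [← Nat.sub_add_cancel hge, pow_add, Module.End.mul_apply, hm₀, map_zero]
    have key : ∀ t : ℕ, mulMon (-(t : ℂ), 0) (invVar (LogPoly.apply (expXL1 hM)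
        (coeffwise (divPow ((-1 : ℂ) • M.L 1) t) (Finsupp.single p w))))
        = ∑ i ∈ Finset.range m, ((-1 : ℂ) ^ p.2) • Finsupp.single (-p.1 - ((i + t : ℕ) : ℂ), p.2)
          (divPow (M.L 1) i (divPow ((-1 : ℂ) • M.L 1) t w)) := by
      intro t
      rw [coeffwise_single, LogPoly.apply_single, expXL1_eq_sum hM (pow_divPow_eq_zero hm (-1) t),
        map_sum, map_sum, map_sum]
      refine Finset.sum_congr rfl fun i _ => ?_
      rw [mulMon_single, invVar_single, map_smul, mulMon_single]
      congr 2
      ext1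
      · push_cast
        simp only [Prod.fst_add]
        ring
      · simp
    rw [Finset.sum_congr rfl fun t _ => key t, Finset.sum_comm, invVar_single]
    refine Eq.trans (sum_sum_divPow_neg hm fun t : ℕ => ((-1 : ℂ) ^ p.2) •
      (Finsupp.lsingle (-p.1 - (t : ℂ), p.2) : W →ₗ[ℂ] LogPoly W)) ?_
    simp

/-- L(1)^t has degree -t, so passing it through the scaling at x⁻¹ costs (-1)^t x^{-2t}. Hence
e^{xL(1)} turns into e^{-x⁻¹L(1)}, which cancels the e^{x⁻¹L(1)} of the argument map at x⁻¹. -/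
theorem apply_invVar_contragredientArg_expXL1 (r : ℤ) (w : W) :
    LogPoly.apply (invVar ∘ₗ contragredientArg hM r) (expXL1 hM w) = invVar (scalingArg hM r w) := by
  obtain ⟨m₀, hm₀⟩ := hM.L_one_nilpotent w
  obtain ⟨m, hm1, hge⟩ := ((eventually_sum_invVar_apply_expXL1 hM (scalingArg hM r w)).and
    (Filter.eventually_ge_atTop m₀)).exists
  have hm : ((M.L 1) ^ m) w = 0 := by
    rw [← Nat.sub_add_cancel hge, pow_add, Module.End.mul_apply, hm₀, map_zero]
  rw [expXL1_eq_sum hM hm, map_sum, ← hm1]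
  refine Finset.sum_congr rfl fun t _ => ?_
  have hT : ∀ w, M.L 0 (divPow (M.L 1) t w)
      = divPow (M.L 1) t (M.L 0 w) + ((-(t : ℤ) : ℤ) : ℂ) • divPow (M.L 1) t w := by
    intro w
    rw [L_zero_divPow hM.sl2]
    push_cast
    module
  have e : ∀ g : LogPoly W, coeffwise (divPow ((-1 : ℂ) • M.L 1) t) g
      = ((-1 : ℂ) ^ t) • coeffwise (divPow (M.L 1) t) g := by
    intro g
    rw [divPow_smul]
    ext p
    simp only [Finsupp.mapRange.linearMap_apply, Finsupp.mapRange_apply, Finsupp.smul_apply,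
      LinearMap.smul_apply]
  rw [LogPoly.apply_single, LinearMap.comp_apply, contragredientArg_eq, scalingArg_shift hM r hT, e,
    map_smul, map_smul, map_smul, map_smul, map_smul, LogPoly.apply_mulMon, invVar_mulMon, pow_zero,
    one_smul, mulMon_mulMon, Prod.mk_add_mk, zpow_neg, zpow_natCast, ← inv_pow, inv_neg, inv_one]
  rw [map_smul]
  congr 3
  ext1
  · push_cast
    ring
  · rfl

/-- The inner exponential is absorbed by the preceding lemma, leaving the two scalings, which are
mutually inverse. -/
theorem apply_invVar_contragredientArg {r s : ℤ} (hrs : r + s = -1) (w : W) :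
    LogPoly.apply (invVar ∘ₗ contragredientArg hM r) (contragredientArg hM s w)
      = Finsupp.single (0, 0) w := by
  rw [contragredientArg_eq, LogPoly.apply_apply,
    show LogPoly.apply (invVar ∘ₗ contragredientArg hM r) ∘ₗ expXL1 hM = invVar ∘ₗ scalingArg hM r
      from LinearMap.ext fun w => apply_invVar_contragredientArg_expXL1 hM r w,
    apply_invVar_scalingArg hM hrs]

end Involution

/-! ### The involution property -/

section EvalAt

variable {W₁ W₂ W₃ : Type*} [AddCommGroup W₁] [Module ℂ W₁] [AddCommGroup W₂] [Module ℂ W₂]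
  [AddCommGroup W₃] [Module ℂ W₃]

/-- `g ↦ 𝒴(g(x), x) w₂` for finite sums `g`. -/
noncomputable def evalAt (𝒴 : W₁ →ₗ[ℂ] W₂ →ₗ[ℂ] LogSeries W₃) :
    LogPoly W₁ →ₗ[ℂ] W₂ →ₗ[ℂ] LogSeries W₃ :=
  Finsupp.lsum ℂ fun p => 𝒴.compr₂ (LogSeries.mulMonomial p)

variable (𝒴 : W₁ →ₗ[ℂ] W₂ →ₗ[ℂ] LogSeries W₃)

theorem evalAt_single (p : ℂ × ℕ) (w : W₁) (x : W₂) :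
    evalAt 𝒴 (Finsupp.single p w) x = LogSeries.mulMonomial p (𝒴 w x) := by
  simp [evalAt]

theorem mulMonomial_mulMonomial (p q : ℂ × ℕ) (f : LogSeries W₃) :
    LogSeries.mulMonomial p (LogSeries.mulMonomial q f) = LogSeries.mulMonomial (p + q) f := by
  obtain ⟨p₁, p₂⟩ := p
  obtain ⟨q₁, q₂⟩ := q
  ext n k
  change (if p₂ ≤ k then if q₂ ≤ k - p₂ then f (n - p₁ - q₁) (k - p₂ - q₂) else 0 else 0)
    = if p₂ + q₂ ≤ k then f (n - (p₁ + q₁)) (k - (p₂ + q₂)) else 0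
  rw [sub_sub, Nat.sub_sub]
  split_ifs <;> first | rfl | omega

theorem substInv_mulMonomial_substInv (p : ℂ × ℕ) (f : LogSeries W₃) :
    LogSeries.substInv (LogSeries.mulMonomial p (LogSeries.substInv f))
      = ((-1 : ℂ) ^ p.2) • LogSeries.mulMonomial (-p.1, p.2) f := by
  obtain ⟨p, q⟩ := p
  ext n k
  change ((-1 : ℂ) ^ k) • (if q ≤ k then ((-1 : ℂ) ^ (k - q)) • f (-(-n - p)) (k - q) else 0)
    = ((-1 : ℂ) ^ q) • if q ≤ k then f (n - -p) (k - q) else 0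
  split_ifs with h
  · obtain ⟨j, rfl⟩ := Nat.exists_eq_add_of_le h
    rw [show -(-n - p) = n - -p by ring, Nat.add_sub_cancel_left, smul_smul, pow_add, mul_assoc,
      ← mul_pow]
    norm_num
  · simp

theorem evalAt_mulMon (p : ℂ × ℕ) (g : LogPoly W₁) (x : W₂) :
    evalAt 𝒴 (mulMon p g) x = LogSeries.mulMonomial p (evalAt 𝒴 g x) := by
  induction g using Finsupp.induction_linear with
  | zero => simp
  | add f g hf hg => simp only [map_add, LinearMap.add_apply, hf, hg]
  | single q w => rw [mulMon_single, evalAt_single, evalAt_single, mulMonomial_mulMonomial]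

theorem evalAt_invVar (g : LogPoly W₁) (x : W₂) :
    evalAt 𝒴 (invVar g) x = LogSeries.substInv (evalAtInv 𝒴 g x) := by
  induction g using Finsupp.induction_linear with
  | zero => simp
  | add f g hf hg => simp only [map_add, LinearMap.add_apply, hf, hg]
  | single q w =>
    rw [invVar_single, evalAtInv_single, map_smul, LinearMap.smul_apply, evalAt_single,
      substInv_mulMonomial_substInv]

theorem evalAtInv_add (𝒵 : W₁ →ₗ[ℂ] W₂ →ₗ[ℂ] LogSeries W₃) (g : LogPoly W₁) (x : W₂) :
    evalAtInv (𝒴 + 𝒵) g x = evalAtInv 𝒴 g x + evalAtInv 𝒵 g x := by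
  induction g using Finsupp.induction_linear with
  | zero => simp
  | add f g hf hg =>
    simp only [map_add, LinearMap.add_apply, hf, hg]
    abel
  | single q w => simp only [evalAtInv_single, LinearMap.add_apply, map_add]

theorem evalAtInv_smul (c : ℂ) (g : LogPoly W₁) (x : W₂) :
    evalAtInv (c • 𝒴) g x = c • evalAtInv 𝒴 g x := by
  induction g using Finsupp.induction_linear with
  | zero => simp
  | add f g hf hg => simp only [map_add, LinearMap.add_apply, hf, hg, smul_add]
  | single q w => simp only [evalAtInv_single, LinearMap.smul_apply, map_smul]

end EvalAt

/-! ### Functoriality -/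

section Functoriality

variable {B V W₁ W₂ W₃ U₂ U₃ : Type*} [AddCommGroup V] [Module ℂ V]
  [AddCommGroup W₁] [Module ℂ W₁] [AddCommGroup W₂] [Module ℂ W₂] [AddCommGroup W₃] [Module ℂ W₃]
  [AddCommGroup U₂] [Module ℂ U₂] [AddCommGroup U₃] [Module ℂ U₃]

/-- The action of a linear map on the coefficients of a series. -/
def mapSeries (T : W₂ →ₗ[ℂ] W₃) : LogSeries W₂ →ₗ[ℂ] LogSeries W₃ where
  toFun f n k := T (f n k)
  map_add' f g := by ext n k; simp
  map_smul' c f := by ext n k; simp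

/-- The composition of `𝒴` with linear maps `W₂ → U₂` and `U₃ → W₃`. -/
def compIntertwining (e₂ : W₂ →ₗ[ℂ] U₂) (e₃ : U₃ →ₗ[ℂ] W₃)
    (𝒴 : W₁ →ₗ[ℂ] U₂ →ₗ[ℂ] LogSeries U₃) : W₁ →ₗ[ℂ] W₂ →ₗ[ℂ] LogSeries W₃ :=
  (𝒴.compl₂ e₂).compr₂ (mapSeries e₃)

theorem compIntertwining_apply (e₂ : W₂ →ₗ[ℂ] U₂) (e₃ : U₃ →ₗ[ℂ] W₃)
    (𝒴 : W₁ →ₗ[ℂ] U₂ →ₗ[ℂ] LogSeries U₃) (w : W₁) (x : W₂) (n : ℂ) (k : ℕ) :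
    compIntertwining e₂ e₃ 𝒴 w x n k = e₃ (𝒴 w (e₂ x) n k) := rfl

theorem component_compIntertwining (e₂ : W₂ →ₗ[ℂ] U₂) (e₃ : U₃ →ₗ[ℂ] W₃)
    (𝒴 : W₁ →ₗ[ℂ] U₂ →ₗ[ℂ] LogSeries U₃) (w : W₁) (x : W₂) (n : ℂ) (k : ℕ) :
    component (compIntertwining e₂ e₃ 𝒴) k w n x = e₃ (component 𝒴 k w n (e₂ x)) := rfl

theorem evalAtInv_compIntertwining (e₂ : W₂ →ₗ[ℂ] U₂) (e₃ : U₃ →ₗ[ℂ] W₃)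
    (𝒴 : W₁ →ₗ[ℂ] U₂ →ₗ[ℂ] LogSeries U₃) (g : LogPoly W₁) (x : W₂) (n : ℂ) (k : ℕ) :
    evalAtInv (compIntertwining e₂ e₃ 𝒴) g x n k = e₃ (evalAtInv 𝒴 g (e₂ x) n k) := by
  induction g using Finsupp.induction_linear with
  | zero => simp
  | add f g hf hg => simp only [map_add, LinearMap.add_apply, Pi.add_apply, hf, hg]
  | single p w =>
    rw [evalAtInv_single, evalAtInv_single]
    change (if p.2 ≤ k then ((-1 : ℂ) ^ (k - p.2)) •
        compIntertwining e₂ e₃ 𝒴 w x (-(n - p.1)) (k - p.2) else 0)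
      = e₃ (if p.2 ≤ k then ((-1 : ℂ) ^ (k - p.2)) • 𝒴 w (e₂ x) (-(n - p.1)) (k - p.2) else 0)
    rw [compIntertwining_apply]
    split_ifs <;> simp

/-- Every axiom is linear in the source and target modules, so it survives composition with maps
commuting with the actions and preserving degrees. It serves to replace W₂'' and W₃'' by W₂ and W₃.
-/
theorem compIntertwining_mem [AddCommGroup B] {M₁ : ModData B V W₁} {M₂ : ModData B V W₂}
    {M₃ : ModData B V W₃} {N₂ : ModData B V U₂} {N₃ : ModData B V U₃} {e₂ : W₂ →ₗ[ℂ] U₂}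
    {e₃ : U₃ →ₗ[ℂ] W₃} (hY₂ : ∀ v n w, e₂ (M₂.Y v n w) = N₂.Y v n (e₂ w))
    (hL₂ : ∀ j w, e₂ (M₂.L j w) = N₂.L j (e₂ w)) (hg₂ : ∀ β, ∀ w ∈ M₂.gr β, e₂ w ∈ N₂.gr β)
    (hY₃ : ∀ v n w, e₃ (N₃.Y v n w) = M₃.Y v n (e₃ w))
    (hL₃ : ∀ j w, e₃ (N₃.L j w) = M₃.L j (e₃ w)) (hg₃ : ∀ β, ∀ w ∈ N₃.gr β, e₃ w ∈ M₃.gr β)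
    {𝒴 : W₁ →ₗ[ℂ] U₂ →ₗ[ℂ] LogSeries U₃} (h : 𝒴 ∈ intertwiningSpace M₁ N₂ N₃) :
    compIntertwining e₂ e₃ 𝒴 ∈ intertwiningSpace M₁ M₂ M₃ := by
  obtain ⟨h, hg⟩ := h
  refine ⟨⟨fun w x n => ?_, fun w x n => ?_, fun v k l m n w x => ?_, fun w x => ?_,
    fun k w n x => ?_⟩, fun β γ w hw x hx n k => ?_⟩
  · refine (h.isLogPolynomial w (e₂ x) n).subset fun k hk h0 => hk ?_
    rw [compIntertwining_apply, h0, map_zero]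
  · obtain ⟨N, hN⟩ := h.truncation w (e₂ x) n
    exact ⟨N, fun m hm k => by rw [component_compIntertwining, hN m hm, map_zero]⟩
  · filter_upwards [h.jacobi v k l m n w (e₂ x)] with N hN
    have h2 := congrArg e₃ hN
    simp only [map_sub, map_sum, map_smul, hY₃] at h2
    simpa only [component_compIntertwining, hY₂] using h2
  · ext n k
    rw [compIntertwining_apply, h.derivative]
    simp only [LogSeries.deriv, compIntertwining_apply, map_add, map_smul]
  · obtain ⟨a, b, c⟩ := h.bracket k w n (e₂ x)
    simp only [component_compIntertwining, hL₂, ← hL₃, ← map_smul, ← map_sub, ← map_add]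
    rw [a, b, c]
    exact ⟨rfl, rfl, rfl⟩
  · exact hg₃ _ _ (hg β γ w hw _ (hg₂ γ x hx) n k)

end Functoriality

/-! ### A_r and A_{-r-1} are inverse to each other -/

section ContragredientEquiv

variable {B V W₁ W₂ W₃ : Type*} [AddCommGroup B] {A : AddSubgroup B} [AddCommGroup V] [Module ℂ V]
  [AddCommGroup W₁] [Module ℂ W₁] [AddCommGroup W₂] [Module ℂ W₂]
  [AddCommGroup W₃] [Module ℂ W₃] {κ : Kind V} {D : VertexData A V}
  {M₁ : ModData B V W₁} {M₂ : ModData B V W₂} {M₃ : ModData B V W₃}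

theorem contragredientOperator_eval (h₁ : IsStronglyGradedModule κ D M₁) (r : ℤ)
    (𝒴 : W₁ →ₗ[ℂ] W₂ →ₗ[ℂ] LogSeries W₃) (w : W₁) (f : M₃.dualSpace) (n : ℂ) (k : ℕ) (x : W₂) :
    contragredientOperator h₁ M₃ r 𝒴 w f n k x
      = (f : Module.Dual ℂ W₃) (evalAtInv 𝒴 (contragredientArg h₁ r w) x n k) := rfl

/-- Evaluating A_r(𝒴) at x⁻¹ undoes the x⁻¹ in its definition, so 𝒴 appears at x, with its argument
acted on by the argument map taken at x⁻¹. -/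
theorem evalAtInv_contragredient (h₁ : IsStronglyGradedModule κ D M₁) {r : ℤ}
    {𝒴 : W₁ →ₗ[ℂ] W₂ →ₗ[ℂ] LogSeries W₃} {𝒵 : W₁ →ₗ[ℂ] M₃.dualSpace →ₗ[ℂ] LogSeries M₂.dualSpace}
    (h : ∀ w f n k, (𝒵 w f n k : Module.Dual ℂ W₂) = contragredientOperator h₁ M₃ r 𝒴 w f n k)
    (g : LogPoly W₁) (f : M₃.dualSpace) (n : ℂ) (k : ℕ) (x : W₂) :
    (evalAtInv 𝒵 g f n k : Module.Dual ℂ W₂) x = (f : Module.Dual ℂ W₃)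
      (evalAt 𝒴 (LogPoly.apply (invVar ∘ₗ contragredientArg h₁ r) g) x n k) := by
  induction g using Finsupp.induction_linear with
  | zero => simp
  | add f g hf hg =>
    simp only [map_add, LinearMap.add_apply, Pi.add_apply, Submodule.coe_add, hf, hg]
  | single p w =>
    rw [evalAtInv_single, LogPoly.apply_single, evalAt_mulMon, LinearMap.comp_apply, evalAt_invVar]
    change ((if p.2 ≤ k then ((-1 : ℂ) ^ (k - p.2)) • 𝒵 w f (-(n - p.1)) (k - p.2) else 0 :
        M₂.dualSpace) : Module.Dual ℂ W₂) x
      = (f : Module.Dual ℂ W₃) (if p.2 ≤ k then ((-1 : ℂ) ^ (k - p.2)) •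
        evalAtInv 𝒴 (contragredientArg h₁ r w) x (-(n - p.1)) (k - p.2) else 0)
    split_ifs
    · rw [Submodule.coe_smul, LinearMap.smul_apply, h, contragredientOperator_eval, map_smul]
    · simp

theorem evalAtInv_contragredientArg (h₁ : IsStronglyGradedModule κ D M₁) {r s : ℤ}
    (hrs : r + s = -1) {𝒴 : W₁ →ₗ[ℂ] W₂ →ₗ[ℂ] LogSeries W₃}
    {𝒵 : W₁ →ₗ[ℂ] M₃.dualSpace →ₗ[ℂ] LogSeries M₂.dualSpace}
    (h : ∀ w f n k, (𝒵 w f n k : Module.Dual ℂ W₂) = contragredientOperator h₁ M₃ r 𝒴 w f n k)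
    (w : W₁) (f : M₃.dualSpace) (n : ℂ) (k : ℕ) (x : W₂) :
    (evalAtInv 𝒵 (contragredientArg h₁ s w) f n k : Module.Dual ℂ W₂) x
      = (f : Module.Dual ℂ W₃) (𝒴 w x n k) := by
  rw [evalAtInv_contragredient h₁ h, apply_invVar_contragredientArg h₁ hrs, evalAt_single]
  change (f : Module.Dual ℂ W₃) (if 0 ≤ k then 𝒴 w x (n - 0) (k - 0) else 0) = _
  simp

variable (hD : IsStronglyGradedVertexAlgebra κ D) (h₁ : IsStronglyGradedModule κ D M₁)
  (h₂ : IsStronglyGradedModule κ D M₂) (h₃ : IsStronglyGradedModule κ D M₃)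

theorem contragredientOperator_contragredientOperator {r s : ℤ}
    (hrs : r + s = -1) {𝒴 : W₁ →ₗ[ℂ] W₂ →ₗ[ℂ] LogSeries W₃}
    {𝒵 : W₁ →ₗ[ℂ] M₃.dualSpace →ₗ[ℂ] LogSeries M₂.dualSpace}
    (h : ∀ w f n k, (𝒵 w f n k : Module.Dual ℂ W₂) = contragredientOperator h₁ M₃ r 𝒴 w f n k)
    (w : W₁) (x : W₂) (n : ℂ) (k : ℕ) :
    contragredientOperator h₁ (contragredient hD h₂) s 𝒵 w (doubleEquiv hD h₂ x) n k
      = (doubleEquiv hD h₃ (𝒴 w x n k) : Module.Dual ℂ M₃.dualSpace) := by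
  ext f
  rw [contragredientOperator_eval, doubleEquiv_apply, doubleEquiv_apply,
    evalAtInv_contragredientArg h₁ hrs h]

/-- The map `𝒴 ↦ A_r(𝒴)`. -/
noncomputable def contragredientLinear (r : ℤ) : intertwiningSpace M₁ M₂ M₃ →ₗ[ℂ]
    intertwiningSpace M₁ (contragredient hD h₃) (contragredient hD h₂) where
  toFun 𝒴 := ⟨contragredientHom h₁ 𝒴.2.1 𝒴.2.2 r,
    contragredientHom_isLogIntertwining hD h₁ h₂ h₃ 𝒴.2.1 𝒴.2.2 r,
    contragredientHom_isGradingCompatible hD h₁ h₂ h₃ 𝒴.2.1 𝒴.2.2 r⟩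
  map_add' 𝒴 𝒵 := by
    ext w f n k x
    refine Eq.trans (congrArg (fun y : LogSeries W₃ => (f : Module.Dual ℂ W₃) (y n k))
      (evalAtInv_add 𝒴.1 𝒵.1 (contragredientArg h₁ r w) x)) (map_add _ _ _)
  map_smul' c 𝒴 := by
    ext w f n k x
    refine Eq.trans (congrArg (fun y : LogSeries W₃ => (f : Module.Dual ℂ W₃) (y n k))
      (evalAtInv_smul 𝒴.1 c (contragredientArg h₁ r w) x)) (map_smul _ _ _)

theorem coe_contragredientLinear (r : ℤ) (𝒴 : intertwiningSpace M₁ M₂ M₃) (w : W₁)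
    (f : M₃.dualSpace) (n : ℂ) (k : ℕ) :
    ((contragredientLinear hD h₁ h₂ h₃ r 𝒴).1 w f n k : Module.Dual ℂ W₂)
      = contragredientOperator h₁ M₃ r 𝒴.1 w f n k := rfl

theorem contragredientLinear_injective (r : ℤ) :
    Function.Injective (contragredientLinear hD h₁ h₂ h₃ r) := by
  intro 𝒴 𝒵 heq
  -- 𝒴 is recovered from A_r(𝒴) by applying A_{-r-1} and the inverse of W₃ = W₃''.
  have key : ∀ 𝒴 : intertwiningSpace M₁ M₂ M₃, ∀ w x n k, 𝒴.1 w x n k = (doubleEquiv hD h₃).symm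
      ⟨_, contragredientOperator_mem_dualSpace h₁ (contragredientLinear hD h₁ h₂ h₃ r 𝒴).2.1
        (contragredientLinear hD h₁ h₂ h₃ r 𝒴).2.2 (-r - 1) w (doubleEquiv hD h₂ x) n k⟩ := by
    intro 𝒴 w x n k
    rw [LinearEquiv.eq_symm_apply]
    exact Subtype.ext (contragredientOperator_contragredientOperator hD h₁ h₂ h₃ (by ring)
      (coe_contragredientLinear hD h₁ h₂ h₃ r 𝒴) w x n k).symm
  ext w x n k
  rw [key 𝒴, key 𝒵]
  simp only [heq]

theorem contragredientLinear_surjective (r : ℤ) :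
    Function.Surjective (contragredientLinear hD h₁ h₂ h₃ r) := by
  intro 𝒵
  have h₂' := isStronglyGradedModule_contragredient hD h₂
  have h₃' := isStronglyGradedModule_contragredient hD h₃
  -- The preimage of 𝒵 is A_{-r-1}(𝒵), which maps W₂'' to W₃'' and is then transported along W₂ =
  -- W₂'' and W₃ = W₃''.
  obtain ⟨𝒳, h𝒳⟩ : ∃ 𝒳 : intertwiningSpace M₁ (contragredient hD h₂') (contragredient hD h₃'),
      ∀ w f n k, (𝒳.1 w f n k : Module.Dual ℂ M₃.dualSpace)
        = contragredientOperator h₁ (contragredient hD h₂) (-r - 1) 𝒵.1 w f n k :=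
    ⟨contragredientLinear hD h₁ h₃' h₂' (-r - 1) 𝒵, fun w f n k =>
      coe_contragredientLinear hD h₁ h₃' h₂' (-r - 1) 𝒵 w f n k⟩
  refine ⟨⟨compIntertwining (doubleEquiv hD h₂).toLinearMap (doubleEquiv hD h₃).symm.toLinearMap
    𝒳.1, compIntertwining_mem (doubleEquiv_Y hD h₂) (doubleEquiv_L hD h₂)
      (fun β w hw => (doubleEquiv_mem_gr hD h₂).2 hw) (fun v n w => ?_) (fun j w => ?_)
      (fun β w hw => ?_) 𝒳.2⟩, ?_⟩
  · refine (LinearEquiv.symm_apply_eq _).2 ?_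
    rw [doubleEquiv_Y, LinearEquiv.coe_coe, LinearEquiv.apply_symm_apply]
  · refine (LinearEquiv.symm_apply_eq _).2 ?_
    rw [doubleEquiv_L, LinearEquiv.coe_coe, LinearEquiv.apply_symm_apply]
  · refine (doubleEquiv_mem_gr hD h₃).1 ?_
    rwa [LinearEquiv.coe_coe, LinearEquiv.apply_symm_apply]
  · ext w f n k x
    have hf : ∀ φ : (contragredient hD h₃).dualSpace, (f : Module.Dual ℂ W₃)
        ((doubleEquiv hD h₃).symm φ) = (φ : Module.Dual ℂ M₃.dualSpace) f := by
      intro φ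
      rw [← doubleEquiv_apply hD h₃, LinearEquiv.apply_symm_apply]
    rw [coe_contragredientLinear, contragredientOperator_eval, evalAtInv_compIntertwining]
    refine (hf _).trans ?_
    have hrs : -r - 1 + r = -1 := by ring
    have := evalAtInv_contragredientArg (M₂ := contragredient hD h₃)
      (M₃ := contragredient hD h₂) h₁ hrs h𝒳 w (doubleEquiv hD h₂ x) n k f
    rw [doubleEquiv_apply] at this
    exact this

/-- The linear isomorphism `𝒴 ↦ A_r(𝒴)`. -/
noncomputable def contragredientEquiv (r : ℤ) : intertwiningSpace M₁ M₂ M₃ ≃ₗ[ℂ]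
    intertwiningSpace M₁ (contragredient hD h₃) (contragredient hD h₂) :=
  LinearEquiv.ofBijective (contragredientLinear hD h₁ h₂ h₃ r)
    ⟨contragredientLinear_injective hD h₁ h₂ h₃ r, contragredientLinear_surjective hD h₁ h₂ h₃ r⟩

end ContragredientEquiv

end LogVA

/-! ### The main theorem -/

theorem proposition3p46 {B V W₁ W₂ W₃ : Type*} [AddCommGroup B] {A : AddSubgroup B}
    [AddCommGroup V] [Module ℂ V] [AddCommGroup W₁] [Module ℂ W₁]
    [AddCommGroup W₂] [Module ℂ W₂] [AddCommGroup W₃] [Module ℂ W₃]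
    (κ : Kind V) (D : VertexData A V) (hD : IsStronglyGradedVertexAlgebra κ D)
    (M₁ : ModData B V W₁) (M₂ : ModData B V W₂) (M₃ : ModData B V W₃)
    (h₁ : IsStronglyGradedModule κ D M₁) (h₂ : IsStronglyGradedModule κ D M₂)
    (h₃ : IsStronglyGradedModule κ D M₃) :
    IsStronglyGradedModule κ D (contragredient hD h₂) ∧
    IsStronglyGradedModule κ D (contragredient hD h₃) ∧
    (∃ (Φ : ℤ → intertwiningSpace M₁ M₂ M₃ ≃ₗ[ℂ]
          intertwiningSpace M₁ (contragredient hD h₃) (contragredient hD h₂))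
        (θ₂ : W₂ ≃ₗ[ℂ] (contragredient hD h₂).dualSpace)
        (θ₃ : W₃ ≃ₗ[ℂ] (contragredient hD h₃).dualSpace),
      (∀ (w₂ : W₂) (f : M₂.dualSpace),
        (θ₂ w₂ : Module.Dual ℂ M₂.dualSpace) f = (f : Module.Dual ℂ W₂) w₂) ∧
      (∀ (w₃ : W₃) (f : M₃.dualSpace),
        (θ₃ w₃ : Module.Dual ℂ M₃.dualSpace) f = (f : Module.Dual ℂ W₃) w₃) ∧
      (∀ (r : ℤ) (𝒴 : intertwiningSpace M₁ M₂ M₃) (w₁ : W₁) (w₃' : M₃.dualSpace) (n : ℂ) (k : ℕ),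
        ((Φ r 𝒴).1 w₁ w₃' n k : Module.Dual ℂ W₂)
          = contragredientOperator h₁ M₃ r 𝒴.1 w₁ w₃' n k) ∧
      (∀ (r : ℤ) (𝒴 : intertwiningSpace M₁ M₂ M₃) (w₁ : W₁) (w₂ : W₂) (n : ℂ) (k : ℕ),
        contragredientOperator h₁ (contragredient hD h₂) (-r - 1) (Φ r 𝒴).1 w₁ (θ₂ w₂) n k
            = (θ₃ (𝒴.1 w₁ w₂ n k) : Module.Dual ℂ M₃.dualSpace) ∧
        contragredientOperator h₁ (contragredient hD h₂) r (Φ (-r - 1) 𝒴).1 w₁ (θ₂ w₂) n k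
            = (θ₃ (𝒴.1 w₁ w₂ n k) : Module.Dual ℂ M₃.dualSpace))) ∧
    fusionRule M₁ M₂ M₃ = fusionRule M₁ (contragredient hD h₃) (contragredient hD h₂) := by
  refine ⟨isStronglyGradedModule_contragredient hD h₂, isStronglyGradedModule_contragredient hD h₃,
    ⟨contragredientEquiv hD h₁ h₂ h₃, doubleEquiv hD h₂, doubleEquiv hD h₃, fun _ _ => rfl,
      fun _ _ => rfl, coe_contragredientLinear hD h₁ h₂ h₃, fun r 𝒴 w₁ w₂ n k => ⟨?_, ?_⟩⟩,
    -- Any r would do; 0 is an arbitrary choice.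
    (contragredientEquiv hD h₁ h₂ h₃ 0).rank_eq⟩
  · exact contragredientOperator_contragredientOperator hD h₁ h₂ h₃ (by ring)
      (coe_contragredientLinear hD h₁ h₂ h₃ r 𝒴) w₁ w₂ n k
  · exact contragredientOperator_contragredientOperator hD h₁ h₂ h₃ (by ring)
      (coe_contragredientLinear hD h₁ h₂ h₃ (-r - 1) 𝒴) w₁ w₂ n k
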